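/- **Setting.** An instance of the random order covering integer program (RO-CIP) consists of costs $c\in\mathbb R^m$ with $c_j>0$ and a matrix $A\in\mathbb R^{n\times m}$ with nonnegative entries in which every row has a positive entry; the problem is to minimize $\langle c,z\rangle$ subject to $Az\ge 1$, $z\in\mathbb Z_+^m$. The numbers $m$ and $c$ are known in advance; the rows $a_i$ of $A$ are chosen adversarially and revealed one at a time in uniformly random order; the number $n$ of rows is not known to the algorithm. The solution $z$ may only be increased, and must after every round be feasible for the rows revealed so far. Let $\mathrm{OPT}$ be the optimal value of the integer program and $\mathrm{LP}$ that of its relaxation to $z\in\mathbb R_{\ge0}^m$. Algorithms run on a randomized real RAM: arithmetic, memory access, comparison, floor, exponential and the toss of a coin $\mathrm{Ber}(p)$ cost one step each. **Algorithm LearnOrCoverCIP.** Assume $a_{ij}\in[0,1]$ and let $\beta$ be a given number with $\mathrm{LP}\le\beta\le 2\,\mathrm{LP}$. Put $\gamma=1/(e-1)$ and $m'=|\{j:c_j\le\beta\}|$. Start with $z=0$ and $x_j=\frac{\beta}{c_jm'}$ if $c_j\le\beta$, $x_j=0$ otherwise. When row $i$ arrives, let $\Delta=\max(0,1-\langle a_i,z\rangle)$.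 If $\Delta\le\gamma$, do nothing. If $\Delta>\gamma$, let $\kappa=\Delta\cdot\min_k c_k/a_{ik}$ (over $k$ with $a_{ik}>0$), let $k^*$ be the first minimizer, and let $y=\kappa x/\beta$, for the vector $x$ held at the start of the round; then 1. add $\lfloor y_j\rfloor+\mathrm{Ber}(y_j-\lfloor y_j\rfloor)$ to $z_j$, independently for all $j$; 2. if $\langle a_i,x\rangle<\Delta$, multiply each $x_j$ by $\exp(\kappa a_{ij}/c_j)$ and then divide $x$ by $\langle c,x\rangle/\beta$; 3. add $\lceil\Delta/a_{ik^*}\rceil$ to $z_{k^*}$. **Theorem.** There are an absolute constant $C$ and a polynomial $p$ such that the following hold. (a) For all instances with $a_{ij}\in[0,1]$ and all $\beta$ with $\mathrm{LP}\le\beta\le2\,\mathrm{LP}$: for every arrival order and every outcome of the coins, $z$ only increases, and after each round $3z$ is feasible for all rows revealed so far (so the final $3z$ is feasible). LearnOrCoverCIP is carried out by a single program (the same for all instances) in at most $p(m+n)$ steps in total. If $mn\ge2$, then the final solution satisfies $\mathbb E\langle c,z\rangle\le C\,\beta\log(mn)$, and therefore $\mathbb E\langle c,3z\rangle\le C\log(mn)\cdot\mathrm{OPT}$;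 the expectation is over the random order and the coins. (b) Consequently RO-CIP has an $O(\log(mn))$-competitive polynomial-time randomized online algorithm that is not given $\beta$: there is a program which, on every instance, takes at most $p(m+n)$ steps in total for every arrival order and every outcome of its coins, holds a solution $z\in\mathbb Z_+^m$ that only increases and that after each round satisfies all the rows revealed so far, and for $mn\ge 2$ its final solution has $\mathbb E\langle c,z\rangle\le C\log(mn)\cdot\mathrm{OPT}$. -/

import Mathlib

open scoped ENNReal

noncomputable section

namespace CoveringIP

/-! ## Covering programs and their optimal values -/

/-- The inner product `⟨c, x⟩`. -/
def dot {m : ℕ} (c x : Fin m → ℝ) : ℝ := ∑ j, c j * x j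

/-- An integer vector `z ∈ ℤ₊ᵐ`, read as a real vector. -/
def toReal {m : ℕ} (z : Fin m → ℕ) : Fin m → ℝ := fun j => (z j : ℝ)

/-- Optimal value of the LP relaxation `min ⟨c, x⟩` subject to `A x ≥ 1`, `x ≥ 0`. -/
def lpOpt {m n : ℕ} (A : Fin n → Fin m → ℝ) (c : Fin m → ℝ) : ℝ :=
  sInf {v | ∃ x : Fin m → ℝ, (∀ j, 0 ≤ x j) ∧ (∀ i, 1 ≤ dot (A i) x) ∧ v = dot c x}

/-- Optimal value of the covering integer program `min ⟨c, z⟩` subject to `A z ≥ 1`, `z ∈ ℤ₊ᵐ`. -/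
def ipOpt {m n : ℕ} (A : Fin n → Fin m → ℝ) (c : Fin m → ℝ) : ℝ :=
  sInf {v | ∃ z : Fin m → ℕ, (∀ i, 1 ≤ dot (A i) (toReal z)) ∧ v = dot c (toReal z)}

/-! ## Probability -/

/-- `p` clipped to `[0, 1]`. -/
def clip (p : ℝ) : ℝ := max 0 (min p 1)

theorem clip_add (p : ℝ) :
    ENNReal.ofReal (clip p) + ENNReal.ofReal (1 - clip p) = 1 := by
  have h0 : 0 ≤ clip p := le_max_left _ _
  have h1 : clip p ≤ 1 := max_le zero_le_one (min_le_right _ _)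
  rw [← ENNReal.ofReal_add h0 (by linarith)]
  simp

/-- The coin `Ber(p)`. -/
def coin (p : ℝ) : PMF Bool :=
  PMF.ofFintype (fun b => cond b (ENNReal.ofReal (clip p)) (ENNReal.ofReal (1 - clip p)))
    (by simpa using clip_add p)

/-- Independent coins, the `j`-th one being `Ber(p j)`. -/
def coins {m : ℕ} (p : Fin m → ℝ) : PMF (Fin m → Bool) :=
  PMF.ofFintype (fun b => ∏ j, coin (p j) (b j)) (by
    rw [← Fintype.prod_sum (fun j b => coin (p j) b)]
    refine Finset.prod_eq_one fun j _ => ?_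
    have h := (coin (p j)).tsum_coe
    rwa [tsum_fintype] at h)

/-- The expectation of a nonnegative function. -/
def expect {S : Type*} (p : PMF S) (f : S → ℝ) : ℝ≥0∞ := ∑' s, p s * ENNReal.ofReal (f s)

/-- The law of the sequence of states of an online randomized procedure on the requests
`r 0, …, r (n-1)`: entry `0` is the initial state, and entry `t + 1` is the state after request `t`
was served. In each round the procedure sees only its own state and the current request. -/
def trajectory {S R : Type*} (serve : R → S → PMF S) :
    (n : ℕ) → S → (Fin n → R) → PMF (Fin (n + 1) → S)
  | 0, s, _ => PMF.pure fun _ => s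
  | n + 1, s, r => (serve (r 0) s).bind fun s' =>
      (trajectory serve n s' (Fin.tail r)).map fun h => Fin.cons s h

/-- The law of an outcome that depends on the arrival order, when the order is uniformly random. -/
def randomOrder {S : Type*} (n : ℕ) (p : Equiv.Perm (Fin n) → PMF S) : PMF S :=
  (PMF.uniformOfFintype (Equiv.Perm (Fin n))).bind p

/-- A history `z` of solutions (`z 0` initial, `z (t+1)` after the `t`-th row `r t` was served) is an
online solution if it only ever increases and if after every round `k` times the current solution
satisfies all the rows revealed so far. -/
def IsOnlineSolution {m n : ℕ} (k : ℕ) (r : Fin n → Fin m → ℝ) (z : Fin (n + 1) → Fin m → ℕ) :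
    Prop :=
  Monotone z ∧ ∀ t s : Fin n, s ≤ t → 1 ≤ dot (r s) (toReal fun j => k * z t.succ j)

/-! ## The algorithm LearnOrCoverCIP -/

/-- The threshold `γ = 1 / (e - 1)`. -/
def threshold : ℝ := (Real.exp 1 - 1)⁻¹

/-- The state of the algorithm: the fractional vector `x` and the integer solution `z`. -/
structure LocState (m : ℕ) where
  x : Fin m → ℝ
  z : Fin m → ℕ

/-- The extent `Δ = max (0, 1 - ⟨a, z⟩)` to which the row `a` is uncovered by `z`. -/
def deficit {m : ℕ} (a : Fin m → ℝ) (z : Fin m → ℕ) : ℝ := max 0 (1 - dot a (toReal z))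

/-- `min_k c_k / a_k`, where columns with `a_k = 0` have ratio `+∞` and so are left out. -/
def minRatio {m : ℕ} (c a : Fin m → ℝ) : ℝ := ⨅ k : {k : Fin m // 0 < a k}, c k / a k

/-- `j` is the (first) minimizer of `c_k / a_k`. -/
def IsArgmin {m : ℕ} (c a : Fin m → ℝ) (j : Fin m) : Prop :=
  0 < a j ∧ (∀ k, 0 < a k → c j / a j ≤ c k / a k) ∧ ∀ k < j, 0 < a k → c j / a j < c k / a k

/-- `x⁰_j = β / (c_j m') · 𝟙{c_j ≤ β}` with `m' = |{j : c_j ≤ β}|`, and `z⁰ = 0`. -/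
def locInit {m : ℕ} (β : ℝ) (c : Fin m → ℝ) : LocState m where
  x := fun j => if c j ≤ β then β / (c j * (Finset.univ.filter fun k => c k ≤ β).card) else 0
  z := 0

/-- Multiplicative update of `x` with rate `κ`, followed by normalization to cost `β`. -/
def learn {m : ℕ} (β : ℝ) (c a : Fin m → ℝ) (κ : ℝ) (x : Fin m → ℝ) : Fin m → ℝ :=
  let w : Fin m → ℝ := fun j => x j * Real.exp (κ * (a j / c j))
  fun j => w j / (dot c w / β)

open Classical in
/-- One round of the algorithm, on the arrival of the row `a`. -/
def locRound {m : ℕ} (β : ℝ) (c a : Fin m → ℝ) (s : LocState m) : PMF (LocState m) :=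
  let Δ := deficit a s.z
  let κ := Δ * minRatio c a
  let y : Fin m → ℝ := fun j => κ * s.x j / β
  if threshold < Δ then
    (coins fun j => Int.fract (y j)).map fun b =>
      { x := if dot a s.x < Δ then learn β c a κ s.x else s.x
        z := fun j => s.z j + (⌊y j⌋₊ + (b j).toNat) + if IsArgmin c a j then ⌈Δ / a j⌉₊ else 0 }
  else PMF.pure s

/-- The law of the history `z⁰, z¹, …, zⁿ` of integer solutions held by LearnOrCoverCIP with the
parameter `β` when the rows arrive as `r 0, …, r (n-1)`. -/
def learnOrCover {m n : ℕ} (β : ℝ) (c : Fin m → ℝ) (r : Fin n → Fin m → ℝ) :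
    PMF (Fin (n + 1) → Fin m → ℕ) :=
  (trajectory (locRound β c) n (locInit β c) r).map fun h t => (h t).z

/-! ## A randomized real random access machine with a step count

The memory consists of arrays of natural numbers and arrays of reals, indexed by natural numbers.
Programs are built from assignments, coin tosses, comparisons and `for` loops. Each arithmetic
operation, memory access, assignment, floor, exponential, comparison, coin toss and loop iteration
is charged at unit cost. -/

/-- The memory of the machine, and a clock that programs cannot read. -/
structure Config where
  int : ℕ → ℕ → ℕ
  real : ℕ → ℕ → ℝ
  clock : ℕ

/-- Integer expressions; `get a i` is the entry of the integer array `a` at index `i`, and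
`sub` is truncated at `0`. -/
inductive IExpr where
  | lit (k : ℕ)
  | get (a : ℕ) (i : IExpr)
  | add (e f : IExpr)
  | sub (e f : IExpr)
  | mul (e f : IExpr)

/-- Real expressions; `get a i` is the entry of the real array `a` at index `i`. -/
inductive RExpr where
  | ofInt (e : IExpr)
  | get (a : ℕ) (i : IExpr)
  | add (e f : RExpr)
  | sub (e f : RExpr)
  | mul (e f : RExpr)
  | div (e f : RExpr)
  | exp (e : RExpr)

/-- Commands. -/
inductive Cmd where
  /-- Do nothing. -/
  | skip
  /-- Store `e` in the integer array `a` at index `i`. -/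
  | setInt (a : ℕ) (i : IExpr) (e : IExpr)
  /-- Store `e` in the real array `a` at index `i`. -/
  | setReal (a : ℕ) (i : IExpr) (e : RExpr)
  /-- Store `⌊e⌋` (or `0` if `e < 0`) in the integer array `a` at index `i`. -/
  | setFloor (a : ℕ) (i : IExpr) (e : RExpr)
  /-- Store the outcome of a fresh coin `Ber(p)` in the integer array `a` at index `i`. -/
  | toss (a : ℕ) (i : IExpr) (p : RExpr)
  /-- First `f`, then `g`. -/
  | seq (f g : Cmd)
  /-- If `d < e` then `f` else `g`. -/
  | ifLt (d e : RExpr) (f g : Cmd)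
  /-- For `k = 0, …, e - 1`: store `k` in the integer array `a` at index `0`, then do `f`. The bound
  `e` is evaluated once, at the start. -/
  | loop (a : ℕ) (e : IExpr) (f : Cmd)

def IExpr.eval (s : Config) : IExpr → ℕ
  | .lit k => k
  | .get a i => s.int a (i.eval s)
  | .add e f => e.eval s + f.eval s
  | .sub e f => e.eval s - f.eval s
  | .mul e f => e.eval s * f.eval s

/-- The number of operations in an expression. -/
def IExpr.size : IExpr → ℕ
  | .lit _ => 1
  | .get _ i => i.size + 1
  | .add e f => e.size + f.size + 1
  | .sub e f => e.size + f.size + 1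
  | .mul e f => e.size + f.size + 1

def RExpr.eval (s : Config) : RExpr → ℝ
  | .ofInt e => (e.eval s : ℝ)
  | .get a i => s.real a (i.eval s)
  | .add e f => e.eval s + f.eval s
  | .sub e f => e.eval s - f.eval s
  | .mul e f => e.eval s * f.eval s
  | .div e f => e.eval s / f.eval s
  | .exp e => Real.exp (e.eval s)

/-- The number of operations in an expression. -/
def RExpr.size : RExpr → ℕ
  | .ofInt e => e.size + 1
  | .get _ i => i.size + 1
  | .add e f => e.size + f.size + 1
  | .sub e f => e.size + f.size + 1
  | .mul e f => e.size + f.size + 1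
  | .div e f => e.size + f.size + 1
  | .exp e => e.size + 1

def Config.tick (s : Config) (k : ℕ) : Config := { s with clock := s.clock + k }

def Config.putInt (s : Config) (a i v : ℕ) : Config :=
  { s with int := Function.update s.int a (Function.update (s.int a) i v) }

def Config.putReal (s : Config) (a i : ℕ) (v : ℝ) : Config :=
  { s with real := Function.update s.real a (Function.update (s.real a) i v) }

/-- Run `body 0`, …, `body (k-1)` one after the other. -/
def iterate (body : ℕ → Config → PMF Config) : ℕ → Config → PMF Config
  | 0, s => PMF.pure s
  | k + 1, s => (iterate body k s).bind (body k)

/-- The law of the configuration after a command has been executed. -/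
def Cmd.run : Cmd → Config → PMF Config
  | .skip, s => PMF.pure (s.tick 1)
  | .setInt a i e, s =>
      PMF.pure ((s.putInt a (i.eval s) (e.eval s)).tick (i.size + e.size + 1))
  | .setReal a i e, s =>
      PMF.pure ((s.putReal a (i.eval s) (e.eval s)).tick (i.size + e.size + 1))
  | .setFloor a i e, s =>
      PMF.pure ((s.putInt a (i.eval s) ⌊e.eval s⌋₊).tick (i.size + e.size + 1))
  | .toss a i p, s => (coin (p.eval s)).map fun b =>
      (s.putInt a (i.eval s) b.toNat).tick (i.size + p.size + 1)
  | .seq f g, s => (f.run s).bind g.run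
  | .ifLt d e f g, s =>
      if d.eval s < e.eval s then f.run (s.tick (d.size + e.size + 1))
      else g.run (s.tick (d.size + e.size + 1))
  | .loop a e f, s =>
      iterate (fun k s => f.run ((s.putInt a 0 k).tick 1)) (e.eval s) (s.tick (e.size + 1))

/-- An online algorithm: `setup` is executed before the first row arrives, and `serve` on the
arrival of each row. -/
structure OnlineProgram where
  setup : Cmd
  serve : Cmd

/-- A vector as an array, padded with zeros. -/
def toArray {m : ℕ} (v : Fin m → ℝ) : ℕ → ℝ := fun j => if h : j < m then v ⟨j, h⟩ else 0

/-- Initial memory: integer array `0` holds `m` at index `0`, real array `0` holds the costs `c`, real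
array `1` holds the parameter `β` at index `0`, and everything else is zero. -/
def Config.start {m : ℕ} (c : Fin m → ℝ) (β : ℝ) : Config where
  int := Function.update 0 0 (Function.update 0 0 m)
  real := Function.update (Function.update 0 0 (toArray c)) 1 (Function.update 0 0 β)
  clock := 0

/-- The arriving row is placed in real array `2`. -/
def Config.load {m : ℕ} (a : Fin m → ℝ) (s : Config) : Config :=
  { s with real := Function.update s.real 2 (toArray a) }

/-- The current solution `z` is held in integer array `1`. -/
def Config.solution (m : ℕ) (s : Config) : Fin m → ℕ := fun j => s.int 1 j

/-- The law of the history of configurations of an online algorithm (after the setup, and after each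
row), when it is given `m`, `c` and the parameter `β`, and the rows arrive as `r 0, …, r (n-1)`. -/
def OnlineProgram.run {m n : ℕ} (P : OnlineProgram) (c : Fin m → ℝ) (β : ℝ)
    (r : Fin n → Fin m → ℝ) : PMF (Fin (n + 1) → Config) :=
  (P.setup.run (Config.start c β)).bind fun s =>
    trajectory (fun a s => P.serve.run (Config.load a s)) n s r

/-- The law of the history of solutions held by an online algorithm. -/
def OnlineProgram.solutions {m n : ℕ} (P : OnlineProgram) (c : Fin m → ℝ) (β : ℝ)
    (r : Fin n → Fin m → ℝ) : PMF (Fin (n + 1) → Fin m → ℕ) :=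
  (P.run c β r).map fun h t => (h t).solution m

/-- With every outcome of the coins, the total number of steps is at most `B`. -/
def OnlineProgram.RunsWithin {m n : ℕ} (P : OnlineProgram) (c : Fin m → ℝ) (β : ℝ)
    (r : Fin n → Fin m → ℝ) (B : ℕ) : Prop :=
  ∀ h ∈ (P.run c β r).support, (h (Fin.last n)).clock ≤ B

/-- The expected cost of `k` times the final solution, when the rows of `A` arrive in uniformly random
order and `law r` is the law of the history of solutions for the arrival sequence `r`. -/
def expectedCost {m n : ℕ} (k : ℕ) (A : Fin n → Fin m → ℝ) (c : Fin m → ℝ)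
    (law : (Fin n → Fin m → ℝ) → PMF (Fin (n + 1) → Fin m → ℕ)) : ℝ≥0∞ :=
  expect (randomOrder n fun σ => law fun t => A (σ t))
    fun z => dot c (toReal fun j => k * z (Fin.last n) j)

end CoveringIP

end

/-! The cost bound is optional stopping for one potential that pays for covering and for learning at
once. Fix a fractional solution `u` of cost at most `β`. A round on row `a_i` with deficit `Δ_i > γ`
spends at most `4κ_i` in expectation, where `κ_i = Δ_i · min_k c_k/a_ik`: the rounding costs `κ_i`
because `⟨c, x⟩ = β`, and the greedy column at most `3κ_i` (`dot_buy_le`). Let uncovered rows have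
weight `w_i = κ_i`, let `ρ` be the total weight of the rows not yet served, and put `q_l = min(1,
⟨a_l, x⟩)`.

Covering: buying a rounding of `κ_i x / β` lowers `24 β log ρ` in expectation by at least `8 (w_i/ρ)
Σ_l w_l q_l` (`le_coinMean_min_rounding`, `rowWeight_le_sub`, `logPotential_le_sub`). Learning: the
multiplicative update changes minus four times the cross entropy of `x` relative to `u` by at most
`8 w_i q_i - 4κ_i` (`learn_change_le`, `crossEntropy_learn`). The `-4κ_i` pays for the round, and
the two other terms cancel when summed over all `i` (`sum_weight_excess`), that is, when the next
row is uniform among the remaining ones. This is where the random order enters. So the potential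
does not increase in expectation (`coinMean_potential_le`, `sum_locRound_le`), and
`mean_randomOrder_le` bounds the final cost by its initial value.

Rows whose full greedy cover costs less than `β/n` get weight zero. They cost `O(β)` in total, and a
nonzero `ρ` then lies between `β/(2n)` and `nβ`, so the logarithm contributes `O(β log n)`; the
cross entropy contributes `O(β log m)`. It must be finite at the start, hence `u` must avoid columns
dearer than `β`, which an optimal LP solution does (`exists_lp_solution`). The threshold `γ =
1/(e-1)` is the deficit above which the bound on the learning term stays valid when the update is
skipped. From `γ < 2/3` it follows that a row left alone is covered to a third, and from `γ > 1/2`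
the rounding loss of the greedy purchase is bounded.

Without `β`, the algorithm runs in phases with a guess. A guess is abandoned if one row alone costs
more, or if a certificate `G`, the product of the factors `e^{κ/β}` divided by the normalizations,
exceeds `m`: if `⟨c, u⟩ ≤ β`, then `β log G` is at most the cross entropy plus `β log m`, hence at
most `β log m` (`AdaptState.refute_good`). Since `log G` replaces the cross entropy in the
potential, a phase is paid for even when its guess is wrong, and guesses at least double and stay
below `2⟨c, u⟩`, so the costs of the phases form a geometric series (`adaptPotential_restart_le`,
`sum_adaptRound_le`). Truncating rows at `1` does not change the integer solutions.

The programs are handled by a simulation. All commands of a round before the coin tosses are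
deterministic, so the law of the memory is an image of the law of the coins (`simulates_roundCmd`,
`solutions_eq`). Loops run only over the columns, which bounds the running time syntactically
(`runsWithin_cost`). -/

namespace CoveringIP

/-! ## Expectations of discrete laws -/

/-- The expectation of a function with values in `[0, ∞]`. -/
noncomputable def mean {S : Type*} (p : PMF S) (f : S → ℝ≥0∞) : ℝ≥0∞ := ∑' s, p s * f s

theorem mean_bind {S T : Type*} (p : PMF S) (k : S → PMF T) (f : T → ℝ≥0∞) :
    mean (p.bind k) f = mean p fun s => mean (k s) f := by
  simp only [mean, PMF.bind_apply, ← ENNReal.tsum_mul_right, ← ENNReal.tsum_mul_left]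
  rw [ENNReal.tsum_comm]
  simp only [mul_assoc]

theorem mean_pure {S : Type*} (s : S) (f : S → ℝ≥0∞) : mean (PMF.pure s) f = f s := by
  rw [mean, tsum_eq_single s]
  · simp
  · intro t ht
    simp [PMF.pure_apply, ht]

theorem mean_map {S T : Type*} (p : PMF S) (g : S → T) (f : T → ℝ≥0∞) :
    mean (p.map g) f = mean p fun s => f (g s) := by
  rw [PMF.map, mean_bind]
  simp [mean_pure]

theorem mean_fintype {S : Type*} [Fintype S] (p : PMF S) (f : S → ℝ≥0∞) :
    mean p f = ∑ s, p s * f s := tsum_fintype _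

/-! ## Trajectories -/

theorem mean_trajectory_succ {S R : Type*} (serve : R → S → PMF S) (n : ℕ) (s : S)
    (r : Fin (n + 1) → R) (f : S → ℝ≥0∞) :
    mean (trajectory serve (n + 1) s r) (fun h => f (h (Fin.last (n + 1)))) =
      mean (serve (r 0) s) fun s' =>
        mean (trajectory serve n s' (Fin.tail r)) fun h => f (h (Fin.last n)) := by
  simp only [trajectory, mean_bind, mean_map, ← Fin.succ_last, Fin.cons_succ]

theorem trajectory_support {S R : Type*} (serve : R → S → PMF S) :
    ∀ (n : ℕ) (s : S) (r : Fin n → R), ∀ h ∈ (trajectory serve n s r).support,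
      h 0 = s ∧ ∀ t : Fin n, h t.succ ∈ (serve (r t) (h t.castSucc)).support
  | 0, s, r, h, hh => by
      simp only [trajectory, PMF.support_pure, Set.mem_singleton_iff] at hh
      subst hh
      exact ⟨rfl, fun t => t.elim0⟩
  | n + 1, s, r, h, hh => by
      simp only [trajectory, PMF.mem_support_bind_iff, PMF.mem_support_map_iff] at hh
      obtain ⟨s', hs', h', hh', rfl⟩ := hh
      obtain ⟨h0, h1⟩ := trajectory_support serve n s' _ h' hh'
      refine ⟨rfl, fun t => ?_⟩
      refine Fin.cases ?_ (fun t => ?_) t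
      · simpa [h0] using hs'
      · simpa [Fin.tail, ← Fin.succ_castSucc] using h1 t

theorem trajectory_invariant {S R : Type*} (serve : R → S → PMF S) (I : S → Prop)
    (n : ℕ) (s : S) (r : Fin n → R) (hs : I s)
    (hI : ∀ t s, I s → ∀ s' ∈ (serve (r t) s).support, I s')
    (h : Fin (n + 1) → S) (hh : h ∈ (trajectory serve n s r).support) (t : Fin (n + 1)) :
    I (h t) := by
  obtain ⟨h0, h1⟩ := trajectory_support serve n s r h hh
  induction t using Fin.induction with
  | zero => rwa [h0]
  | succ t ih => exact hI t _ ih _ (h1 t)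

/-- A simulation of one procedure by another one carries over to trajectories. -/
theorem trajectory_map {S T R : Type*} (serve : R → S → PMF S) (serve' : R → T → PMF T)
    (abs : S → T) (I : S → Prop) :
    ∀ (n : ℕ) (s : S) (r : Fin n → R), I s →
      (∀ t s, I s → (serve (r t) s).map abs = serve' (r t) (abs s) ∧
        ∀ s' ∈ (serve (r t) s).support, I s') →
      (trajectory serve n s r).map (fun h t => abs (h t)) = trajectory serve' n (abs s) r
  | 0, s, r, _, _ => by simp [trajectory, PMF.pure_map]
  | n + 1, s, r, hs, hI => by
      obtain ⟨h1, h2⟩ := hI 0 s hs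
      simp only [trajectory]
      rw [← h1, PMF.bind_map, PMF.map_bind]
      ext h
      simp only [PMF.bind_apply]
      refine tsum_congr fun s' => ?_
      by_cases hs' : serve (r 0) s s' = 0
      · simp [hs']
      · congr 1
        have ih := trajectory_map serve serve' abs I n s' (Fin.tail r)
          (h2 _ ((PMF.mem_support_iff _ _).2 hs')) (fun t => hI t.succ)
        simp only [Function.comp_apply]
        rw [← ih, PMF.map_comp, PMF.map_comp]
        congr 2
        ext h t
        refine Fin.cases ?_ (fun t => ?_) t <;> simp

/-! ## Random arrival order -/

/-- The rows that remain when row `i` has arrived. -/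
def dropRow {k : ℕ} {R : Type*} (i : Fin (k + 1)) (A : Fin (k + 1) → R) : Fin k → R :=
  fun j => A (Equiv.swap 0 i j.succ)

theorem sum_dropRow {k : ℕ} {R M : Type*} [AddCommMonoid M] (i : Fin (k + 1))
    (A : Fin (k + 1) → R) (f : R → M) : f (A i) + ∑ j, f (dropRow i A j) = ∑ j, f (A j) := by
  rw [← Equiv.sum_comp (Equiv.swap 0 i) fun j => f (A j), Fin.sum_univ_succ]
  simp [dropRow]

/-- An order is the row that comes first together with an order of the rest. `dropRow` is built on
the same transposition `swap 0 i` as `decomposeFin`, so that the two fit together. -/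
theorem sum_perm_succ {k : ℕ} {M : Type*} [AddCommMonoid M] (F : Equiv.Perm (Fin (k + 1)) → M) :
    ∑ σ, F σ = ∑ i, ∑ τ, F (Equiv.Perm.decomposeFin.symm (i, τ)) := by
  rw [← Equiv.sum_comp Equiv.Perm.decomposeFin.symm, Fintype.sum_prod_type]

/-- Optional stopping for a nonnegative potential that does not increase in expectation when the next
row is drawn uniformly from the remaining ones. -/
theorem sum_perm_mean_le {S R : Type*} (serve : R → S → PMF S)
    (Inv : (k : ℕ) → (Fin k → R) → S → Prop) (Φ : (k : ℕ) → (Fin k → R) → S → ℝ≥0∞)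
    (f : S → ℝ≥0∞) (hf : ∀ A s, Inv 0 A s → f s ≤ Φ 0 A s)
    (hInv : ∀ k A s, Inv (k + 1) A s → ∀ i, ∀ s' ∈ (serve (A i) s).support, Inv k (dropRow i A) s')
    (hΦ : ∀ k A s, Inv (k + 1) A s →
      ∑ i, mean (serve (A i) s) (Φ k (dropRow i A)) ≤ (k + 1 : ℕ) * Φ (k + 1) A s) :
    ∀ (n : ℕ) (A : Fin n → R) (s : S), Inv n A s →
      ∑ σ : Equiv.Perm (Fin n), mean (trajectory serve n s fun t => A (σ t))
        (fun h => f (h (Fin.last n))) ≤ n.factorial * Φ n A s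
  | 0, A, s, h => by
      have : ∀ σ : Equiv.Perm (Fin 0), (fun t => A (σ t)) = A := fun σ => by ext t; exact t.elim0
      simpa [trajectory, mean_pure] using hf A s h
  | n + 1, A, s, h => by
      rw [sum_perm_succ]
      -- Condition on the first row `i`. After it has been served, the remaining rows `dropRow i A`
      -- are again in uniformly random order, so the induction hypothesis applies to each possible
      -- state.
      have key : ∀ i, ∑ τ : Equiv.Perm (Fin n), mean (trajectory serve (n + 1) s
          fun t => A (Equiv.Perm.decomposeFin.symm (i, τ) t)) (fun h => f (h (Fin.last (n + 1)))) ≤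
          n.factorial * mean (serve (A i) s) (Φ n (dropRow i A)) := by
        intro i
        have h1 : ∀ τ : Equiv.Perm (Fin n), mean (trajectory serve (n + 1) s
            fun t => A (Equiv.Perm.decomposeFin.symm (i, τ) t))
              (fun h => f (h (Fin.last (n + 1)))) =
            mean (serve (A i) s) fun s' => mean (trajectory serve n s' fun t => dropRow i A (τ t))
              fun h => f (h (Fin.last n)) := by
          intro τ
          rw [mean_trajectory_succ]
          simp [Fin.tail_def, dropRow, Equiv.Perm.decomposeFin_symm_apply_succ]
        simp only [h1]
        simp only [mean]
        rw [← ENNReal.tsum_mul_left, ← Summable.tsum_finsetSum fun _ _ => ENNReal.summable]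
        refine ENNReal.tsum_le_tsum fun s' => ?_
        rw [← Finset.mul_sum]
        by_cases hs' : serve (A i) s s' = 0
        · simp [hs']
        · rw [mul_left_comm]
          gcongr
          exact sum_perm_mean_le serve Inv Φ f hf hInv hΦ n _ s'
            (hInv n A s h i s' ((PMF.mem_support_iff _ _).2 hs'))
      calc _ ≤ ∑ i, (n.factorial : ℝ≥0∞) * mean (serve (A i) s) (Φ n (dropRow i A)) :=
            Finset.sum_le_sum fun i _ => key i
        _ = n.factorial * ∑ i, mean (serve (A i) s) (Φ n (dropRow i A)) := by rw [Finset.mul_sum]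
        _ ≤ n.factorial * ((n + 1 : ℕ) * Φ (n + 1) A s) := by gcongr; exact hΦ n A s h
        _ = _ := by rw [Nat.factorial_succ]; push_cast; ring

/-- Division of `sum_perm_mean_le` by `n!`. The maps `g` and `F` allow the law to be one of solution
histories while the potential lives on states. -/
theorem mean_randomOrder_le {S R T : Type*} (serve : R → S → PMF S)
    (Inv : (k : ℕ) → (Fin k → R) → S → Prop) (Φ : (k : ℕ) → (Fin k → R) → S → ℝ≥0∞)
    (f : S → ℝ≥0∞) (hf : ∀ A s, Inv 0 A s → f s ≤ Φ 0 A s)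
    (hInv : ∀ k A s, Inv (k + 1) A s → ∀ i, ∀ s' ∈ (serve (A i) s).support, Inv k (dropRow i A) s')
    (hΦ : ∀ k A s, Inv (k + 1) A s →
      ∑ i, mean (serve (A i) s) (Φ k (dropRow i A)) ≤ (k + 1 : ℕ) * Φ (k + 1) A s)
    (n : ℕ) (A : Fin n → R) (s : S) (h : Inv n A s) (g : (Fin (n + 1) → S) → T)
    (F : T → ℝ≥0∞) (hF : ∀ h, F (g h) = f (h (Fin.last n))) :
    mean (randomOrder n fun σ => (trajectory serve n s fun t => A (σ t)).map g) F ≤ Φ n A s := by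
  rw [randomOrder, mean_bind, mean_fintype]
  simp only [PMF.uniformOfFintype_apply, mean_map, hF, ← Finset.mul_sum]
  rw [mul_comm, ← div_eq_mul_inv]
  refine ENNReal.div_le_of_le_mul ?_
  rw [mul_comm]
  simpa [Fintype.card_perm] using sum_perm_mean_le serve Inv Φ f hf hInv hΦ n A s h

/-! ## Independent coins -/

/-- The real expectation of a function of independent coins `Ber(p j)`. -/
noncomputable def coinMean {m : ℕ} (p : Fin m → ℝ) (f : (Fin m → Bool) → ℝ) : ℝ :=
  ∑ b, (∏ j, bif b j then p j else 1 - p j) * f b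

section coinMean
variable {m : ℕ} {p : Fin m → ℝ}

theorem coinWeight_nonneg (hp : ∀ j, 0 ≤ p j ∧ p j ≤ 1) (b : Fin m → Bool) :
    0 ≤ ∏ j, bif b j then p j else 1 - p j := by
  refine Finset.prod_nonneg fun j _ => ?_
  cases b j
  · simpa using (hp j).2
  · simpa using (hp j).1

theorem coinMean_mono (hp : ∀ j, 0 ≤ p j ∧ p j ≤ 1) {f g : (Fin m → Bool) → ℝ}
    (h : ∀ b, f b ≤ g b) : coinMean p f ≤ coinMean p g :=
  Finset.sum_le_sum fun b _ => mul_le_mul_of_nonneg_left (h b) (coinWeight_nonneg hp b)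

/-- Independence, as the expansion of a product of two-term sums. The normalization, the mean of one
coin and the exponential moments all come from it. -/
theorem coinMean_prod (f : Fin m → Bool → ℝ) :
    coinMean p (fun b => ∏ j, f j (b j)) = ∏ j, (p j * f j true + (1 - p j) * f j false) := by
  simp only [coinMean, ← Finset.prod_mul_distrib]
  rw [← Fintype.prod_sum (fun j b => (bif b then p j else 1 - p j) * f j b)]
  simp

theorem coinMean_const (r : ℝ) : coinMean p (fun _ => r) = r := by
  have := coinMean_prod (p := p) (fun _ _ => 1)
  simp only [coinMean, Finset.prod_const_one, mul_one] at this
  rw [coinMean, ← Finset.sum_mul, this]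
  simp

theorem coinMean_add (f g : (Fin m → Bool) → ℝ) :
    coinMean p (fun b => f b + g b) = coinMean p f + coinMean p g := by
  simp [coinMean, mul_add, Finset.sum_add_distrib]

theorem coinMean_const_mul (r : ℝ) (f : (Fin m → Bool) → ℝ) :
    coinMean p (fun b => r * f b) = r * coinMean p f := by
  simp only [coinMean, Finset.mul_sum]
  exact Finset.sum_congr rfl fun b _ => by ring

theorem coinMean_sum {ι : Type*} (s : Finset ι) (f : ι → (Fin m → Bool) → ℝ) :
    coinMean p (fun b => ∑ i ∈ s, f i b) = ∑ i ∈ s, coinMean p (f i) := by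
  simp only [coinMean, Finset.mul_sum]
  exact Finset.sum_comm

theorem coinMean_toNat (j : Fin m) : coinMean p (fun b => ((b j).toNat : ℝ)) = p j := by
  have h := coinMean_prod (p := p) (fun i b => if i = j then (b.toNat : ℝ) else 1)
  have h1 : ∀ b : Fin m → Bool, (∏ i, if i = j then ((b i).toNat : ℝ) else 1) = (b j).toNat := by
    intro b
    rw [Finset.prod_ite_eq' Finset.univ j fun i => ((b i).toNat : ℝ)]
    simp
  simp only [h1] at h
  rw [h, Finset.prod_eq_single j]
  · simp
  · intro i _ hi
    simp [hi]
  · simp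

theorem coins_apply (hp : ∀ j, 0 ≤ p j ∧ p j ≤ 1) (b : Fin m → Bool) :
    coins p b = ENNReal.ofReal (∏ j, bif b j then p j else 1 - p j) := by
  rw [coins, PMF.ofFintype_apply, ENNReal.ofReal_prod_of_nonneg]
  · refine Finset.prod_congr rfl fun j _ => ?_
    have : clip (p j) = p j := by simp [clip, (hp j).1, (hp j).2]
    cases b j <;> simp [coin, this]
  · intro j _
    cases b j
    · simpa using (hp j).2
    · simpa using (hp j).1

/-- The passage from `[0, ∞]` to real expectations, in which the potential can be split into terms
of either sign. -/
theorem mean_coins (hp : ∀ j, 0 ≤ p j ∧ p j ≤ 1) {f : (Fin m → Bool) → ℝ} (hf : ∀ b, 0 ≤ f b) :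
    mean (coins p) (fun b => ENNReal.ofReal (f b)) = ENNReal.ofReal (coinMean p f) := by
  rw [mean_fintype, coinMean, ENNReal.ofReal_sum_of_nonneg
    fun b _ => mul_nonneg (coinWeight_nonneg hp b) (hf b)]
  refine Finset.sum_congr rfl fun b _ => ?_
  rw [coins_apply hp, ENNReal.ofReal_mul (coinWeight_nonneg hp b)]

theorem coinMean_nonneg (hp : ∀ j, 0 ≤ p j ∧ p j ≤ 1) {f : (Fin m → Bool) → ℝ}
    (hf : ∀ b, 0 ≤ f b) : 0 ≤ coinMean p f :=
  Finset.sum_nonneg fun b _ => mul_nonneg (coinWeight_nonneg hp b) (hf b)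

end coinMean

theorem fract_mem {m : ℕ} (y : Fin m → ℝ) (j : Fin m) :
    0 ≤ Int.fract (y j) ∧ Int.fract (y j) ≤ 1 :=
  ⟨Int.fract_nonneg _, (Int.fract_lt_one _).le⟩

/-- The randomized rounding of `y`. -/
noncomputable def rounding {m : ℕ} (y : Fin m → ℝ) (b : Fin m → Bool) : Fin m → ℕ :=
  fun j => ⌊y j⌋₊ + (b j).toNat

theorem floor_add_fract_of_nonneg {y : ℝ} (hy : 0 ≤ y) : (⌊y⌋₊ : ℝ) + Int.fract y = y := by
  rw [natCast_floor_eq_intCast_floor hy]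
  exact Int.floor_add_fract y

theorem coinMean_dot_rounding {m : ℕ} (a y : Fin m → ℝ) (hy : ∀ j, 0 ≤ y j) :
    coinMean (fun j => Int.fract (y j)) (fun b => dot a (toReal (rounding y b))) = dot a y := by
  simp only [dot, toReal, rounding, coinMean_sum, coinMean_const_mul]
  refine Finset.sum_congr rfl fun j _ => ?_
  push_cast
  rw [coinMean_add, coinMean_const, coinMean_toNat, floor_add_fract_of_nonneg (hy j)]

theorem exp_neg_le_one_sub_half {a : ℝ} (h0 : 0 ≤ a) (h1 : a ≤ 1) :
    Real.exp (-a) ≤ 1 - a / 2 := by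
  have h := Real.add_one_le_exp a
  rw [Real.exp_neg, inv_le_iff_one_le_mul₀ (Real.exp_pos a)]
  nlinarith

/-- Rounding `y` covers a constraint at least to a constant fraction of what `y` does. -/
theorem le_coinMean_min_rounding {m : ℕ} (a y : Fin m → ℝ) (ha : ∀ j, 0 ≤ a j ∧ a j ≤ 1)
    (hy : ∀ j, 0 ≤ y j) :
    min 1 (dot a y) / 3 ≤
      coinMean (fun j => Int.fract (y j)) (fun b => min 1 (dot a (toReal (rounding y b)))) := by
  have hX : ∀ b, 0 ≤ dot a (toReal (rounding y b)) := fun b =>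
    Finset.sum_nonneg fun j _ => mul_nonneg (ha j).1 (Nat.cast_nonneg _)
  have hμ : 0 ≤ dot a y := Finset.sum_nonneg fun j _ => mul_nonneg (ha j).1 (hy j)
  have h1 : ∀ b, 1 + (-1) * Real.exp (-dot a (toReal (rounding y b))) ≤
      min 1 (dot a (toReal (rounding y b))) := by
    intro b
    have := Real.add_one_le_exp (-dot a (toReal (rounding y b)))
    have := Real.exp_pos (-dot a (toReal (rounding y b)))
    refine le_min ?_ ?_ <;> linarith
  -- Column by column: the floor contributes a deterministic factor, and a coin with bias `f`
  -- contributes `1 - f + f e^{-a} ≤ 1 - fa/2 ≤ e^{-fa/2}`.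
  have h2 : coinMean (fun j => Int.fract (y j))
      (fun b => Real.exp (-dot a (toReal (rounding y b)))) ≤ Real.exp (-(dot a y / 2)) := by
    have e1 : ∀ b, Real.exp (-dot a (toReal (rounding y b))) =
        ∏ j, Real.exp (-(a j * (⌊y j⌋₊ + ((b j).toNat : ℝ)))) := by
      intro b
      rw [← Real.exp_sum, Finset.sum_neg_distrib]
      simp [dot, toReal, rounding]
    have e2 : Real.exp (-(dot a y / 2)) = ∏ j, Real.exp (-(a j * y j / 2)) := by
      rw [← Real.exp_sum, Finset.sum_neg_distrib, dot, Finset.sum_div]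
    simp only [e1]
    rw [coinMean_prod (p := fun j => Int.fract (y j))
      (fun j t => Real.exp (-(a j * (⌊y j⌋₊ + (t.toNat : ℝ))))), e2]
    have hnn : ∀ j, 0 ≤ 1 - Int.fract (y j) := fun j => sub_nonneg.2 (fract_mem y j).2
    refine Finset.prod_le_prod (fun j _ => ?_) fun j _ => ?_
    · have := hnn j
      have := Int.fract_nonneg (y j)
      positivity
    · have hf := floor_add_fract_of_nonneg (hy j)
      have h3 := exp_neg_le_one_sub_half (ha j).1 (ha j).2
      have h4 : Real.exp (-(a j * ⌊y j⌋₊)) ≤ Real.exp (-(a j * ⌊y j⌋₊ / 2)) := by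
        have : 0 ≤ a j * (⌊y j⌋₊ : ℝ) := mul_nonneg (ha j).1 (Nat.cast_nonneg _)
        exact Real.exp_le_exp.2 (by linarith)
      have h5 := Real.add_one_le_exp (-(a j * Int.fract (y j) / 2))
      have h6 := Int.fract_nonneg (y j)
      simp only [Bool.toNat_true, Bool.toNat_false, Nat.cast_one, Nat.cast_zero, add_zero]
      calc _ = Real.exp (-(a j * ⌊y j⌋₊)) *
            (Int.fract (y j) * Real.exp (-a j) + (1 - Int.fract (y j))) := by
            rw [show -(a j * ((⌊y j⌋₊ : ℝ) + 1)) = -(a j * ⌊y j⌋₊) + -a j by ring, Real.exp_add]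
            ring
        _ ≤ Real.exp (-(a j * ⌊y j⌋₊ / 2)) * Real.exp (-(a j * Int.fract (y j) / 2)) := by
            refine mul_le_mul h4 ?_ ?_ (Real.exp_pos _).le
            · nlinarith
            · have := hnn j
              positivity
        _ = _ := by
            rw [← Real.exp_add]
            congr 1
            have : a j * y j = a j * ⌊y j⌋₊ + a j * Int.fract (y j) := by rw [← mul_add, hf]
            linarith
  have h3 := coinMean_mono (fract_mem y) h1
  rw [coinMean_add, coinMean_const, coinMean_const_mul] at h3
  -- Equivalent to `1 ≤ e^{μ/2} (1 - min(1, μ)/3)`, which follows from `e^{μ/2} ≥ 1 + μ/2`; equality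
  -- in the resulting polynomial bound occurs at `μ = 1`.
  have h4 : Real.exp (-(dot a y / 2)) ≤ 1 - min 1 (dot a y) / 3 := by
    have h := Real.add_one_le_exp (dot a y / 2)
    rw [Real.exp_neg, inv_le_iff_one_le_mul₀ (Real.exp_pos _)]
    rcases le_total 1 (dot a y) with h' | h'
    · rw [min_eq_left h']
      linarith
    · rw [min_eq_right h']
      nlinarith
  linarith

/-! ## Rows and cheapest columns -/

/-- A constraint with coefficients in `[0, 1]` that can be satisfied. -/
def IsRow {m : ℕ} (a : Fin m → ℝ) : Prop := (∀ j, 0 ≤ a j ∧ a j ≤ 1) ∧ ∃ j, 0 < a j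

section rows
variable {m : ℕ} {c a : Fin m → ℝ}

theorem minRatio_le {k : Fin m} (hk : 0 < a k) : minRatio c a ≤ c k / a k :=
  ciInf_le (Set.finite_range fun k : {k : Fin m // 0 < a k} => c k / a k).bddBelow ⟨k, hk⟩

theorem minRatio_eq {k : Fin m} (hk : IsArgmin c a k) : minRatio c a = c k / a k :=
  haveI : Nonempty {k : Fin m // 0 < a k} := ⟨⟨k, hk.1⟩⟩
  le_antisymm (minRatio_le hk.1) (le_ciInf fun l => hk.2.1 l l.2)

theorem exists_isArgmin (ha : ∃ j, 0 < a j) : ∃ k, IsArgmin c a k := by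
  classical
  obtain ⟨j, hj⟩ := ha
  obtain ⟨l, hl, hl'⟩ := Finset.exists_min_image (Finset.univ.filter fun k => 0 < a k)
    (fun k => c k / a k) ⟨j, by simpa using hj⟩
  have hne : (Finset.univ.filter fun k => 0 < a k ∧ c k / a k = c l / a l).Nonempty :=
    ⟨l, by simpa using hl⟩
  refine ⟨Finset.min' _ hne, ?_⟩
  have hmem := Finset.min'_mem _ hne
  simp only [Finset.mem_filter, Finset.mem_univ, true_and] at hmem
  refine ⟨hmem.1, fun k hk => ?_, fun k hk hk' => ?_⟩
  · rw [hmem.2]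
    exact hl' k (by simpa using hk)
  · refine lt_of_le_of_ne ?_ fun h => ?_
    · rw [hmem.2]
      exact hl' k (by simpa using hk')
    · exact (Finset.min'_le _ k 
        (Finset.mem_filter.2 ⟨Finset.mem_univ _, hk', h.symm.trans hmem.2⟩)).not_gt hk

theorem IsArgmin.unique {k l : Fin m} (hk : IsArgmin c a k) (hl : IsArgmin c a l) : k = l := by
  rcases lt_trichotomy k l with h | h | h
  · exact absurd (hk.2.1 l hl.1) (hl.2.2 k h hk.1).not_ge
  · exact h
  · exact absurd (hl.2.1 k hk.1) (hk.2.2 l h hl.1).not_ge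

theorem minRatio_pos (hc : ∀ j, 0 < c j) (ha : ∃ j, 0 < a j) : 0 < minRatio c a := by
  obtain ⟨k, hk⟩ := exists_isArgmin (c := c) ha
  rw [minRatio_eq hk]
  exact div_pos (hc k) hk.1

theorem minRatio_mul_le (hc : ∀ j, 0 < c j) (h0 : ∀ j, 0 ≤ a j) (j : Fin m) :
    minRatio c a * a j ≤ c j := by
  rcases (h0 j).eq_or_lt with h | h
  · rw [← h, mul_zero]
    exact (hc j).le
  · rw [← le_div_iff₀ h]
    exact minRatio_le h

/-- Every column pays at least the minimal ratio per unit of coverage. Hence a full greedy cover of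
a single row is a lower bound for the cost of any feasible solution. -/
theorem minRatio_mul_dot_le (hc : ∀ j, 0 < c j) (h0 : ∀ j, 0 ≤ a j) {x : Fin m → ℝ}
    (hx : ∀ j, 0 ≤ x j) : minRatio c a * dot a x ≤ dot c x := by
  rw [dot, dot, Finset.mul_sum]
  refine Finset.sum_le_sum fun j _ => ?_
  rw [← mul_assoc]
  exact mul_le_mul_of_nonneg_right (minRatio_mul_le hc h0 j) (hx j)

theorem minRatio_le_dot (hc : ∀ j, 0 < c j) (h0 : ∀ j, 0 ≤ a j) (ha : ∃ j, 0 < a j)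
    {x : Fin m → ℝ} (hx : ∀ j, 0 ≤ x j) (h : 1 ≤ dot a x) : minRatio c a ≤ dot c x :=
  (le_mul_of_one_le_right (minRatio_pos hc ha).le h).trans (minRatio_mul_dot_le hc h0 hx)

end rows

theorem dot_nonneg {m : ℕ} {a x : Fin m → ℝ} (ha : ∀ j, 0 ≤ a j) (hx : ∀ j, 0 ≤ x j) :
    0 ≤ dot a x := Finset.sum_nonneg fun j _ => mul_nonneg (ha j) (hx j)

theorem dot_add {m : ℕ} (a x y : Fin m → ℝ) : dot a (fun j => x j + y j) = dot a x + dot a y := by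
  simp [dot, mul_add, Finset.sum_add_distrib]

theorem dot_mul_left {m : ℕ} (a x : Fin m → ℝ) (r : ℝ) :
    dot a (fun j => r * x j) = r * dot a x := by
  simp only [dot, Finset.mul_sum]
  exact Finset.sum_congr rfl fun j _ => by ring

theorem dot_toReal_mono {m : ℕ} {a : Fin m → ℝ} (ha : ∀ j, 0 ≤ a j) {z z' : Fin m → ℕ}
    (h : ∀ j, z j ≤ z' j) : dot a (toReal z) ≤ dot a (toReal z') :=
  Finset.sum_le_sum fun j _ => mul_le_mul_of_nonneg_left (Nat.cast_le.2 (h j)) (ha j)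

theorem exp_one_lt : Real.exp 1 < 2.72 := Real.exp_one_lt_d9.trans (by norm_num)

theorem lt_exp_one : 2.71 < Real.exp 1 := lt_trans (by norm_num) Real.exp_one_gt_d9

/-- This makes `1 < 2Δ` in every active round, which absorbs the `+1` of the ceiling in the greedy
purchase and keeps nonzero row weights above `s/2`. -/
theorem half_lt_threshold : 1 / 2 < threshold := by
  have := exp_one_lt
  have := lt_exp_one
  rw [threshold, lt_inv_comm₀ (by norm_num) (by linarith)]
  linarith

/-- The source of the factor `3`: a skipped row is covered to at least `1 - γ > 1/3`. -/
theorem threshold_lt : threshold < 2 / 3 := by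
  have := lt_exp_one
  rw [threshold, inv_lt_comm₀ (by linarith) (by norm_num)]
  linarith

section deficit
variable {m : ℕ} {a : Fin m → ℝ}

theorem deficit_nonneg (z : Fin m → ℕ) : 0 ≤ deficit a z := le_max_left _ _

theorem deficit_le_one (ha : ∀ j, 0 ≤ a j) (z : Fin m → ℕ) : deficit a z ≤ 1 :=
  max_le zero_le_one (sub_le_self _ (dot_nonneg ha fun _ => Nat.cast_nonneg _))

theorem deficit_anti (ha : ∀ j, 0 ≤ a j) {z z' : Fin m → ℕ} (h : ∀ j, z j ≤ z' j) :
    deficit a z' ≤ deficit a z :=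
  max_le_max le_rfl (sub_le_sub_left (dot_toReal_mono ha h) _)

end deficit

/-! ## One round -/

open Classical in
/-- The integer solution after a round on the row `a` with deficit `Δ` in which the rounding of `y`
was bought. -/
noncomputable def buy {m : ℕ} (c a : Fin m → ℝ) (Δ : ℝ) (y : Fin m → ℝ) (z : Fin m → ℕ)
    (b : Fin m → Bool) : Fin m → ℕ :=
  fun j => z j + (⌊y j⌋₊ + (b j).toNat) + if IsArgmin c a j then ⌈Δ / a j⌉₊ else 0

section buy
variable {m : ℕ} {c a : Fin m → ℝ}

theorem le_buy (Δ : ℝ) (y : Fin m → ℝ) (z : Fin m → ℕ) (b : Fin m → Bool) (j : Fin m) :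
    z j ≤ buy c a Δ y z b j := by
  unfold buy
  omega

/-- The greedy purchase alone fills the deficit. The rounding is not needed for feasibility, so this
holds for all outcomes of the coins. -/
theorem one_le_dot_buy (ha : IsRow a) (y : Fin m → ℝ) (z : Fin m → ℕ) (b : Fin m → Bool) :
    1 ≤ dot a (toReal (buy c a (deficit a z) y z b)) := by
  obtain ⟨k, hk⟩ := exists_isArgmin (c := c) ha.2
  have h1 : dot a (toReal z) + a k * ⌈deficit a z / a k⌉₊ ≤
      dot a (toReal (buy c a (deficit a z) y z b)) := by
    have : dot a (fun j => toReal z j + if j = k then (⌈deficit a z / a k⌉₊ : ℝ) else 0) ≤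
        dot a (toReal (buy c a (deficit a z) y z b)) := by
      refine Finset.sum_le_sum fun j _ => mul_le_mul_of_nonneg_left ?_ (ha.1 j).1
      by_cases hj : j = k
      · subst hj
        simp only [toReal, buy, if_true, hk]
        push_cast
        have : 0 ≤ (⌊y j⌋₊ : ℝ) + ((b j).toNat : ℝ) := by positivity
        linarith
      · simp only [toReal, hj, if_false, add_zero]
        exact Nat.cast_le.2 (le_buy _ _ _ _ _)
    rw [dot_add] at this
    simpa [dot] using this
  have h2 : deficit a z ≤ a k * ⌈deficit a z / a k⌉₊ := by
    rw [← div_le_iff₀' hk.1]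
    exact Nat.le_ceil _
  have h3 : 1 - dot a (toReal z) ≤ deficit a z := le_max_right _ _
  linarith

theorem dot_buy_le (hc : ∀ j, 0 < c j) (ha : IsRow a) {Δ : ℝ} (hΔ : threshold < Δ)
    (y : Fin m → ℝ) (z : Fin m → ℕ) (b : Fin m → Bool) :
    dot c (toReal (buy c a Δ y z b)) ≤
      dot c (toReal z) + dot c (toReal (rounding y b)) + 3 * (Δ * minRatio c a) := by
  obtain ⟨k, hk⟩ := exists_isArgmin (c := c) ha.2
  have h0 : ∀ j, IsArgmin c a j ↔ j = k := fun j => ⟨fun h => h.unique hk, fun h => h ▸ hk⟩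
  have h1 : toReal (buy c a Δ y z b) = fun j => (toReal z j + toReal (rounding y b) j) +
      if j = k then (⌈Δ / a j⌉₊ : ℝ) else 0 := by
    ext j
    simp only [toReal, buy, rounding, h0]
    push_cast
    rfl
  rw [h1, dot_add, dot_add]
  have h2 : dot c (fun j => if j = k then (⌈Δ / a j⌉₊ : ℝ) else 0) = c k * ⌈Δ / a k⌉₊ := by
    simp [dot]
  rw [h2, minRatio_eq hk]
  have hγ := half_lt_threshold
  have hak := hk.1
  -- Since `a k ≤ 1`, also `Δ / a k > 1/2`. So the ceiling is below `Δ / a k + 1 < 3 Δ / a k`.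
  have h3 : Δ ≤ Δ / a k := by
    rw [le_div_iff₀ hak]
    nlinarith [(ha.1 k).2]
  have h4 : (⌈Δ / a k⌉₊ : ℝ) < Δ / a k + 1 := Nat.ceil_lt_add_one (by linarith)
  have h5 : c k * ⌈Δ / a k⌉₊ ≤ c k * (3 * (Δ / a k)) :=
    mul_le_mul_of_nonneg_left (by linarith) (hc k).le
  have h6 : c k * (3 * (Δ / a k)) = 3 * (Δ * (c k / a k)) := by ring
  linarith

end buy

/-! ## The uncovered weight -/

open Classical in
/-- The cost of covering the row `a` greedily, if this row is uncovered and the cost of a full greedy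
cover lies between `s` and `β`. -/
noncomputable def rowWeight {m : ℕ} (s β : ℝ) (c a : Fin m → ℝ) (z : Fin m → ℕ) : ℝ :=
  if threshold < deficit a z ∧ minRatio c a ≤ β ∧ s ≤ minRatio c a then
    deficit a z * minRatio c a else 0

/-- The total weight of the uncovered rows. -/
noncomputable def uncovered {m k : ℕ} (s β : ℝ) (c : Fin m → ℝ) (A : Fin k → Fin m → ℝ)
    (z : Fin m → ℕ) : ℝ := ∑ i, rowWeight s β c (A i) z

open Classical in
/-- The logarithm of `ρ` in units of `s`, shifted such that a drop from `ρ ≥ s / 2` to `0` costs at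
least `1`. -/
noncomputable def logPotential (s ρ : ℝ) : ℝ := if ρ = 0 then 0 else 1 + Real.log (2 * ρ / s)

section weight
variable {m : ℕ} {c a : Fin m → ℝ} {s β : ℝ}

theorem rowWeight_nonneg (hc : ∀ j, 0 < c j) (ha : IsRow a) (z : Fin m → ℕ) :
    0 ≤ rowWeight s β c a z := by
  unfold rowWeight
  split_ifs
  · exact mul_nonneg (deficit_nonneg z) (minRatio_pos hc ha.2).le
  · exact le_rfl

theorem rowWeight_le (hβ : 0 ≤ β) (hc : ∀ j, 0 < c j) (ha : IsRow a) (z : Fin m → ℕ) :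
    rowWeight s β c a z ≤ β := by
  unfold rowWeight
  split_ifs with h
  · have := deficit_le_one (fun j => (ha.1 j).1) z
    have := minRatio_pos hc ha.2
    have := deficit_nonneg (a := a) z
    nlinarith
  · exact hβ

theorem rowWeight_eq_zero_or_le (hc : ∀ j, 0 < c j) (ha : IsRow a) (z : Fin m → ℕ) :
    rowWeight s β c a z = 0 ∨ s ≤ 2 * rowWeight s β c a z := by
  unfold rowWeight
  split_ifs with h
  · right
    have := half_lt_threshold
    have := minRatio_pos hc ha.2
    nlinarith [h.1, h.2.2]
  · exact Or.inl rfl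

/-- If the row is still uncovered, its deficit has dropped by at least `⟨a, X⟩ ≥ Δ min(1, ⟨a, X⟩)`,
because `Δ ≤ 1`. Otherwise its weight is now zero and the right side is nonnegative. -/
theorem rowWeight_le_sub (hc : ∀ j, 0 < c j) (ha : IsRow a) {z z' : Fin m → ℕ} {X : Fin m → ℕ}
    (h : ∀ j, z j + X j ≤ z' j) :
    rowWeight s β c a z' ≤ rowWeight s β c a z - rowWeight s β c a z * min 1 (dot a (toReal X)) := by
  have ha0 : ∀ j, 0 ≤ a j := fun j => (ha.1 j).1
  have hr := minRatio_pos hc ha.2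
  have hX : 0 ≤ dot a (toReal X) := dot_nonneg ha0 fun _ => Nat.cast_nonneg _
  have hd := deficit_anti (z := z) (z' := z') ha0 fun j => (Nat.le_add_right _ _).trans (h j)
  by_cases h1 : threshold < deficit a z' ∧ minRatio c a ≤ β ∧ s ≤ minRatio c a
  · have h2 : threshold < deficit a z ∧ minRatio c a ≤ β ∧ s ≤ minRatio c a :=
      ⟨h1.1.trans_le hd, h1.2⟩
    rw [rowWeight, rowWeight, if_pos h1, if_pos h2]
    have h3 : dot a (toReal z) + dot a (toReal X) ≤ dot a (toReal z') := by
      have := dot_toReal_mono ha0 (z := fun j => z j + X j) h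
      rwa [show toReal (fun j => z j + X j) = fun j => toReal z j + toReal X j by
        ext j; simp [toReal], dot_add] at this
    have hγ := half_lt_threshold
    have h4 : deficit a z' = 1 - dot a (toReal z') :=
      max_eq_right (by
        by_contra hneg
        have : deficit a z' = 0 := max_eq_left (le_of_not_ge hneg)
        linarith [h1.1])
    have h5 : 1 - dot a (toReal z) ≤ deficit a z := le_max_right _ _
    have h6 : deficit a z * min 1 (dot a (toReal X)) ≤ dot a (toReal X) := by
      have := deficit_le_one ha0 z
      have h0 := deficit_nonneg (a := a) z
      have h7 : 0 ≤ min 1 (dot a (toReal X)) := le_min zero_le_one hX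
      nlinarith [min_le_right 1 (dot a (toReal X))]
    nlinarith
  · rw [rowWeight, if_neg h1]
    have := rowWeight_nonneg (s := s) (β := β) hc ha z
    nlinarith [min_le_left 1 (dot a (toReal X))]

variable {k : ℕ} {A : Fin k → Fin m → ℝ}

theorem uncovered_nonneg (hc : ∀ j, 0 < c j) (hA : ∀ i, IsRow (A i)) (z : Fin m → ℕ) :
    0 ≤ uncovered s β c A z := Finset.sum_nonneg fun i _ => rowWeight_nonneg hc (hA i) z

theorem uncovered_eq_zero_or_le (hc : ∀ j, 0 < c j) (hA : ∀ i, IsRow (A i)) (z : Fin m → ℕ) :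
    uncovered s β c A z = 0 ∨ s ≤ 2 * uncovered s β c A z := by
  by_cases h : ∃ i, rowWeight s β c (A i) z ≠ 0
  · obtain ⟨i, hi⟩ := h
    right
    have h1 := (rowWeight_eq_zero_or_le (s := s) (β := β) hc (hA i) z).resolve_left hi
    have h2 : rowWeight s β c (A i) z ≤ uncovered s β c A z :=
      Finset.single_le_sum (fun i _ => rowWeight_nonneg hc (hA i) z) (Finset.mem_univ i)
    linarith
  · push Not at h
    exact Or.inl (Finset.sum_eq_zero fun i _ => h i)

theorem uncovered_dropRow_le (hc : ∀ j, 0 < c j) {A : Fin (k + 1) → Fin m → ℝ}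
    (hA : ∀ i, IsRow (A i)) (i : Fin (k + 1)) (z : Fin m → ℕ) :
    uncovered s β c (dropRow i A) z ≤ uncovered s β c A z := by
  have h := sum_dropRow i A fun a => rowWeight s β c a z
  have := rowWeight_nonneg (s := s) (β := β) hc (hA i) z
  unfold uncovered
  linarith

theorem uncovered_le (hβ : 0 ≤ β) (hc : ∀ j, 0 < c j) (hA : ∀ i, IsRow (A i)) (z : Fin m → ℕ) :
    uncovered s β c A z ≤ k * β := by
  have := Finset.sum_le_sum fun i (_ : i ∈ Finset.univ) =>
    rowWeight_le (s := s) (β := β) hβ hc (hA i) z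
  simpa [uncovered] using this

end weight

theorem logPotential_nonneg {s ρ : ℝ} (hs : 0 < s) (h : ρ = 0 ∨ s ≤ 2 * ρ) :
    0 ≤ logPotential s ρ := by
  unfold logPotential
  split_ifs with h0
  · exact le_rfl
  · have := Real.log_nonneg ((one_le_div hs).2 (h.resolve_left h0))
    linarith

/-- For `ρ' > 0` this is `log t ≤ t - 1` at `t = ρ'/ρ`. For `ρ' = 0` the relative decrease is `1`,
which is what the summand `1` in `logPotential` is for. -/
theorem logPotential_le_sub {s ρ ρ' : ℝ} (hs : 0 < s) (h0 : 0 ≤ ρ') (hρ : 0 < ρ)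
    (h : s ≤ 2 * ρ) : logPotential s ρ' ≤ logPotential s ρ - (ρ - ρ') / ρ := by
  unfold logPotential
  rw [if_neg hρ.ne', sub_div, div_self hρ.ne']
  split_ifs with h1
  · have := Real.log_nonneg ((one_le_div hs).2 h)
    rw [h1]
    simp only [zero_div]
    linarith
  · have h2 : 0 < ρ' := lt_of_le_of_ne h0 (Ne.symm h1)
    have h3 := Real.log_le_sub_one_of_pos (div_pos h2 hρ)
    rw [Real.log_div h2.ne' hρ.ne'] at h3
    rw [Real.log_div (by positivity) hs.ne', Real.log_div (by positivity) hs.ne',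
      Real.log_mul two_ne_zero h2.ne', Real.log_mul two_ne_zero hρ.ne']
    linarith

theorem logPotential_mono {s ρ ρ' : ℝ} (hs : 0 < s) (h0 : 0 ≤ ρ') (hle : ρ' ≤ ρ)
    (h : ρ = 0 ∨ s ≤ 2 * ρ) : logPotential s ρ' ≤ logPotential s ρ := by
  rcases h with h | h
  · rw [show ρ' = ρ by linarith]
  · have hρ : 0 < ρ := by linarith
    have := logPotential_le_sub hs h0 hρ h
    have : 0 ≤ (ρ - ρ') / ρ := div_nonneg (by linarith) hρ.le
    linarith

/-! ## The multiplicative update -/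

/-- The factor by which the multiplicative update is normalized. -/
noncomputable def learnNorm {m : ℕ} (β : ℝ) (c a : Fin m → ℝ) (κ : ℝ) (x : Fin m → ℝ) : ℝ :=
  dot c (fun j => x j * Real.exp (κ * (a j / c j))) / β

/-- An upper bound for the change of the learning potential in a round on the row `a`. -/
noncomputable def learnGain {m : ℕ} (a : Fin m → ℝ) (Δ κ : ℝ) (x : Fin m → ℝ) : ℝ :=
  κ * ((Real.exp 1 - 1) * min (dot a x) Δ - 1)

/-- The chord of the convex function `exp` over `[0, 1]`; this is the origin of `e - 1`, and so of
the threshold. -/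
theorem exp_le_one_add_mul {u : ℝ} (h0 : 0 ≤ u) (h1 : u ≤ 1) :
    Real.exp u ≤ 1 + (Real.exp 1 - 1) * u := by
  have h := convexOn_exp.2 (Set.mem_univ 0) (Set.mem_univ 1) (sub_nonneg.2 h1) h0 (by ring)
  simp only [smul_eq_mul, mul_zero, mul_one, zero_add, Real.exp_zero] at h
  linarith

section learn
variable {m : ℕ} {c a x : Fin m → ℝ} {β κ : ℝ}

theorem one_le_learnNorm (hβ : 0 < β) (hc : ∀ j, 0 < c j) (ha : ∀ j, 0 ≤ a j)
    (hx : ∀ j, 0 ≤ x j) (hcx : dot c x = β) (hκ : 0 ≤ κ) : 1 ≤ learnNorm β c a κ x := by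
  rw [learnNorm, one_le_div hβ]
  nth_rw 1 [← hcx]
  refine Finset.sum_le_sum fun j _ => mul_le_mul_of_nonneg_left ?_ (hc j).le
  exact le_mul_of_one_le_right (hx j)
    (Real.one_le_exp (mul_nonneg hκ (div_nonneg (ha j) (hc j).le)))

/-- Minimality of the greedy ratio puts the exponents `κ a_j / c_j` in `[0, 1]`. The chord bound
then gives `Z ≤ 1 + (e-1) κ ⟨a, x⟩ / β`, and `log Z ≤ Z - 1`. -/
theorem mul_log_learnNorm_le (hβ : 0 < β) (hc : ∀ j, 0 < c j) (ha : ∀ j, 0 ≤ a j)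
    (hx : ∀ j, 0 ≤ x j) (hcx : dot c x = β) (hκ : 0 ≤ κ) (hκ' : ∀ j, κ * a j ≤ c j) :
    β * Real.log (learnNorm β c a κ x) ≤ (Real.exp 1 - 1) * κ * dot a x := by
  have h1 := one_le_learnNorm hβ hc ha hx hcx hκ
  have h2 : dot c (fun j => x j * Real.exp (κ * (a j / c j))) ≤
      β + (Real.exp 1 - 1) * κ * dot a x := by
    rw [← hcx, dot, dot, dot, Finset.mul_sum, ← Finset.sum_add_distrib]
    refine Finset.sum_le_sum fun j _ => ?_
    have hu : κ * (a j / c j) ≤ 1 := by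
      rw [← mul_div_assoc, div_le_one (hc j)]
      exact hκ' j
    have h3 := exp_le_one_add_mul (mul_nonneg hκ (div_nonneg (ha j) (hc j).le)) hu
    have h4 : c j * (κ * (a j / c j)) = κ * a j := by
      have := (hc j).ne'
      field_simp
    calc _ ≤ c j * (x j * (1 + (Real.exp 1 - 1) * (κ * (a j / c j)))) := by
          have := (hc j).le
          have := hx j
          gcongr
      _ = c j * x j + (Real.exp 1 - 1) * x j * (c j * (κ * (a j / c j))) := by ring
      _ = _ := by rw [h4]; ring
  have h3 := Real.log_le_sub_one_of_pos (zero_lt_one.trans_le h1)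
  have h4 : β * (learnNorm β c a κ x - 1) ≤ (Real.exp 1 - 1) * κ * dot a x := by
    rw [mul_sub, learnNorm, mul_div_cancel₀ _ hβ.ne']
    linarith
  exact (mul_le_mul_of_nonneg_left h3 hβ.le).trans h4

theorem learn_apply (j : Fin m) :
    learn β c a κ x j = x j * Real.exp (κ * (a j / c j)) / learnNorm β c a κ x := rfl

theorem learn_nonneg (hβ : 0 < β) (hc : ∀ j, 0 < c j) (ha : ∀ j, 0 ≤ a j)
    (hx : ∀ j, 0 ≤ x j) (hcx : dot c x = β) (hκ : 0 ≤ κ) (j : Fin m) :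
    0 ≤ learn β c a κ x j := by
  have h1 := one_le_learnNorm hβ hc ha hx hcx hκ
  have := hx j
  rw [learn_apply]
  positivity

theorem dot_learn (hβ : 0 < β) (hc : ∀ j, 0 < c j) (ha : ∀ j, 0 ≤ a j)
    (hx : ∀ j, 0 ≤ x j) (hcx : dot c x = β) (hκ : 0 ≤ κ) : dot c (learn β c a κ x) = β := by
  have h1 := one_le_learnNorm hβ hc ha hx hcx hκ
  have h2 : dot c (learn β c a κ x) =
      dot c (fun j => x j * Real.exp (κ * (a j / c j))) / learnNorm β c a κ x := by
    simp only [dot, learn_apply, Finset.sum_div, mul_div_assoc]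
  have h3 : dot c (fun j => x j * Real.exp (κ * (a j / c j))) = learnNorm β c a κ x * β := by
    rw [learnNorm, div_mul_cancel₀ _ hβ.ne']
  rw [h2, h3, mul_div_cancel_left₀ _ (by linarith)]

/-- The change of the learning potential in a round. -/
theorem learn_change_le {Δ : ℝ} (hβ : 0 < β) (hc : ∀ j, 0 < c j) (ha : ∀ j, 0 ≤ a j)
    (hx : ∀ j, 0 ≤ x j) (hcx : dot c x = β) (hκ : 0 ≤ κ) (hκ' : ∀ j, κ * a j ≤ c j)
    (hΔ : threshold < Δ) :
    (if dot a x < Δ then β * Real.log (learnNorm β c a κ x) - κ else 0) ≤ learnGain a Δ κ x := by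
  unfold learnGain
  split_ifs with h
  · rw [min_eq_left h.le]
    have := mul_log_learnNorm_le hβ hc ha hx hcx hκ hκ'
    linarith
  -- Without an update the change is zero, and the claimed bound is `κ((e-1)Δ - 1) ≥ 0`. This is
  -- exactly `Δ ≥ γ`.
  · rw [min_eq_right (not_lt.1 h)]
    have h1 := lt_exp_one
    have h2 : 1 < (Real.exp 1 - 1) * Δ := by
      rw [threshold, inv_lt_iff_one_lt_mul₀ (by linarith)] at hΔ
      linarith
    exact mul_nonneg hκ (by linarith)

theorem learnGain_le {Δ : ℝ} (hκ : 0 ≤ κ) (hΔ : Δ ≤ 1) : learnGain a Δ κ x ≤ κ := by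
  have h1 := lt_exp_one
  have h2 := exp_one_lt
  unfold learnGain
  have h3 : (Real.exp 1 - 1) * min (dot a x) Δ ≤ (Real.exp 1 - 1) * 1 :=
    mul_le_mul_of_nonneg_left ((min_le_right _ _).trans hΔ) (by linarith)
  exact mul_le_of_le_one_right hκ (by linarith)

end learn

/-! ## Covering against learning -/

section step
variable {m k : ℕ} {c x : Fin m → ℝ} {s β : ℝ}

/-- The accounting of one active round on row `i`. An active row of weight zero is cheap and is
charged to `8 s`. For any other row the cost `4κ` is paid by learning, up to the gap between `8 w_i
q_i` and its weighted average over all rows. This gap may be positive for an individual row and is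
only controlled after averaging over `i`. -/
theorem coinMean_potential_le {A : Fin (k + 1) → Fin m → ℝ} (hs : 0 < s) (hβ : 0 < β)
    (hc : ∀ j, 0 < c j) (hA : ∀ i, IsRow (A i)) (hx : ∀ j, 0 ≤ x j) (hcx : dot c x = β)
    (z : Fin m → ℕ) (i : Fin (k + 1)) (hact : threshold < deficit (A i) z)
    (hr : minRatio c (A i) ≤ β) :
    coinMean (fun j => Int.fract (deficit (A i) z * minRatio c (A i) * x j / β)) (fun b =>
        dot c (toReal (buy c (A i) (deficit (A i) z)
          (fun j => deficit (A i) z * minRatio c (A i) * x j / β) z b)) +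
        24 * β * logPotential s (uncovered s β c (dropRow i A) (buy c (A i) (deficit (A i) z)
          (fun j => deficit (A i) z * minRatio c (A i) * x j / β) z b))) +
      4 * learnGain (A i) (deficit (A i) z) (deficit (A i) z * minRatio c (A i)) x ≤
    dot c (toReal z) + 24 * β * logPotential s (uncovered s β c A z) + 8 * s +
      8 * (rowWeight s β c (A i) z * min 1 (dot (A i) x)) -
      8 * (rowWeight s β c (A i) z / uncovered s β c A z *
        ∑ l, rowWeight s β c (A l) z * min 1 (dot (A l) x)) := by
  set Δ := deficit (A i) z with hΔ
  set r := minRatio c (A i) with hrd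
  set κ := Δ * r with hκd
  set y : Fin m → ℝ := fun j => κ * x j / β with hyd
  set p : Fin m → ℝ := fun j => Int.fract (κ * x j / β)
  set ρ := uncovered s β c A z with hρd
  set w : Fin (k + 1) → ℝ := fun l => rowWeight s β c (A l) z with hwd
  have hr0 : 0 < r := minRatio_pos hc (hA i).2
  have hγ := half_lt_threshold
  have hΔ1 : Δ ≤ 1 := deficit_le_one (fun j => ((hA i).1 j).1) z
  have hκ0 : 0 < κ := mul_pos (by linarith) hr0
  have hκr : κ ≤ r := by nlinarith
  have hy : ∀ j, 0 ≤ y j := fun j => div_nonneg (mul_nonneg hκ0.le (hx j)) hβ.le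
  have hp : ∀ j, 0 ≤ p j ∧ p j ≤ 1 := fract_mem y
  have hdoty : ∀ a : Fin m → ℝ, dot a y = κ / β * dot a x := by
    intro a
    rw [← dot_mul_left]
    congr 1
    ext j
    simp only [hyd]
    ring
  -- The rounding costs `⟨c, y⟩ = κ ⟨c, x⟩ / β = κ` in expectation, and the greedy column at most
  -- `3κ`.
  have hcost : coinMean p (fun b => dot c (toReal (buy c (A i) Δ y z b))) ≤
      dot c (toReal z) + 4 * κ := by
    have h1 := coinMean_mono hp fun b => dot_buy_le hc (hA i) hact y z b
    rw [coinMean_add, coinMean_add, coinMean_const, coinMean_const,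
      coinMean_dot_rounding c y hy, hdoty, hcx, div_mul_cancel₀ _ hβ.ne'] at h1
    linarith
  have hρ0 : 0 ≤ ρ := uncovered_nonneg hc hA z
  have hw0 : ∀ l, 0 ≤ w l := fun l => rowWeight_nonneg hc (hA l) z
  have hwi : w i ≤ ρ := Finset.single_le_sum (fun l _ => hw0 l) (Finset.mem_univ i)
  have hdx : ∀ l, 0 ≤ dot (A l) x := fun l => dot_nonneg (fun j => ((hA l).1 j).1) hx
  have hq0 : ∀ l, 0 ≤ w l * min 1 (dot (A l) x) := fun l =>
    mul_nonneg (hw0 l) (le_min zero_le_one (hdx l))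
  have hb : ∀ b, uncovered s β c (dropRow i A) (buy c (A i) Δ y z b) ≤
      ρ - ∑ l, w l * min 1 (dot (A l) (toReal (rounding y b))) := by
    intro b
    refine (uncovered_dropRow_le hc hA i _).trans ?_
    rw [hρd, uncovered, uncovered, ← Finset.sum_sub_distrib]
    refine Finset.sum_le_sum fun l _ => rowWeight_le_sub hc (hA l) fun j => ?_
    exact Nat.le_add_right _ _
  have hdrop : ∀ l, IsRow (dropRow i A l) := fun l => hA _
  have hb0 : ∀ b, 0 ≤ uncovered s β c (dropRow i A) (buy c (A i) Δ y z b) := fun b =>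
    uncovered_nonneg hc hdrop _
  have hunc := uncovered_eq_zero_or_le (s := s) (β := β) hc hA z
  have hlearn : learnGain (A i) Δ κ x ≤ κ := learnGain_le hκ0.le hΔ1
  by_cases hlight : w i = 0
  -- The row is active with ratio at most `β`, so its weight can vanish only because its ratio is
  -- below `s`. Cost and learning then amount to at most `4κ + 4κ ≤ 8s`, and `ρ` does not increase.
  · have hks : κ ≤ s := by
      by_contra hcon
      have : w i = κ := if_pos ⟨hact, hr, by linarith⟩
      linarith
    have h1 : coinMean p (fun b => 24 * β *
        logPotential s (uncovered s β c (dropRow i A) (buy c (A i) Δ y z b))) ≤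
        24 * β * logPotential s ρ := by
      rw [← coinMean_const (p := p) (24 * β * logPotential s ρ)]
      refine coinMean_mono hp fun b => mul_le_mul_of_nonneg_left ?_ (by linarith)
      refine logPotential_mono hs (hb0 b) ?_ hunc
      refine (hb b).trans (sub_le_self _ (Finset.sum_nonneg fun l _ => mul_nonneg (hw0 l) ?_))
      exact le_min zero_le_one (dot_nonneg (fun j => ((hA l).1 j).1) fun _ => Nat.cast_nonneg _)
    have h2 : rowWeight s β c (A i) z = 0 := hlight
    rw [coinMean_add, h2]
    simp only [zero_mul, zero_div, mul_zero, add_zero, sub_zero]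
    linarith
  · have hwκ : w i = κ := by
      by_contra hcon
      have : rowWeight s β c (A i) z = κ ∨ rowWeight s β c (A i) z = 0 := by
        unfold rowWeight
        split_ifs
        · exact Or.inl rfl
        · exact Or.inr rfl
      rcases this with h | h
      · exact hcon h
      · exact hlight h
    have hρ : 0 < ρ := by linarith
    have h1 : coinMean p (fun b => 24 * β *
        logPotential s (uncovered s β c (dropRow i A) (buy c (A i) Δ y z b))) ≤
        24 * β * (logPotential s ρ -
          (∑ l, w l * (κ / β * min 1 (dot (A l) x) / 3)) / ρ) := by
      have h2 : ∀ b, 24 * β * logPotential s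
            (uncovered s β c (dropRow i A) (buy c (A i) Δ y z b)) ≤
          24 * β * logPotential s ρ + (- (24 * β / ρ)) *
            ∑ l, w l * min 1 (dot (A l) (toReal (rounding y b))) := by
        intro b
        have h3 := logPotential_le_sub hs (hb0 b) hρ (hunc.resolve_left hρ.ne')
        have h4 : (∑ l, w l * min 1 (dot (A l) (toReal (rounding y b)))) / ρ ≤
            (ρ - uncovered s β c (dropRow i A) (buy c (A i) Δ y z b)) / ρ := by
          gcongr
          linarith [hb b]
        have h5 : 24 * β * logPotential s
              (uncovered s β c (dropRow i A) (buy c (A i) Δ y z b)) ≤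
            24 * β * (logPotential s ρ -
              (∑ l, w l * min 1 (dot (A l) (toReal (rounding y b)))) / ρ) :=
          mul_le_mul_of_nonneg_left (by linarith) (by linarith)
        refine h5.trans (le_of_eq ?_)
        ring
      refine (coinMean_mono hp h2).trans ?_
      rw [coinMean_add, coinMean_const, coinMean_const_mul, coinMean_sum]
      have h6 : ∑ l, w l * (κ / β * min 1 (dot (A l) x) / 3) ≤
          ∑ l, coinMean p (fun b => w l * min 1 (dot (A l) (toReal (rounding y b)))) := by
        refine Finset.sum_le_sum fun l _ => ?_
        rw [coinMean_const_mul]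
        refine mul_le_mul_of_nonneg_left ?_ (hw0 l)
        refine le_trans ?_ (le_coinMean_min_rounding (A l) y (hA l).1 hy)
        rw [hdoty]
        -- As `κ ≤ β`, the factor `κ/β` can be pulled out of `min 1`. With the constant `1/3` of the
        -- rounding lemma, `24 β` becomes `8 κ`.
        have hkb : κ / β ≤ 1 := (div_le_one hβ).2 (hκr.trans hr)
        have hkb0 : 0 ≤ κ / β := div_nonneg hκ0.le hβ.le
        have h7 : κ / β * min 1 (dot (A l) x) ≤ min 1 (κ / β * dot (A l) x) := by
          refine le_min ?_ (mul_le_mul_of_nonneg_left (min_le_right _ _) hkb0)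
          nlinarith [min_le_left 1 (dot (A l) x), le_min zero_le_one (hdx l)]
        linarith
      have h8 : 0 ≤ 24 * β / ρ := by positivity
      have h9 := mul_le_mul_of_nonneg_left h6 h8
      have h10 : 24 * β * (logPotential s ρ - (∑ l, w l * (κ / β * min 1 (dot (A l) x) / 3)) / ρ) =
          24 * β * logPotential s ρ -
            24 * β / ρ * ∑ l, w l * (κ / β * min 1 (dot (A l) x) / 3) := by ring
      rw [h10]
      linarith
    have h11 : 24 * β * (logPotential s ρ -
        (∑ l, w l * (κ / β * min 1 (dot (A l) x) / 3)) / ρ) =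
        24 * β * logPotential s ρ - 8 * (κ / ρ * ∑ l, w l * min 1 (dot (A l) x)) := by
      have : ∑ l, w l * (κ / β * min 1 (dot (A l) x) / 3) =
          κ / β / 3 * ∑ l, w l * min 1 (dot (A l) x) := by
        rw [Finset.mul_sum]
        exact Finset.sum_congr rfl fun l _ => by ring
      rw [this]
      field_simp
      ring
    -- Uses `e - 1 ≤ 2` and `Δ ≤ 1`. The `-4κ` cancels the cost of the round.
    have h12 : 4 * learnGain (A i) Δ κ x ≤ 8 * (κ * min 1 (dot (A i) x)) - 4 * κ := by
      have he := exp_one_lt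
      have he' := lt_exp_one
      have h13 : min (dot (A i) x) Δ ≤ min 1 (dot (A i) x) :=
        le_min ((min_le_right _ _).trans hΔ1) (min_le_left _ _)
      have h14 : 0 ≤ min 1 (dot (A i) x) := le_min zero_le_one (hdx i)
      unfold learnGain
      have h15 : (Real.exp 1 - 1) * min (dot (A i) x) Δ ≤ 2 * min 1 (dot (A i) x) := by
        nlinarith
      nlinarith [mul_le_mul_of_nonneg_left h15 hκ0.le]
    have h16 : rowWeight s β c (A i) z = κ := hwκ
    rw [coinMean_add, h16]
    change _ ≤ _ - 8 * (κ / ρ * ∑ l, w l * min 1 (dot (A l) x))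
    linarith

/-- `Σ_i w_i = ρ`, so the averaged term sums to `8 Σ_l w_l q_l`, the sum of the others. If `ρ = 0`,
then all weights vanish and so do all terms. -/
theorem sum_weight_excess {A : Fin k → Fin m → ℝ} (hc : ∀ j, 0 < c j) (hA : ∀ i, IsRow (A i))
    (z : Fin m → ℕ) :
    ∑ i, (8 * (rowWeight s β c (A i) z * min 1 (dot (A i) x)) -
      8 * (rowWeight s β c (A i) z / uncovered s β c A z *
        ∑ l, rowWeight s β c (A l) z * min 1 (dot (A l) x))) = 0 := by
  rw [Finset.sum_sub_distrib, ← Finset.mul_sum, ← Finset.mul_sum, ← Finset.sum_mul,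
    ← Finset.sum_div]
  change 8 * _ - 8 * (uncovered s β c A z / uncovered s β c A z * _) = 0
  rcases eq_or_ne (uncovered s β c A z) 0 with h | h
  · have h1 : ∀ i, rowWeight s β c (A i) z = 0 := fun i =>
      (Finset.sum_eq_zero_iff_of_nonneg fun i _ => rowWeight_nonneg hc (hA i) z).1 h i
        (Finset.mem_univ i)
    simp [h1]
  · rw [div_self h]
    ring

end step

/-! ## The learning potential -/

/-- Minus the learning potential: the cross entropy of `x` relative to `u`. -/
noncomputable def crossEntropy {m : ℕ} (c u : Fin m → ℝ) (β : ℝ) (x : Fin m → ℝ) : ℝ :=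
  ∑ j, c j * u j * Real.log (c j * x j / β)

section crossEntropy
variable {m : ℕ} {c u x a : Fin m → ℝ} {β κ : ℝ}

theorem crossEntropy_nonpos (hβ : 0 < β) (hc : ∀ j, 0 < c j) (hu : ∀ j, 0 ≤ u j)
    (hx : ∀ j, 0 ≤ x j) (hcx : dot c x = β) : crossEntropy c u β x ≤ 0 := by
  refine Finset.sum_nonpos fun j _ => ?_
  have h1 : c j * x j ≤ β := by
    rw [← hcx]
    exact Finset.single_le_sum (f := fun j => c j * x j)
      (fun j _ => mul_nonneg (hc j).le (hx j)) (Finset.mem_univ j)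
  have h2 : 0 ≤ c j * x j := mul_nonneg (hc j).le (hx j)
  have h3 := Real.log_nonpos (div_nonneg h2 hβ.le) ((div_le_one hβ).2 h1)
  exact mul_nonpos_of_nonneg_of_nonpos (mul_nonneg (hc j).le (hu j)) h3

/-- The logarithm makes the change exact: it is `κ⟨a, u⟩ - ⟨c, u⟩ log Z`. Now use `⟨a, u⟩ ≥ 1`, `⟨c,
u⟩ ≤ β` and `log Z ≥ 0`. Coordinates with `u j = 0` drop out, so `x` has to be positive only on the
support of `u`. -/
theorem crossEntropy_learn (hβ : 0 < β) (hc : ∀ j, 0 < c j) (ha : ∀ j, 0 ≤ a j)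
    (hx : ∀ j, 0 ≤ x j) (hcx : dot c x = β) (hu : ∀ j, 0 ≤ u j) (hux : ∀ j, 0 < u j → 0 < x j)
    (hcu : dot c u ≤ β) (hau : 1 ≤ dot a u) (hκ : 0 ≤ κ) :
    crossEntropy c u β x + κ - β * Real.log (learnNorm β c a κ x) ≤
      crossEntropy c u β (learn β c a κ x) := by
  have h1 := one_le_learnNorm hβ hc ha hx hcx hκ
  set Z := learnNorm β c a κ x with hZ
  have h2 : crossEntropy c u β (learn β c a κ x) =
      crossEntropy c u β x + κ * dot a u - dot c u * Real.log Z := by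
    rw [crossEntropy, crossEntropy, dot, dot, Finset.mul_sum, Finset.sum_mul,
      ← Finset.sum_add_distrib, ← Finset.sum_sub_distrib]
    refine Finset.sum_congr rfl fun j _ => ?_
    rcases (hu j).eq_or_lt with h | h
    · simp [← h]
    · have hxj := hux j h
      have hcj := hc j
      have hZ0 : 0 < Z := by linarith
      rw [learn_apply, ← hZ, show c j * (x j * Real.exp (κ * (a j / c j)) / Z) / β =
        (c j * x j / β) * Real.exp (κ * (a j / c j)) / Z by ring,
        Real.log_div (by positivity) hZ0.ne', Real.log_mul (by positivity) (Real.exp_pos _).ne',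
        Real.log_exp]
      field_simp
  rw [h2]
  have h3 : dot c u * Real.log Z ≤ β * Real.log Z :=
    mul_le_mul_of_nonneg_right hcu (Real.log_nonneg h1)
  nlinarith

end crossEntropy

/-- Combines bounds for the individual rows whose errors `e i` cancel. The summation takes place in
the reals, since the errors have both signs. -/
theorem sum_mean_le {k : ℕ} {φ : ℝ} (M : Fin (k + 1) → ℝ≥0∞) (e : Fin (k + 1) → ℝ)
    (h : ∀ i, ∃ B : ℝ, 0 ≤ B ∧ M i ≤ ENNReal.ofReal B ∧ B ≤ φ + e i) (he : ∑ i, e i = 0) :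
    ∑ i, M i ≤ (k + 1 : ℕ) * ENNReal.ofReal φ := by
  choose B hB0 hMB hB using h
  calc ∑ i, M i ≤ ∑ i, ENNReal.ofReal (B i) := Finset.sum_le_sum fun i _ => hMB i
    _ = ENNReal.ofReal (∑ i, B i) := (ENNReal.ofReal_sum_of_nonneg fun i _ => hB0 i).symm
    _ ≤ ENNReal.ofReal (∑ i, (φ + e i)) :=
        ENNReal.ofReal_le_ofReal (Finset.sum_le_sum fun i _ => hB i)
    _ = ENNReal.ofReal ((k + 1 : ℕ) * φ) := by
        rw [Finset.sum_add_distrib, he]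
        simp
    _ = _ := by rw [ENNReal.ofReal_mul (Nat.cast_nonneg _), ENNReal.ofReal_natCast]

theorem third_le_dot {m : ℕ} {a : Fin m → ℝ} {z : Fin m → ℕ} (h : ¬threshold < deficit a z) :
    1 ≤ 3 * dot a (toReal z) := by
  have h1 : 1 - dot a (toReal z) ≤ deficit a z := le_max_right _ _
  have := threshold_lt
  linarith

theorem dot_toReal_mul {m : ℕ} (k : ℕ) (a : Fin m → ℝ) (z : Fin m → ℕ) :
    dot a (toReal fun j => k * z j) = k * dot a (toReal z) := by
  rw [← dot_mul_left]
  congr 1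
  ext j
  simp [toReal]

/-! ## LearnOrCoverCIP -/

theorem locRound_of_lt {m : ℕ} {β : ℝ} {c a : Fin m → ℝ} {s : LocState m}
    (h : threshold < deficit a s.z) :
    locRound β c a s =
      (coins fun j => Int.fract (deficit a s.z * minRatio c a * s.x j / β)).map fun b =>
        { x := if dot a s.x < deficit a s.z then
            learn β c a (deficit a s.z * minRatio c a) s.x else s.x
          z := buy c a (deficit a s.z) (fun j => deficit a s.z * minRatio c a * s.x j / β) s.z b } := by
  simp only [locRound, h, if_true]
  rfl

theorem locRound_of_not_lt {m : ℕ} {β : ℝ} {c a : Fin m → ℝ} {s : LocState m}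
    (h : ¬threshold < deficit a s.z) : locRound β c a s = PMF.pure s := by
  simp only [locRound, h, if_false]

theorem locRound_support {m : ℕ} {β : ℝ} {c a : Fin m → ℝ} (ha : IsRow a) {s s' : LocState m}
    (h : s' ∈ (locRound β c a s).support) :
    (∀ j, s.z j ≤ s'.z j) ∧ 1 ≤ 3 * dot a (toReal s'.z) := by
  by_cases hact : threshold < deficit a s.z
  · rw [locRound_of_lt hact, PMF.mem_support_map_iff] at h
    obtain ⟨b, -, rfl⟩ := h
    refine ⟨le_buy _ _ _ b, ?_⟩
    have := one_le_dot_buy (c := c) ha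
      (fun j => deficit a s.z * minRatio c a * s.x j / β) s.z b
    dsimp only
    linarith
  · rw [locRound_of_not_lt hact, PMF.mem_support_pure_iff] at h
    subst h
    exact ⟨fun j => le_rfl, third_le_dot hact⟩

/-- A history in which every round keeps what was bought before and covers a third of the arriving row
is an online solution up to the factor `3`. -/
theorem isOnlineSolution_of_step {m n k : ℕ} {r : Fin n → Fin m → ℝ} (hr : ∀ t j, 0 ≤ r t j)
    {z : Fin (n + 1) → Fin m → ℕ} (hmono : ∀ t j, z (Fin.castSucc t) j ≤ z t.succ j)
    (hcov : ∀ t, 1 ≤ (k : ℝ) * dot (r t) (toReal (z t.succ))) : IsOnlineSolution k r z := by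
  have hz : Monotone z := Fin.monotone_iff_le_succ.2 fun t j => hmono t j
  refine ⟨hz, fun t s hst => ?_⟩
  rw [dot_toReal_mul]
  refine (hcov s).trans (mul_le_mul_of_nonneg_left ?_ (Nat.cast_nonneg _))
  exact dot_toReal_mono (hr s) fun j => hz (Fin.succ_le_succ_iff.2 hst) j

theorem learnOrCover_isOnlineSolution {m n : ℕ} {β : ℝ} {c : Fin m → ℝ} {r : Fin n → Fin m → ℝ}
    (hr : ∀ t, IsRow (r t)) {z : Fin (n + 1) → Fin m → ℕ}
    (hz : z ∈ (learnOrCover β c r).support) : IsOnlineSolution 3 r z := by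
  rw [learnOrCover, PMF.mem_support_map_iff] at hz
  obtain ⟨h, hh, rfl⟩ := hz
  obtain ⟨-, h1⟩ := trajectory_support _ _ _ _ h hh
  exact isOnlineSolution_of_step (fun t j => ((hr t).1 j).1)
    (fun t => (locRound_support (hr t) (h1 t)).1)
    (fun t => by exact_mod_cast (locRound_support (hr t) (h1 t)).2)

/-- The state of the algorithm is compatible with the fractional solution `u`. -/
def LocState.Good {m : ℕ} (β : ℝ) (c u : Fin m → ℝ) (s : LocState m) : Prop :=
  (∀ j, 0 ≤ s.x j) ∧ dot c s.x = β ∧ ∀ j, 0 < u j → 0 < s.x j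

/-- The potential of LearnOrCoverCIP. -/
noncomputable def locPotential {m : ℕ} (s₀ β : ℝ) (c u : Fin m → ℝ) (k : ℕ)
    (A : Fin k → Fin m → ℝ) (s : LocState m) : ℝ :=
  dot c (toReal s.z) + 24 * β * logPotential s₀ (uncovered s₀ β c A s.z) -
    4 * crossEntropy c u β s.x + 8 * s₀ * k

section loc
variable {m : ℕ} {s₀ β : ℝ} {c u : Fin m → ℝ}

theorem locPotential_nonneg (hs : 0 < s₀) (hβ : 0 < β) (hc : ∀ j, 0 < c j) (hu : ∀ j, 0 ≤ u j)
    {k : ℕ} {A : Fin k → Fin m → ℝ} (hA : ∀ i, IsRow (A i)) {s : LocState m}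
    (h : s.Good β c u) : dot c (toReal s.z) ≤ locPotential s₀ β c u k A s := by
  have h1 := crossEntropy_nonpos hβ hc hu h.1 h.2.1
  have h2 := logPotential_nonneg hs (uncovered_eq_zero_or_le (s := s₀) (β := β) hc hA s.z)
  have h3 : 0 ≤ 24 * β * logPotential s₀ (uncovered s₀ β c A s.z) := by positivity
  have h4 : 0 ≤ 8 * s₀ * (k : ℝ) := by positivity
  unfold locPotential
  linarith

theorem Good_learn (hβ : 0 < β) (hc : ∀ j, 0 < c j) {a : Fin m → ℝ} (ha : IsRow a)
    {s : LocState m} (h : s.Good β c u) (z : Fin m → ℕ) :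
    (LocState.mk (if dot a s.x < deficit a s.z then
      learn β c a (deficit a s.z * minRatio c a) s.x else s.x) z).Good β c u := by
  have ha0 : ∀ j, 0 ≤ a j := fun j => (ha.1 j).1
  have hκ : 0 ≤ deficit a s.z * minRatio c a :=
    mul_nonneg (deficit_nonneg _) (minRatio_pos hc ha.2).le
  obtain ⟨h1, h2, h3⟩ := h
  split_ifs
  · refine ⟨learn_nonneg hβ hc ha0 h1 h2 hκ, dot_learn hβ hc ha0 h1 h2 hκ, fun j hj => ?_⟩
    have := one_le_learnNorm hβ hc ha0 h1 h2 hκ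
    have := h3 j hj
    dsimp only
    rw [learn_apply]
    positivity
  · exact ⟨h1, h2, h3⟩

theorem locRound_good (hβ : 0 < β) (hc : ∀ j, 0 < c j) {a : Fin m → ℝ} (ha : IsRow a)
    {s s' : LocState m} (h : s.Good β c u) (hs' : s' ∈ (locRound β c a s).support) :
    s'.Good β c u := by
  by_cases hact : threshold < deficit a s.z
  · rw [locRound_of_lt hact, PMF.mem_support_map_iff] at hs'
    obtain ⟨b, -, rfl⟩ := hs'
    exact Good_learn hβ hc ha h _
  · rw [locRound_of_not_lt hact, PMF.mem_support_pure_iff] at hs'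
    rwa [hs']

theorem greedy_rate_le (hc : ∀ j, 0 < c j) {a : Fin m → ℝ} (ha : IsRow a) (z : Fin m → ℕ) :
    0 ≤ deficit a z * minRatio c a ∧ deficit a z * minRatio c a ≤ minRatio c a ∧
      ∀ j, deficit a z * minRatio c a * a j ≤ c j := by
  have ha0 : ∀ j, 0 ≤ a j := fun j => (ha.1 j).1
  have hr := minRatio_pos hc ha.2
  have h1 := deficit_le_one ha0 z
  have h0 := deficit_nonneg (a := a) z
  have h2 : deficit a z * minRatio c a ≤ minRatio c a := by nlinarith
  exact ⟨by positivity, h2, fun j =>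
    (mul_le_mul_of_nonneg_right h2 (ha0 j)).trans (minRatio_mul_le hc ha0 j)⟩

theorem crossEntropy_round (hβ : 0 < β) (hc : ∀ j, 0 < c j) (hu : ∀ j, 0 ≤ u j)
    (hcu : dot c u ≤ β) {a : Fin m → ℝ} (ha : IsRow a) (hau : 1 ≤ dot a u) {s : LocState m}
    (h : s.Good β c u) (hact : threshold < deficit a s.z) :
    crossEntropy c u β s.x -
      learnGain a (deficit a s.z) (deficit a s.z * minRatio c a) s.x ≤
    crossEntropy c u β (if dot a s.x < deficit a s.z then
      learn β c a (deficit a s.z * minRatio c a) s.x else s.x) := by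
  have ha0 : ∀ j, 0 ≤ a j := fun j => (ha.1 j).1
  obtain ⟨h1, h2, h3⟩ := h
  obtain ⟨hκ, -, hκ'⟩ := greedy_rate_le hc ha s.z
  have h4 := learn_change_le hβ hc ha0 h1 h2 hκ hκ' hact
  split_ifs at h4 ⊢ with h5
  · have := crossEntropy_learn hβ hc ha0 h1 h2 hu h3 hcu hau hκ
    linarith
  · linarith

/-- The supermartingale property: one active round by `coinMean_potential_le` and
`crossEntropy_round`, a skipped one by monotonicity, and the sum over rows by `sum_weight_excess`.
-/
theorem sum_locRound_le (hs : 0 < s₀) (hβ : 0 < β) (hc : ∀ j, 0 < c j) (hu : ∀ j, 0 ≤ u j)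
    (hcu : dot c u ≤ β) {k : ℕ} {A : Fin (k + 1) → Fin m → ℝ}
    (hA : ∀ i, IsRow (A i)) (hAu : ∀ i, 1 ≤ dot (A i) u) {s : LocState m} (h : s.Good β c u) :
    ∑ i, mean (locRound β c (A i) s)
        (fun s' => ENNReal.ofReal (locPotential s₀ β c u k (dropRow i A) s')) ≤
      (k + 1 : ℕ) * ENNReal.ofReal (locPotential s₀ β c u (k + 1) A s) := by
  refine sum_mean_le _ _ (fun i => ?_) (sum_weight_excess (s := s₀) (β := β) (x := s.x) hc hA s.z)
  have hdrop : ∀ l, IsRow (dropRow i A l) := fun l => hA _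
  by_cases hact : threshold < deficit (A i) s.z
  -- A full greedy cover of one row is no dearer than the feasible `u`.
  · have hr : minRatio c (A i) ≤ β :=
      (minRatio_le_dot hc (fun j => ((hA i).1 j).1) (hA i).2 hu (hAu i)).trans hcu
    have h1 := coinMean_potential_le hs hβ hc hA h.1 h.2.1 s.z i hact hr
    have h2 := crossEntropy_round hβ hc hu hcu (hA i) (hAu i) h hact
    have hg := fun z => Good_learn hβ hc (hA i) h z
    have hn := fun z => (dot_nonneg (fun j => (hc j).le) fun _ => Nat.cast_nonneg _).trans
      (locPotential_nonneg hs hβ hc hu hdrop (hg z))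
    rw [locRound_of_lt hact, mean_map, mean_coins (fract_mem _) fun b => hn _]
    refine ⟨_, coinMean_nonneg (fract_mem _) fun b => hn _, le_rfl, ?_⟩
    simp only [locPotential]
    simp only [sub_eq_add_neg, add_assoc, coinMean_add, coinMean_const] at h1 ⊢
    push_cast
    linarith
  · have h0 : rowWeight s₀ β c (A i) s.z = 0 := if_neg fun h => hact h.1
    rw [locRound_of_not_lt hact, mean_pure, h0]
    refine ⟨_, (dot_nonneg (fun j => (hc j).le) fun _ => Nat.cast_nonneg _).trans
      (locPotential_nonneg hs hβ hc hu hdrop h), le_rfl, ?_⟩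
    have h1 := logPotential_mono hs (uncovered_nonneg (s := s₀) (β := β) hc hdrop s.z)
      (uncovered_dropRow_le hc hA i s.z) (uncovered_eq_zero_or_le hc hA s.z)
    have h2 := mul_le_mul_of_nonneg_left h1 (by linarith : 0 ≤ 24 * β)
    simp only [locPotential, zero_mul, zero_div, mul_zero, sub_zero, add_zero]
    push_cast
    linarith

end loc

/-- The initial uncovered weight contributes a logarithmic term. -/
theorem logPotential_uncovered_le {m k n : ℕ} {β : ℝ} {c : Fin m → ℝ} {A : Fin k → Fin m → ℝ}
    (hβ : 0 < β) (hc : ∀ j, 0 < c j) (hA : ∀ i, IsRow (A i)) (hn : 0 < n) (hk : k ≤ n)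
    (z : Fin m → ℕ) :
    logPotential (β / n) (uncovered (β / n) β c A z) ≤ 2 + 2 * Real.log n := by
  have hn' : (0 : ℝ) < n := Nat.cast_pos.2 hn
  have hs : 0 < β / n := by positivity
  have h1 : uncovered (β / n) β c A z ≤ n * β :=
    (uncovered_le hβ.le hc hA z).trans
      (mul_le_mul_of_nonneg_right (Nat.cast_le.2 hk) hβ.le)
  have hn1 : (1 : ℝ) ≤ n := Nat.one_le_cast.2 hn
  have h2 : β / n ≤ 2 * (n * β) := by
    rw [div_le_iff₀ hn']
    nlinarith [mul_pos hn' hβ, mul_le_mul hn1 hn1 zero_le_one hn'.le]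
  refine (logPotential_mono hs (uncovered_nonneg hc hA z) h1 (Or.inr h2)).trans ?_
  rw [logPotential, if_neg (by positivity), show 2 * (n * β) / (β / n) = 2 * ((n : ℝ) * n) by
    field_simp, Real.log_mul two_ne_zero (by positivity), Real.log_mul hn'.ne' hn'.ne']
  have := Real.log_two_lt_d9
  linarith

/-- Additive constants are absorbed through `2 ≤ 3 log(mn)`, which is where `mn ≥ 2` is needed. -/
theorem log_mul_lower {m n : ℕ} (h : 2 ≤ m * n) :
    Real.log m ≤ Real.log (m * n) ∧ Real.log n ≤ Real.log (m * n) ∧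
      0 ≤ Real.log m ∧ 0 ≤ Real.log n ∧ 2 ≤ 3 * Real.log (m * n) ∧
      Real.log (m * n) = Real.log m + Real.log n := by
  have hm : 0 < m := Nat.pos_of_ne_zero fun h0 => by simp [h0] at h
  have hn : 0 < n := Nat.pos_of_ne_zero fun h0 => by simp [h0] at h
  have h1 : Real.log (m * n) = Real.log m + Real.log n :=
    Real.log_mul (Nat.cast_ne_zero.2 hm.ne') (Nat.cast_ne_zero.2 hn.ne')
  have h2 := Real.log_nonneg (Nat.one_le_cast.2 hm : (1 : ℝ) ≤ m)
  have h3 := Real.log_nonneg (Nat.one_le_cast.2 hn : (1 : ℝ) ≤ n)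
  have h4 : Real.log 2 ≤ Real.log (m * n) :=
    Real.log_le_log two_pos (by exact_mod_cast h)
  have := Real.log_two_gt_d9
  exact ⟨by linarith, by linarith, h2, h3, by linarith, h1⟩

/-! ## Optimal values -/

section opt
variable {m n : ℕ} {A : Fin n → Fin m → ℝ} {c : Fin m → ℝ}

/-- One multiplicity for all columns, so large that a single positive entry of each row suffices. -/
theorem exists_integer_feasible (hA0 : ∀ i j, 0 ≤ A i j) (hA : ∀ i, ∃ j, 0 < A i j) :
    ∃ z : Fin m → ℕ, ∀ i, 1 ≤ dot (A i) (toReal z) := by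
  choose f hf using hA
  refine ⟨fun _ => ⌈∑ i, (A i (f i))⁻¹⌉₊, fun i => ?_⟩
  have h1 : (A i (f i))⁻¹ ≤ (⌈∑ i, (A i (f i))⁻¹⌉₊ : ℝ) :=
    (Finset.single_le_sum (f := fun i => (A i (f i))⁻¹) (fun i _ => (inv_pos.2 (hf i)).le)
      (Finset.mem_univ i)).trans (Nat.le_ceil _)
  have h2 : A i (f i) * (⌈∑ i, (A i (f i))⁻¹⌉₊ : ℝ) ≤
      dot (A i) (toReal fun _ => ⌈∑ i, (A i (f i))⁻¹⌉₊) :=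
    Finset.single_le_sum (f := fun j => A i j * (⌈∑ i, (A i (f i))⁻¹⌉₊ : ℝ))
      (fun j _ => mul_nonneg (hA0 i j) (Nat.cast_nonneg _)) (Finset.mem_univ (f i))
  refine le_trans ?_ h2
  rw [← mul_inv_cancel₀ (hf i).ne']
  exact mul_le_mul_of_nonneg_left h1 (hf i).le

theorem lpOpt_le (hc : ∀ j, 0 < c j) {x : Fin m → ℝ} (hx : ∀ j, 0 ≤ x j)
    (h : ∀ i, 1 ≤ dot (A i) x) : lpOpt A c ≤ dot c x := by
  refine csInf_le ⟨0, ?_⟩ ⟨x, hx, h, rfl⟩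
  rintro v ⟨x, hx, -, rfl⟩
  exact dot_nonneg (fun j => (hc j).le) hx

/-- Compactness: solutions no dearer than a known feasible one lie in a box, because all costs are
positive. -/
theorem exists_lpOpt_eq (hc : ∀ j, 0 < c j) (hA0 : ∀ i j, 0 ≤ A i j) (hA : ∀ i, ∃ j, 0 < A i j) :
    ∃ x : Fin m → ℝ, (∀ j, 0 ≤ x j) ∧ (∀ i, 1 ≤ dot (A i) x) ∧ lpOpt A c = dot c x := by
  obtain ⟨z, hz⟩ := exists_integer_feasible hA0 hA
  have hcont : ∀ a : Fin m → ℝ, Continuous fun x => dot a x := fun a => by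
    unfold dot
    fun_prop
  let K : Set (Fin m → ℝ) :=
    {x | (∀ j, 0 ≤ x j) ∧ (∀ i, 1 ≤ dot (A i) x) ∧ dot c x ≤ dot c (toReal z)}
  have hK : IsCompact K := by
    refine (isCompact_Icc (a := (0 : Fin m → ℝ)) (b := fun j => dot c (toReal z) / c j)).of_isClosed_subset
      ?_ ?_
    · simp only [K, Set.ofPred_and, Set.ofPred_forall]
      refine (isClosed_iInter fun j => isClosed_le continuous_const (continuous_apply j)).inter
        ((isClosed_iInter fun i => isClosed_le continuous_const (hcont _)).inter
          (isClosed_le (hcont _) continuous_const))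
    · rintro x ⟨h1, -, h3⟩
      refine ⟨h1, fun j => ?_⟩
      rw [le_div_iff₀ (hc j), mul_comm]
      exact (Finset.single_le_sum (f := fun j => c j * x j)
        (fun j _ => mul_nonneg (hc j).le (h1 j)) (Finset.mem_univ j)).trans h3
  obtain ⟨x, ⟨h1, h2, h3⟩, hmin⟩ :=
    hK.exists_isMinOn ⟨toReal z, fun j => Nat.cast_nonneg _, hz, le_rfl⟩ (hcont c).continuousOn
  refine ⟨x, h1, h2, le_antisymm (lpOpt_le hc h1 h2) (le_csInf ⟨_, x, h1, h2, rfl⟩ ?_)⟩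
  rintro v ⟨y, hy1, hy2, rfl⟩
  rcases le_total (dot c y) (dot c (toReal z)) with h | h
  · exact hmin ⟨hy1, hy2, h⟩
  · exact h3.trans h

/-- An optimal `u` has no mass on columns dearer than `β`. If `S > 0` is that mass, then it covers
at most `S` of any row, as entries are at most `1`, but costs more than `βS`. Dropping it and
scaling the rest by `1/(1-S)` is feasible and strictly cheaper. -/
theorem exists_lp_solution (hc : ∀ j, 0 < c j) (hA : ∀ i, IsRow (A i)) {β : ℝ}
    (hβ : lpOpt A c ≤ β) : ∃ u : Fin m → ℝ, (∀ j, 0 ≤ u j) ∧ (∀ i, 1 ≤ dot (A i) u) ∧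
      dot c u ≤ β ∧ ∀ j, 0 < u j → c j ≤ β := by
  classical
  obtain ⟨u, hu, hAu, hopt⟩ := exists_lpOpt_eq hc (fun i j => ((hA i).1 j).1) fun i => (hA i).2
  refine ⟨u, hu, hAu, hopt ▸ hβ, fun j hj => ?_⟩
  by_contra hcj
  push Not at hcj
  let v : Fin m → ℝ := fun j => if β < c j then u j else 0
  let w : Fin m → ℝ := fun j => if β < c j then 0 else u j
  have hv : ∀ j, 0 ≤ v j := fun j => by
    simp only [v]
    split_ifs
    exacts [hu j, le_rfl]
  have hw : ∀ j, 0 ≤ w j := fun j => by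
    simp only [w]
    split_ifs
    exacts [le_rfl, hu j]
  have hsplit : ∀ a : Fin m → ℝ, dot a u = dot a v + dot a w := by
    intro a
    rw [← dot_add]
    congr 1
    ext j
    simp only [v, w]
    split_ifs <;> simp
  have hlt : β * ∑ j, v j < dot c v := by
    rw [dot, Finset.mul_sum]
    refine Finset.sum_lt_sum (fun i _ => ?_) ⟨j, Finset.mem_univ j, ?_⟩
    · simp only [v]
      split_ifs with h
      · exact mul_le_mul_of_nonneg_right h.le (hu i)
      · simp
    · simp only [v, if_pos hcj]
      exact mul_lt_mul_of_pos_right hcj hj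
  have hcw : 0 ≤ dot c w := dot_nonneg (fun j => (hc j).le) hw
  have hcu := hsplit c
  set S := ∑ j, v j with hS
  have hS0 : 0 ≤ S := Finset.sum_nonneg fun j _ => hv j
  have hβ0 : 0 ≤ β := (dot_nonneg (fun j => (hc j).le) hu).trans (hopt ▸ hβ)
  have hS1 : S < 1 := by
    by_contra h
    nlinarith
  have hfeas : ∀ i, 1 ≤ dot (A i) fun j => (1 - S)⁻¹ * w j := by
    intro i
    have h1 : dot (A i) v ≤ S :=
      Finset.sum_le_sum fun j _ => mul_le_of_le_one_left (hv j) ((hA i).1 j).2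
    have h2 := hAu i
    rw [hsplit] at h2
    rw [dot_mul_left, inv_mul_eq_div, le_div_iff₀ (sub_pos.2 hS1)]
    linarith
  have h3 := lpOpt_le hc (fun j => mul_nonneg (inv_pos.2 (sub_pos.2 hS1)).le (hw j)) hfeas
  rw [dot_mul_left, inv_mul_eq_div, le_div_iff₀ (sub_pos.2 hS1)] at h3
  nlinarith

theorem lpOpt_le_ipOpt (hc : ∀ j, 0 < c j) (hA0 : ∀ i j, 0 ≤ A i j)
    (hA : ∀ i, ∃ j, 0 < A i j) : lpOpt A c ≤ ipOpt A c := by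
  obtain ⟨z, hz⟩ := exists_integer_feasible hA0 hA
  refine le_csInf ⟨_, z, hz, rfl⟩ ?_
  rintro v ⟨z, hz, rfl⟩
  exact lpOpt_le hc (fun j => Nat.cast_nonneg _) hz

end opt

theorem expectedCost_mul {m n : ℕ} (k : ℕ) (A : Fin n → Fin m → ℝ) (c : Fin m → ℝ)
    (law : (Fin n → Fin m → ℝ) → PMF (Fin (n + 1) → Fin m → ℕ)) :
    expectedCost k A c law = k * expectedCost 1 A c law := by
  simp only [expectedCost, expect, dot_toReal_mul, one_mul]
  rw [← ENNReal.tsum_mul_left]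
  refine tsum_congr fun z => ?_
  rw [ENNReal.ofReal_mul (Nat.cast_nonneg _), ENNReal.ofReal_natCast]
  ring

/-! ## The expected cost of LearnOrCoverCIP -/

/-- The cost `β` is spread evenly over the `m'` affordable columns, so the cross entropy is `-⟨c, u⟩
log m'`, and `m' ≤ m`. -/
theorem locInit_good {m : ℕ} {β : ℝ} {c u a : Fin m → ℝ} (hc : ∀ j, 0 < c j)
    (hu : ∀ j, 0 ≤ u j) (hau : 1 ≤ dot a u) (hsupp : ∀ j, 0 < u j → c j ≤ β) :
    (locInit β c).Good β c u ∧ (dot c u ≤ β →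
      -(β * Real.log m) ≤ crossEntropy c u β (locInit β c).x) := by
  obtain ⟨j₀, hj₀⟩ : ∃ j, 0 < u j := by
    by_contra! h
    have h0 : ∀ j, u j = 0 := fun j => le_antisymm (h j) (hu j)
    simp [dot, h0] at hau
    linarith
  have hβ : 0 < β := (hc j₀).trans_le (hsupp j₀ hj₀)
  set M := (Finset.univ.filter fun k => c k ≤ β).card with hM
  have hM0 : 0 < M := Finset.card_pos.2 ⟨j₀, by simpa using hsupp j₀ hj₀⟩
  have hM0' : (0 : ℝ) < M := Nat.cast_pos.2 hM0
  have hpos : ∀ j, c j ≤ β → 0 < (locInit β c).x j ∧ c j * (locInit β c).x j = β / M := by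
    intro j hj
    have := hc j
    simp only [locInit, if_pos hj, ← hM]
    refine ⟨by positivity, ?_⟩
    field_simp
  have hzero : ∀ j, ¬c j ≤ β → (locInit β c).x j = 0 := fun j hj => by simp [locInit, hj]
  refine ⟨⟨fun j => ?_, ?_, fun j hj => (hpos j (hsupp j hj)).1⟩, fun hcu => ?_⟩
  · by_cases hj : c j ≤ β
    · exact (hpos j hj).1.le
    · exact (hzero j hj).ge
  · have : ∀ j, c j * (locInit β c).x j = if c j ≤ β then β / M else 0 := by
      intro j
      split_ifs with hj
      · exact (hpos j hj).2
      · rw [hzero j hj, mul_zero]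
    rw [dot, Finset.sum_congr rfl fun j _ => this j, ← Finset.sum_filter, Finset.sum_const, ← hM,
      nsmul_eq_mul, mul_div_cancel₀ _ hM0'.ne']
  · have hMm : M ≤ m := by simpa using Finset.card_le_univ (Finset.univ.filter fun k => c k ≤ β)
    have hlog : Real.log M ≤ Real.log m := Real.log_le_log hM0' (Nat.cast_le.2 hMm)
    have h0 : 0 ≤ Real.log M := Real.log_nonneg (Nat.one_le_cast.2 hM0)
    have h1 : crossEntropy c u β (locInit β c).x = -(dot c u * Real.log M) := by
      rw [crossEntropy, dot, Finset.sum_mul, ← Finset.sum_neg_distrib]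
      refine Finset.sum_congr rfl fun j _ => ?_
      rcases (hu j).eq_or_lt with h | h
      · simp [← h]
      · rw [(hpos j (hsupp j h)).2, div_div_cancel_left' hβ.ne', Real.log_inv]
        ring
    rw [h1]
    have : dot c u * Real.log M ≤ β * Real.log m := mul_le_mul hcu hlog h0 hβ.le
    linarith

theorem expectedCost_learnOrCover_le {m n : ℕ} {A : Fin n → Fin m → ℝ} {c : Fin m → ℝ} {β : ℝ}
    (hc : ∀ j, 0 < c j) (hA : ∀ i, IsRow (A i)) (hβ : lpOpt A c ≤ β) (hmn : 2 ≤ m * n) :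
    expectedCost 1 A c (learnOrCover β c) ≤ ENNReal.ofReal (136 * β * Real.log (m * n)) := by
  obtain ⟨u, hu, hAu, hcu, hsupp⟩ := exists_lp_solution hc hA hβ
  have hn : 0 < n := Nat.pos_of_ne_zero fun h0 => by simp [h0] at hmn
  have hr := minRatio_pos hc (hA ⟨0, hn⟩).2
  have hrβ := (minRatio_le_dot hc (fun j => ((hA ⟨0, hn⟩).1 j).1) (hA ⟨0, hn⟩).2 hu
    (hAu ⟨0, hn⟩)).trans hcu
  have hβ0 : 0 < β := hr.trans_le hrβ
  have hn' : (0 : ℝ) < n := Nat.cast_pos.2 hn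
  have hs : 0 < β / n := by positivity
  obtain ⟨hgood, hent⟩ := locInit_good hc hu (hAu ⟨0, hn⟩) hsupp
  have hcost := mean_randomOrder_le (locRound β c)
    (fun k A s => ((∀ i, IsRow (A i)) ∧ ∀ i, 1 ≤ dot (A i) u) ∧ s.Good β c u)
    (fun k A s => ENNReal.ofReal (locPotential (β / n) β c u k A s))
    (fun s => ENNReal.ofReal (dot c (toReal s.z)))
    (fun A s h => ENNReal.ofReal_le_ofReal (locPotential_nonneg hs hβ0 hc hu h.1.1 h.2))
    (fun k A s h i s' hs' => ⟨⟨fun l => h.1.1 _, fun l => h.1.2 _⟩,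
      locRound_good hβ0 hc (h.1.1 i) h.2 hs'⟩)
    (fun k A s h => sum_locRound_le hs hβ0 hc hu hcu h.1.1 h.1.2 h.2)
    n A (locInit β c) ⟨⟨hA, hAu⟩, hgood⟩ (fun h t => (h t).z)
    (fun z => ENNReal.ofReal (dot c (toReal fun j => 1 * z (Fin.last n) j)))
    (fun h => by simp)
  refine hcost.trans (ENNReal.ofReal_le_ofReal ?_)
  have h1 := logPotential_uncovered_le hβ0 hc hA hn le_rfl (locInit β c).z
  have h2 := hent hcu
  obtain ⟨h3, h4, h5, h6, h7, h8⟩ := log_mul_lower hmn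
  have h9 : dot c (toReal (locInit β c).z) = 0 := by simp [dot, toReal, locInit]
  have h10 : 8 * (β / n) * n = 8 * β := by field_simp
  -- The initial potential is at most `24β(2 + 2 log n) + 4β log m + 8β`. With `L = log(mn)`, the
  -- constant `56β` is at most `84βL`, and `84 + 48 + 4 = 136`.
  rw [locPotential, h9, h10]
  have h11 := mul_le_mul_of_nonneg_left h1 (by linarith : 0 ≤ 24 * β)
  have h12 := mul_le_mul_of_nonneg_left h3 hβ0.le
  have h13 := mul_le_mul_of_nonneg_left h4 hβ0.le
  have h14 := mul_le_mul_of_nonneg_left h7 hβ0.le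
  nlinarith

/-! ## An algorithm that guesses the optimal value -/

/-- The state of LearnOrCoverCIP together with the current guess `β` and with the certificate `G`: if
`G` exceeds `m`, then the optimal value exceeds `β`. -/
structure AdaptState (m : ℕ) where
  x : Fin m → ℝ
  z : Fin m → ℕ
  β : ℝ
  G : ℝ

/-- Start again with the guess `β`, but keep the integer solution. -/
noncomputable def AdaptState.restart {m : ℕ} (c : Fin m → ℝ) (β : ℝ) (s : AdaptState m) :
    AdaptState m where
  x := fun j => β / (c j * m)
  z := s.z
  β := β
  G := 1

open Classical in
/-- The multiplicative update and the update of the certificate. -/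
noncomputable def AdaptState.learn {m : ℕ} (c a : Fin m → ℝ) (s : AdaptState m) : AdaptState m :=
  if dot a s.x < deficit a s.z then
    { s with
      x := CoveringIP.learn s.β c a (deficit a s.z * minRatio c a) s.x
      G := s.G * (Real.exp (deficit a s.z * minRatio c a / s.β) /
        learnNorm s.β c a (deficit a s.z * minRatio c a) s.x) }
  else s

open Classical in
/-- A round of LearnOrCoverCIP, preceded and followed by modifications of the state. -/
noncomputable def modifiedRound {m : ℕ} (pre : (Fin m → ℝ) → AdaptState m → AdaptState m)
    (post : AdaptState m → AdaptState m) (c a : Fin m → ℝ) (s : AdaptState m) :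
    PMF (AdaptState m) :=
  if threshold < deficit a (pre a s).z then
    (coins fun j => Int.fract
        (deficit a (pre a s).z * minRatio c a * (pre a s).x j / (pre a s).β)).map fun b =>
      { post ((pre a s).learn c a) with
        z := buy c a (deficit a (pre a s).z)
          (fun j => deficit a (pre a s).z * minRatio c a * (pre a s).x j / (pre a s).β)
          (pre a s).z b }
  else PMF.pure (pre a s)

/-- The part of the state that LearnOrCoverCIP uses. -/
def AdaptState.toLoc {m : ℕ} (s : AdaptState m) : LocState m := ⟨s.x, s.z⟩

/-- The certificate never influences `x` or `z`, so a round without restarts is a round of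
LearnOrCoverCIP. Both programs can therefore share one round. -/
theorem modifiedRound_id {m : ℕ} {β : ℝ} (c a : Fin m → ℝ) {s : AdaptState m} (hs : s.β = β) :
    (modifiedRound (fun _ s => s) id c a s).map AdaptState.toLoc = locRound β c a s.toLoc ∧
      ∀ s' ∈ (modifiedRound (fun _ s => s) id c a s).support, s'.β = β := by
  subst hs
  have hβ : (s.learn c a).β = s.β := by
    unfold AdaptState.learn
    split_ifs <;> rfl
  by_cases h : threshold < deficit a s.z
  · have h' : threshold < deficit a s.toLoc.z := h
    constructor
    · rw [locRound_of_lt h', modifiedRound, if_pos h, PMF.map_comp]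
      congr 1
      ext b : 1
      by_cases hd : dot a s.x < deficit a s.z <;>
        simp [AdaptState.toLoc, AdaptState.learn, hd]
    · intro s' hs'
      rw [modifiedRound, if_pos h, PMF.mem_support_map_iff] at hs'
      obtain ⟨b, -, rfl⟩ := hs'
      exact hβ
  · have h' : ¬threshold < deficit a s.toLoc.z := h
    rw [locRound_of_not_lt h', modifiedRound, if_neg h, PMF.pure_map]
    refine ⟨rfl, fun s' hs' => ?_⟩
    rw [PMF.mem_support_pure_iff] at hs'
    rw [hs']

open Classical in
/-- A guess below the cost of a full greedy cover of the arriving row is too small. -/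
noncomputable def AdaptState.raise {m : ℕ} (c a : Fin m → ℝ) (s : AdaptState m) : AdaptState m :=
  if s.β < minRatio c a then s.restart c (2 * minRatio c a) else s

open Classical in
/-- A guess that is refuted by the certificate is too small. -/
noncomputable def AdaptState.refute {m : ℕ} (c : Fin m → ℝ) (s : AdaptState m) : AdaptState m :=
  if (m : ℝ) < s.G then s.restart c (2 * s.β) else s

/-- One round of the algorithm that guesses the optimal value. -/
noncomputable def adaptRound {m : ℕ} (c : Fin m → ℝ) :
    (Fin m → ℝ) → AdaptState m → PMF (AdaptState m) :=
  modifiedRound (AdaptState.raise c) (AdaptState.refute c) c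

/-! ### Invariants of the phases -/

section states
variable {m : ℕ} {c u a : Fin m → ℝ}

/-- The invariant of a phase, except for the bound on the certificate. -/
def AdaptState.Sound (c u : Fin m → ℝ) (s : AdaptState m) : Prop :=
  0 < s.β ∧ s.β ≤ 2 * dot c u ∧ (∀ j, 0 < s.x j) ∧ dot c s.x = s.β ∧ 0 < s.G ∧
    (dot c u ≤ s.β → s.β * Real.log s.G ≤ crossEntropy c u s.β s.x + s.β * Real.log m)

/-- The invariant of a phase. -/
def AdaptState.Good (c u : Fin m → ℝ) (s : AdaptState m) : Prop := s.Sound c u ∧ s.G ≤ m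

theorem AdaptState.z_raise (s : AdaptState m) : (s.raise c a).z = s.z := by
  unfold AdaptState.raise
  split_ifs <;> rfl

theorem AdaptState.refute_setZ (s : AdaptState m) (z : Fin m → ℕ) :
    { s.refute c with z := z } = ({ s with z := z } : AdaptState m).refute c := by
  unfold AdaptState.refute
  dsimp only
  split_ifs <;> rfl

theorem adaptRound_support (ha : IsRow a) {s s' : AdaptState m}
    (h : s' ∈ (adaptRound c a s).support) :
    (∀ j, s.z j ≤ s'.z j) ∧ 1 ≤ 3 * dot a (toReal s'.z) := by
  rw [adaptRound, modifiedRound] at h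
  split_ifs at h with hact
  · rw [PMF.mem_support_map_iff] at h
    obtain ⟨b, -, rfl⟩ := h
    rw [s.z_raise]
    refine ⟨le_buy _ _ _ b, ?_⟩
    have := one_le_dot_buy (c := c) ha
      (fun j => deficit a s.z * minRatio c a * (s.raise c a).x j / (s.raise c a).β) s.z b
    dsimp only
    linarith
  · rw [PMF.mem_support_pure_iff] at h
    subst h
    rw [s.z_raise] at hact ⊢
    exact ⟨fun j => le_rfl, third_le_dot hact⟩

/-- The cost is spread over all `m` columns, affordable or not. So `x` is positive everywhere and no
condition on the support of `u` is needed; the cross entropy is `-⟨c, u⟩ log m`, matching `G = 1`.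
-/
theorem AdaptState.restart_good (hc : ∀ j, 0 < c j) (hm : 0 < m) {β : ℝ}
    (hβ : 0 < β) (hβu : β ≤ 2 * dot c u) (s : AdaptState m) : (s.restart c β).Good c u := by
  have hm' : (0 : ℝ) < m := Nat.cast_pos.2 hm
  have h1 : ∀ j, c j * (β / (c j * m)) = β / m := fun j => by
    have := (hc j).ne'
    field_simp
  refine ⟨⟨hβ, hβu, fun j => div_pos hβ (mul_pos (hc j) hm'), ?_, zero_lt_one, fun hcu => ?_⟩,
    Nat.one_le_cast.2 hm⟩
  · simp only [AdaptState.restart, dot, h1]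
    rw [Finset.sum_const, Finset.card_univ, Fintype.card_fin, nsmul_eq_mul,
      mul_div_cancel₀ _ hm'.ne']
  · have h2 : crossEntropy c u β (fun j => β / (c j * m)) = -(dot c u * Real.log m) := by
      rw [crossEntropy, dot, Finset.sum_mul, ← Finset.sum_neg_distrib]
      refine Finset.sum_congr rfl fun j _ => ?_
      rw [h1, div_div_cancel_left' hβ.ne', Real.log_inv]
      ring
    have h3 := mul_le_mul_of_nonneg_right (show dot c u ≤ β from hcu)
      (Real.log_nonneg (Nat.one_le_cast.2 hm : (1 : ℝ) ≤ m))
    simp only [AdaptState.restart, Real.log_one, mul_zero, h2]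
    linarith

theorem IsRow.dim_pos (ha : IsRow a) : 0 < m := by
  obtain ⟨j, -⟩ := ha.2
  exact j.pos

/-- The alternative `s.β = 0` is the initial state, in which any row raises the guess. The new guess
`2 minRatio c a` is at most `2⟨c, u⟩` because `u` covers the row. -/
theorem AdaptState.raise_good (hc : ∀ j, 0 < c j) (hu : ∀ j, 0 ≤ u j) (ha : IsRow a)
    (hau : 1 ≤ dot a u) {s : AdaptState m} (h : s.β = 0 ∨ s.Good c u) :
    (s.raise c a).Good c u ∧ minRatio c a ≤ (s.raise c a).β := by
  have hr := minRatio_pos hc ha.2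
  have hru := minRatio_le_dot hc (fun j => (ha.1 j).1) ha.2 hu hau
  unfold AdaptState.raise
  split_ifs with hlt
  · refine ⟨s.restart_good hc ha.dim_pos (by linarith) (by linarith), ?_⟩
    simp only [AdaptState.restart]
    linarith
  · rcases h with h | h
    · rw [h] at hlt
      exact absurd hr hlt
    · exact ⟨h, not_lt.1 hlt⟩

/-- Both `β log G` and the lower bound for the cross entropy move by `κ - β log Z`; the latter
requires `⟨c, u⟩ ≤ β`, the bound on the change of `log G` does not. One update can push `G` beyond
`m`, but as `κ ≤ β` only by a factor at most `e`; hence the slack `s.β`. -/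
theorem AdaptState.learn_sound (hc : ∀ j, 0 < c j) (hu : ∀ j, 0 ≤ u j) (ha : IsRow a)
    (hau : 1 ≤ dot a u) {s : AdaptState m} (h : s.Good c u) (hr : minRatio c a ≤ s.β)
    (hact : threshold < deficit a s.z) :
    (s.learn c a).Sound c u ∧ (s.learn c a).β = s.β ∧
      0 ≤ s.β * (Real.log m - Real.log (s.learn c a).G) + s.β ∧
      s.β * (Real.log m - Real.log (s.learn c a).G) ≤ s.β * (Real.log m - Real.log s.G) +
        learnGain a (deficit a s.z) (deficit a s.z * minRatio c a) s.x := by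
  obtain ⟨⟨hβ, hβu, hx, hcx, hG, hent⟩, hGm⟩ := h
  have ha0 : ∀ j, 0 ≤ a j := fun j => (ha.1 j).1
  have hx0 : ∀ j, 0 ≤ s.x j := fun j => (hx j).le
  obtain ⟨hκ, hκr, hκ'⟩ := greedy_rate_le hc ha s.z
  have hlog : 0 ≤ s.β * (Real.log m - Real.log s.G) :=
    mul_nonneg hβ.le (sub_nonneg.2 (Real.log_le_log hG hGm))
  have hchange := learn_change_le hβ hc ha0 hx0 hcx hκ hκ' hact
  unfold AdaptState.learn
  split_ifs at hchange ⊢ with hd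
  · have hZ := one_le_learnNorm hβ hc ha0 hx0 hcx hκ
    set κ := deficit a s.z * minRatio c a
    set Z := learnNorm s.β c a κ s.x with hZd
    have hZ0 : 0 < Z := by linarith
    have hlogG : Real.log (s.G * (Real.exp (κ / s.β) / Z)) =
        Real.log s.G + (κ / s.β - Real.log Z) := by
      rw [Real.log_mul hG.ne' (by positivity), Real.log_div (Real.exp_pos _).ne' hZ0.ne',
        Real.log_exp]
    have hmul : s.β * Real.log (s.G * (Real.exp (κ / s.β) / Z)) =
        s.β * Real.log s.G + κ - s.β * Real.log Z := by
      rw [hlogG]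
      field_simp
      ring
    have hZl : 0 ≤ s.β * Real.log Z := mul_nonneg hβ.le (Real.log_nonneg hZ)
    simp only [mul_sub] at hlog ⊢
    refine ⟨⟨hβ, hβu, fun j => ?_, dot_learn hβ hc ha0 hx0 hcx hκ, by positivity, fun hcu => ?_⟩,
      trivial, by linarith, by linarith⟩
    · dsimp only
      rw [learn_apply]
      have := hx j
      positivity
    · have h1 := crossEntropy_learn hβ hc ha0 hx0 hcx hu (fun j _ => hx j) hcu hau hκ
      have h2 := hent hcu
      dsimp only
      linarith
  · exact ⟨⟨hβ, hβu, hx, hcx, hG, hent⟩, rfl, by linarith, by linarith⟩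

/-- If `⟨c, u⟩ ≤ β`, then nonpositivity of the cross entropy forces `log G ≤ log m`. So `G > m`
proves `β < ⟨c, u⟩`, and the doubled guess is still at most `2⟨c, u⟩`. -/
theorem AdaptState.refute_good (hc : ∀ j, 0 < c j) (hu : ∀ j, 0 ≤ u j) (hm : 0 < m)
    {s : AdaptState m} (h : s.Sound c u) : (s.refute c).Good c u := by
  unfold AdaptState.refute
  split_ifs with hG
  · obtain ⟨hβ, hβu, hx, hcx, hG0, hent⟩ := h
    refine s.restart_good hc hm (by linarith) ?_
    by_contra hlt
    have h1 := hent (by linarith)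
    have h2 := crossEntropy_nonpos hβ hc hu (fun j => (hx j).le) hcx
    have h3 : s.β * Real.log s.G ≤ s.β * Real.log m := by linarith
    have h4 := Real.log_lt_log (Nat.cast_pos.2 hm) hG
    exact absurd (le_of_mul_le_mul_left h3 hβ) h4.not_ge
  · exact ⟨h, not_lt.1 hG⟩

theorem AdaptState.setZ_good {s : AdaptState m} (h : s.Good c u) (z : Fin m → ℕ) :
    ({ s with z := z } : AdaptState m).Good c u := h

theorem adaptRound_good (hc : ∀ j, 0 < c j) (hu : ∀ j, 0 ≤ u j) (ha : IsRow a)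
    (hau : 1 ≤ dot a u) {s s' : AdaptState m} (h : s.β = 0 ∨ s.Good c u)
    (hs' : s' ∈ (adaptRound c a s).support) : s'.Good c u := by
  obtain ⟨h1, h2⟩ := s.raise_good hc hu ha hau h
  rw [adaptRound, modifiedRound] at hs'
  split_ifs at hs' with hact
  · rw [PMF.mem_support_map_iff] at hs'
    obtain ⟨b, -, rfl⟩ := hs'
    exact AdaptState.setZ_good (AdaptState.refute_good hc hu ha.dim_pos
      (AdaptState.learn_sound hc hu ha hau h1 h2 hact).1) _
  · rw [PMF.mem_support_pure_iff] at hs'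
    rwa [hs']

end states

/-- The cost of a phase with the guess `β` is at most `β` times this number. -/
noncomputable def phaseRate (m n : ℕ) : ℝ := 64 + 48 * Real.log n + 4 * Real.log m

/-- The potential of the algorithm that guesses the optimal value. The last term pays for the phases to
come. -/
noncomputable def adaptPotential {m : ℕ} (n : ℕ) (V : ℝ) (c : Fin m → ℝ) (k : ℕ)
    (A : Fin k → Fin m → ℝ) (s : AdaptState m) : ℝ :=
  dot c (toReal s.z) + 24 * s.β * logPotential (s.β / n) (uncovered (s.β / n) s.β c A s.z) +
    4 * (s.β * (Real.log m - Real.log s.G)) + 4 * s.β + 8 * (s.β / n) * k +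
    phaseRate m n * (4 * V - 2 * s.β)

/-! ### The potential across phases -/

section potential
variable {m n k : ℕ} {c u a : Fin m → ℝ} {V : ℝ} {A : Fin k → Fin m → ℝ}

theorem phaseRate_nonneg (m n : ℕ) : 0 ≤ phaseRate m n := by
  have := Real.log_natCast_nonneg n
  have := Real.log_natCast_nonneg m
  unfold phaseRate
  positivity

/-- The term `4 s.β` of the potential is there for the moment between an update and the refutation,
when the certificate term can be as low as `-4 s.β`. -/
theorem le_adaptPotential (hn : 0 < n) (hc : ∀ j, 0 < c j) (hA : ∀ i, IsRow (A i))
    {s : AdaptState m} (hβ : 0 ≤ s.β)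
    (hG : 0 ≤ s.β * (Real.log m - Real.log s.G) + s.β) :
    dot c (toReal s.z) + phaseRate m n * (4 * V - 2 * s.β) ≤ adaptPotential n V c k A s := by
  have hn' : (0 : ℝ) < n := Nat.cast_pos.2 hn
  have h1 : 0 ≤ 24 * s.β * logPotential (s.β / n) (uncovered (s.β / n) s.β c A s.z) := by
    rcases hβ.eq_or_lt with h | h
    · simp [← h]
    · exact mul_nonneg (by linarith) (logPotential_nonneg (div_pos h hn')
        (uncovered_eq_zero_or_le hc hA s.z))
  have h2 : 0 ≤ 8 * (s.β / n) * k := by positivity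
  unfold adaptPotential
  linarith

theorem AdaptState.Good.cert_nonneg {s : AdaptState m} (h : s.Good c u) :
    0 ≤ s.β * (Real.log m - Real.log s.G) :=
  mul_nonneg h.1.1.le (sub_nonneg.2 (Real.log_le_log h.1.2.2.2.2.1 h.2))

theorem Good.le_adaptPotential (hn : 0 < n) (hc : ∀ j, 0 < c j) (hA : ∀ i, IsRow (A i))
    {s : AdaptState m} (h : s.β = 0 ∨ s.Good c u) :
    dot c (toReal s.z) + phaseRate m n * (4 * V - 2 * s.β) ≤ adaptPotential n V c k A s := by
  rcases h with h | h
  · exact CoveringIP.le_adaptPotential hn hc hA h.ge (by simp [h])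
  · exact CoveringIP.le_adaptPotential hn hc hA h.1.1.le (add_nonneg h.cert_nonneg h.1.1.le)

theorem adaptPotential_nonneg (hn : 0 < n) (hc : ∀ j, 0 < c j) (hu : ∀ j, 0 ≤ u j)
    (hA : ∀ i, IsRow (A i)) {s : AdaptState m} (h : s.β = 0 ∨ s.Good c u) :
    dot c (toReal s.z) ≤ adaptPotential n (dot c u) c k A s := by
  refine le_trans (le_add_of_nonneg_right (mul_nonneg (phaseRate_nonneg m n) ?_))
    (Good.le_adaptPotential hn hc hA h)
  rcases h with h | h
  · have := dot_nonneg (fun j => (hc j).le) hu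
    rw [h]
    linarith
  · linarith [h.1.2.1]

/-- A new phase needs at most `24β(2 + 2 log n) + 4β log m + 4β + 8β`, and `4β` more are set aside.
This is `β · phaseRate m n`, half of what the reserve gives up. -/
theorem adaptPotential_restart_le (hn : 0 < n) (hk : k ≤ n) (hc : ∀ j, 0 < c j)
    (hA : ∀ i, IsRow (A i)) {β : ℝ} (hβ : 0 < β) (s : AdaptState m) :
    adaptPotential n V c k A (s.restart c β) + 4 * β ≤
      dot c (toReal s.z) + phaseRate m n * (4 * V - β) := by
  have hn' : (0 : ℝ) < n := Nat.cast_pos.2 hn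
  have h1 := logPotential_uncovered_le hβ hc hA hn hk s.z
  have h2 := mul_le_mul_of_nonneg_left h1 (by linarith : 0 ≤ 24 * β)
  have h3 : 8 * (β / n) * k ≤ 8 * β := by
    have : β / n * k ≤ β := by
      rw [div_mul_eq_mul_div, div_le_iff₀ hn']
      exact mul_le_mul_of_nonneg_left (Nat.cast_le.2 hk) hβ.le
    linarith
  simp only [adaptPotential, AdaptState.restart, Real.log_one, sub_zero, phaseRate]
  linarith

/-- The guess doubles, so the reserve left after the new phase has been funded, `4V - β'` with `β' =
2β`, equals the old one, `4V - 2β`. -/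
theorem adaptPotential_refute_le (hn : 0 < n) (hk : k ≤ n) (hc : ∀ j, 0 < c j)
    (hA : ∀ i, IsRow (A i)) {s : AdaptState m} (h : 0 < s.β)
    (hG : 0 ≤ s.β * (Real.log m - Real.log s.G) + s.β) :
    adaptPotential n V c k A (s.refute c) ≤ adaptPotential n V c k A s := by
  unfold AdaptState.refute
  split_ifs
  · have h1 := adaptPotential_restart_le (V := V) hn hk hc hA (β := 2 * s.β) (by linarith) s
    have h2 := le_adaptPotential (V := V) hn hc hA h.le hG
    linarith
  · exact le_rfl

theorem adaptPotential_dropRow_le (hn : 0 < n) (hc : ∀ j, 0 < c j)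
    {A : Fin (k + 1) → Fin m → ℝ} (hA : ∀ i, IsRow (A i)) {s : AdaptState m} (hβ : 0 < s.β)
    (i : Fin (k + 1)) :
    adaptPotential n V c k (dropRow i A) s ≤ adaptPotential n V c (k + 1) A s := by
  have hs : 0 < s.β / n := div_pos hβ (Nat.cast_pos.2 hn)
  have hdrop : ∀ l, IsRow (dropRow i A l) := fun l => hA _
  have h1 := logPotential_mono hs
    (uncovered_nonneg (s := s.β / n) (β := s.β) hc hdrop s.z)
    (uncovered_dropRow_le hc hA i s.z) (uncovered_eq_zero_or_le hc hA s.z)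
  have h2 := mul_le_mul_of_nonneg_left h1 (by linarith : 0 ≤ 24 * s.β)
  simp only [adaptPotential]
  push_cast
  linarith

/-- The change of the potential in a round, after the guess has been raised. -/
theorem mean_modifiedRound_le {pre : (Fin m → ℝ) → AdaptState m → AdaptState m} (hn : 0 < n)
    (hk : k ≤ n) (hc : ∀ j, 0 < c j) (hu : ∀ j, 0 ≤ u j) {A : Fin (k + 1) → Fin m → ℝ}
    (hA : ∀ i, IsRow (A i)) (hAu : ∀ i, 1 ≤ dot (A i) u) {s : AdaptState m} (i : Fin (k + 1))
    (h : (pre (A i) s).Good c u) (hr : minRatio c (A i) ≤ (pre (A i) s).β) :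
    ∃ B : ℝ, 0 ≤ B ∧
      mean (modifiedRound pre (AdaptState.refute c) c (A i) s)
        (fun s' => ENNReal.ofReal (adaptPotential n (dot c u) c k (dropRow i A) s')) ≤
          ENNReal.ofReal B ∧
      B ≤ adaptPotential n (dot c u) c (k + 1) A (pre (A i) s) +
        (8 * (rowWeight ((pre (A i) s).β / n) (pre (A i) s).β c (A i) (pre (A i) s).z *
            min 1 (dot (A i) (pre (A i) s).x)) -
          8 * (rowWeight ((pre (A i) s).β / n) (pre (A i) s).β c (A i) (pre (A i) s).z /
              uncovered ((pre (A i) s).β / n) (pre (A i) s).β c A (pre (A i) s).z *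
            ∑ l, rowWeight ((pre (A i) s).β / n) (pre (A i) s).β c (A l) (pre (A i) s).z *
              min 1 (dot (A l) (pre (A i) s).x))) := by
  have hdrop : ∀ l, IsRow (dropRow i A l) := fun l => hA _
  unfold modifiedRound
  generalize pre (A i) s = s at h hr ⊢
  have hβ := h.1.1
  have hs : 0 < s.β / n := div_pos hβ (Nat.cast_pos.2 hn)
  have hcz : ∀ z : Fin m → ℕ, 0 ≤ dot c (toReal z) := fun z =>
    dot_nonneg (fun j => (hc j).le) fun _ => Nat.cast_nonneg _
  split_ifs with hact
  · obtain ⟨h1, h2, h3, h4⟩ := AdaptState.learn_sound hc hu (hA i) (hAu i) h hr hact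
    have h5 := coinMean_potential_le hs hβ hc hA (fun j => (h.1.2.2.1 j).le) h.1.2.2.2.1 s.z i
      hact hr
    set z' := fun b => buy c (A i) (deficit (A i) s.z)
      (fun j => deficit (A i) s.z * minRatio c (A i) * s.x j / s.β) s.z b with hz'
    have hpot : ∀ b, adaptPotential n (dot c u) c k (dropRow i A)
        ({ (s.learn c (A i)).refute c with z := z' b }) ≤
        adaptPotential n (dot c u) c k (dropRow i A) { s.learn c (A i) with z := z' b } := by
      intro b
      rw [AdaptState.refute_setZ]
      refine adaptPotential_refute_le hn hk hc hdrop ?_ ?_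
      · exact h1.1
      · dsimp only
        rw [h2]
        exact h3
    have hnn : ∀ b, 0 ≤ adaptPotential n (dot c u) c k (dropRow i A)
        { (s.learn c (A i)).refute c with z := z' b } := fun b =>
      (hcz _).trans (adaptPotential_nonneg hn hc hu hdrop
        (Or.inr (AdaptState.setZ_good (AdaptState.refute_good hc hu (hA i).dim_pos h1) _)))
    rw [mean_map, mean_coins (fract_mem _) hnn]
    refine ⟨_, coinMean_nonneg (fract_mem _) fun b => hnn _, le_rfl, ?_⟩
    refine (coinMean_mono (fract_mem _) hpot).trans ?_
    simp only [adaptPotential, h2]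
    simp only [sub_eq_add_neg, add_assoc, coinMean_add, coinMean_const] at h4 h5 ⊢
    push_cast
    linarith
  · have h0 : rowWeight (s.β / n) s.β c (A i) s.z = 0 := if_neg fun h => hact h.1
    rw [mean_pure, h0]
    refine ⟨_, (hcz _).trans (adaptPotential_nonneg hn hc hu hdrop (Or.inr h)), le_rfl, ?_⟩
    simpa using adaptPotential_dropRow_le hn hc hA hβ i

/-- Rows that raise the guess have weight zero under the old guess, so the cancellation of
`sum_weight_excess` can be used with the old guess throughout. The rows that raise it start from a
different `x` and `β` and are bounded individually. -/
theorem sum_adaptRound_le (hn : 0 < n) (hk : k + 1 ≤ n) (hc : ∀ j, 0 < c j)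
    (hu : ∀ j, 0 ≤ u j) {A : Fin (k + 1) → Fin m → ℝ} (hA : ∀ i, IsRow (A i))
    (hAu : ∀ i, 1 ≤ dot (A i) u) {s : AdaptState m} (h : s.β = 0 ∨ s.Good c u) :
    ∑ i, mean (adaptRound c (A i) s)
        (fun s' => ENNReal.ofReal (adaptPotential n (dot c u) c k (dropRow i A) s')) ≤
      (k + 1 : ℕ) * ENNReal.ofReal (adaptPotential n (dot c u) c (k + 1) A s) := by
  refine sum_mean_le _ _ (fun i => ?_)
    (sum_weight_excess (s := s.β / n) (β := s.β) (x := s.x) hc hA s.z)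
  obtain ⟨h1, h2⟩ := s.raise_good hc hu (hA i) (hAu i) h
  obtain ⟨B, hB0, hB1, hB2⟩ := mean_modifiedRound_le (pre := AdaptState.raise c) hn
    (Nat.le_of_succ_le hk) hc hu hA hAu i h1 h2
  refine ⟨B, hB0, hB1, hB2.trans ?_⟩
  by_cases hlt : s.β < minRatio c (A i)
  · have h3 : s.raise c (A i) = s.restart c (2 * minRatio c (A i)) := if_pos hlt
    have h4 : rowWeight (s.β / n) s.β c (A i) s.z = 0 := if_neg fun h => hlt.not_ge h.2.1
    rw [h3] at h1
    rw [h3, h4]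
    set s₁ := s.restart c (2 * minRatio c (A i)) with hs₁
    have hr := minRatio_pos hc (hA i).2
    -- The amount set aside, `4 · 2 minRatio = 8 minRatio`, pays for the excess `8 w_i q_i` of the
    -- raising row in the new phase, for which no averaging is available.
    have h5 := adaptPotential_restart_le (V := dot c u) hn hk hc hA
      (β := 2 * minRatio c (A i)) (by linarith) s
    have h6 := Good.le_adaptPotential (V := dot c u) hn hc hA h
    have hw : rowWeight (s₁.β / n) s₁.β c (A i) s₁.z ≤ minRatio c (A i) := by
      unfold rowWeight
      split_ifs
      · exact (greedy_rate_le hc (hA i) _).2.1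
      · exact hr.le
    have hw0 : ∀ l, 0 ≤ rowWeight (s₁.β / n) s₁.β c (A l) s₁.z := fun l =>
      rowWeight_nonneg hc (hA l) _
    have hd : ∀ l, 0 ≤ min 1 (dot (A l) s₁.x) := fun l =>
      le_min zero_le_one (dot_nonneg (fun j => ((hA l).1 j).1) fun j => (h1.1.2.2.1 j).le)
    have h7 : rowWeight (s₁.β / n) s₁.β c (A i) s₁.z * min 1 (dot (A i) s₁.x) ≤
        minRatio c (A i) :=
      (mul_le_of_le_one_right (hw0 i) (min_le_left _ _)).trans hw
    have h8 : 0 ≤ rowWeight (s₁.β / n) s₁.β c (A i) s₁.z / uncovered (s₁.β / n) s₁.β c A s₁.z *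
        ∑ l, rowWeight (s₁.β / n) s₁.β c (A l) s₁.z * min 1 (dot (A l) s₁.x) :=
      mul_nonneg (div_nonneg (hw0 i) (uncovered_nonneg hc hA _))
        (Finset.sum_nonneg fun l _ => mul_nonneg (hw0 l) (hd l))
    have h9 : phaseRate m n * (4 * dot c u - 2 * minRatio c (A i)) ≤
        phaseRate m n * (4 * dot c u - 2 * s.β) :=
      mul_le_mul_of_nonneg_left (by linarith) (phaseRate_nonneg m n)
    simp only [zero_mul, zero_div, mul_zero, sub_zero, add_zero]
    linarith
  · have h3 : s.raise c (A i) = s := if_neg hlt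
    rw [h3]

end potential

/-- The initial state of the algorithm that guesses the optimal value. -/
def adaptInit (m : ℕ) : AdaptState m := ⟨0, 0, 0, 0⟩

theorem mean_adaptRound_le {m n : ℕ} {A : Fin n → Fin m → ℝ} {c u : Fin m → ℝ}
    (hc : ∀ j, 0 < c j) (hu : ∀ j, 0 ≤ u j) (hA : ∀ i, IsRow (A i)) (hAu : ∀ i, 1 ≤ dot (A i) u)
    (hmn : 2 ≤ m * n) :
    expect (randomOrder n fun σ => (trajectory (adaptRound c) n (adaptInit m)
        fun t => A (σ t)).map fun h t j => 3 * (h t).z j)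
      (fun z => dot c (toReal (z (Fin.last n)))) ≤
    ENNReal.ofReal (1776 * Real.log (m * n) * dot c u) := by
  have hn : 0 < n := Nat.pos_of_ne_zero fun h0 => by simp [h0] at hmn
  have hcost := mean_randomOrder_le (adaptRound c)
    (fun k A s => k ≤ n ∧ ((∀ i, IsRow (A i)) ∧ ∀ i, 1 ≤ dot (A i) u) ∧ (s.β = 0 ∨ s.Good c u))
    (fun k A s => 3 * ENNReal.ofReal (adaptPotential n (dot c u) c k A s))
    (fun s => 3 * ENNReal.ofReal (dot c (toReal s.z)))
    (fun A s h => by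
      gcongr
      exact adaptPotential_nonneg hn hc hu h.2.1.1 h.2.2)
    (fun k A s h i s' hs' => ⟨Nat.le_of_succ_le h.1, ⟨fun l => h.2.1.1 _, fun l => h.2.1.2 _⟩,
      Or.inr (adaptRound_good hc hu (h.2.1.1 i) (h.2.1.2 i) h.2.2 hs')⟩)
    (fun k A s h => by
      have h1 := sum_adaptRound_le hn h.1 hc hu h.2.1.1 h.2.1.2 h.2.2
      simp only [mean, mul_left_comm _ (3 : ℝ≥0∞), ENNReal.tsum_mul_left] at h1 ⊢
      rw [← Finset.mul_sum]
      gcongr)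
    n A (adaptInit m) ⟨le_rfl, ⟨hA, hAu⟩, Or.inl rfl⟩ (fun h t j => 3 * (h t).z j)
    (fun z => ENNReal.ofReal (dot c (toReal (z (Fin.last n)))))
    (fun h => by
      rw [dot_toReal_mul, ENNReal.ofReal_mul (Nat.cast_nonneg _), ENNReal.ofReal_natCast]
      rfl)
  refine hcost.trans ?_
  rw [show (3 : ℝ≥0∞) = ENNReal.ofReal 3 by simp, ← ENNReal.ofReal_mul (by norm_num)]
  refine ENNReal.ofReal_le_ofReal ?_
  have h9 : dot c (toReal (adaptInit m).z) = 0 := by simp [dot, toReal, adaptInit]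
  obtain ⟨h3, h4, h5, h6, h7, h8⟩ := log_mul_lower hmn
  have hV : 0 ≤ dot c u := dot_nonneg (fun j => (hc j).le) hu
  rw [adaptPotential, h9]
  simp only [adaptInit, phaseRate, mul_zero, zero_mul, zero_div, add_zero, zero_add, sub_zero]
  -- `64 ≤ 96 log(mn)` and `96 + 48 + 4 = 148`. The reserve `4V` and the factor `3` of the solution
  -- give `1776 = 12 · 148`.
  have h10 : 64 + 48 * Real.log n + 4 * Real.log m ≤ 148 * Real.log (m * n) := by linarith
  have h11 := mul_le_mul_of_nonneg_right h10 hV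
  linarith

/-! ## Reasoning about programs -/

section machine

@[simp] theorem Config.tick_int (s : Config) (k : ℕ) : (s.tick k).int = s.int := rfl
@[simp] theorem Config.tick_real (s : Config) (k : ℕ) : (s.tick k).real = s.real := rfl
@[simp] theorem Config.tick_clock (s : Config) (k : ℕ) : (s.tick k).clock = s.clock + k := rfl
@[simp] theorem Config.putInt_real (s : Config) (a i v : ℕ) : (s.putInt a i v).real = s.real := rfl
@[simp] theorem Config.putInt_clock (s : Config) (a i v : ℕ) :
    (s.putInt a i v).clock = s.clock := rfl
@[simp] theorem Config.putReal_int (s : Config) (a i : ℕ) (v : ℝ) :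
    (s.putReal a i v).int = s.int := rfl
@[simp] theorem Config.putReal_clock (s : Config) (a i : ℕ) (v : ℝ) :
    (s.putReal a i v).clock = s.clock := rfl
theorem Config.putInt_int (s : Config) (a i v b k : ℕ) :
    (s.putInt a i v).int b k = if b = a ∧ k = i then v else s.int b k := by
  simp only [Config.putInt, Function.update_apply]
  by_cases h : b = a
  · subst h
    simp [Function.update_apply]
  · simp [h]
theorem Config.putReal_real (s : Config) (a i : ℕ) (v : ℝ) (b k : ℕ) :
    (s.putReal a i v).real b k = if b = a ∧ k = i then v else s.real b k := by
  simp only [Config.putReal, Function.update_apply]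
  by_cases h : b = a
  · subst h
    simp [Function.update_apply]
  · simp [h]
theorem Config.putInt_int_of_ne (s : Config) {a b : ℕ} (i v : ℕ) (h : b ≠ a) :
    (s.putInt a i v).int b = s.int b := by simp [Config.putInt, h]
theorem Config.putReal_real_of_ne (s : Config) {a b : ℕ} (i : ℕ) (v : ℝ) (h : b ≠ a) :
    (s.putReal a i v).real b = s.real b := by simp [Config.putReal, h]

/-! ### Write sets and running time of commands -/

/-- The integer arrays that a command may change. -/
def Cmd.intTargets : Cmd → List ℕ
  | .skip => []
  | .setInt a _ _ => [a]
  | .setReal _ _ _ => []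
  | .setFloor a _ _ => [a]
  | .toss a _ _ => [a]
  | .seq f g => f.intTargets ++ g.intTargets
  | .ifLt _ _ f g => f.intTargets ++ g.intTargets
  | .loop a _ f => a :: f.intTargets

/-- The real arrays that a command may change. -/
def Cmd.realTargets : Cmd → List ℕ
  | .skip => []
  | .setInt _ _ _ => []
  | .setReal a _ _ => [a]
  | .setFloor _ _ _ => []
  | .toss _ _ _ => []
  | .seq f g => f.realTargets ++ g.realTargets
  | .ifLt _ _ f g => f.realTargets ++ g.realTargets
  | .loop _ _ f => f.realTargets

/-- The number `m` of columns, as an expression. -/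
def dimExpr : IExpr := .get 0 (.lit 0)

/-- All loops run over the columns, and the number of columns is not changed. -/
def Cmd.Simple : Cmd → Prop
  | .skip => True
  | .setInt a _ _ => a ≠ 0
  | .setReal _ _ _ => True
  | .setFloor a _ _ => a ≠ 0
  | .toss a _ _ => a ≠ 0
  | .seq f g => f.Simple ∧ g.Simple
  | .ifLt _ _ f g => f.Simple ∧ g.Simple
  | .loop a e f => a ≠ 0 ∧ e = dimExpr ∧ f.Simple

open Polynomial in
/-- A bound for the running time of a command as a polynomial in the number of columns. -/
noncomputable def Cmd.cost : Cmd → Polynomial ℕ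
  | .skip => 1
  | .setInt _ i e => C (i.size + e.size + 1)
  | .setReal _ i e => C (i.size + e.size + 1)
  | .setFloor _ i e => C (i.size + e.size + 1)
  | .toss _ i p => C (i.size + p.size + 1)
  | .seq f g => f.cost + g.cost
  | .ifLt d e f g => C (d.size + e.size + 1) + (f.cost + g.cost)
  | .loop _ e f => C (e.size + 1) + X * (1 + f.cost)

theorem iterate_support (body : ℕ → Config → PMF Config) (I : ℕ → Config → Prop) :
    ∀ (k : ℕ) (s : Config), I 0 s →
      (∀ j < k, ∀ σ, I j σ → ∀ t ∈ (body j σ).support, I (j + 1) t) →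
      ∀ t ∈ (iterate body k s).support, I k t
  | 0, s, hs, _, t, ht => by
      rw [iterate, PMF.mem_support_pure_iff] at ht
      rwa [ht]
  | k + 1, s, hs, h, t, ht => by
      rw [iterate, PMF.mem_support_bind_iff] at ht
      obtain ⟨σ, hσ, ht⟩ := ht
      exact h k k.lt_succ_self σ
        (iterate_support body I k s hs (fun j hj => h j (Nat.lt_succ_of_lt hj)) σ hσ) t ht

/-- A command changes only its targets. -/
theorem Cmd.run_frame : ∀ (f : Cmd) (s t : Config), t ∈ (f.run s).support →
    (∀ a, a ∉ f.intTargets → t.int a = s.int a) ∧ ∀ a, a ∉ f.realTargets → t.real a = s.real a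
  | .skip, s, t, h => by
      rw [Cmd.run, PMF.mem_support_pure_iff] at h
      subst h
      exact ⟨fun _ _ => rfl, fun _ _ => rfl⟩
  | .setInt a i e, s, t, h => by
      rw [Cmd.run, PMF.mem_support_pure_iff] at h
      subst h
      refine ⟨fun b hb => ?_, fun _ _ => rfl⟩
      exact s.putInt_int_of_ne _ _ (by simpa [Cmd.intTargets] using hb)
  | .setReal a i e, s, t, h => by
      rw [Cmd.run, PMF.mem_support_pure_iff] at h
      subst h
      refine ⟨fun _ _ => rfl, fun b hb => ?_⟩
      exact s.putReal_real_of_ne _ _ (by simpa [Cmd.realTargets] using hb)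
  | .setFloor a i e, s, t, h => by
      rw [Cmd.run, PMF.mem_support_pure_iff] at h
      subst h
      refine ⟨fun b hb => ?_, fun _ _ => rfl⟩
      exact s.putInt_int_of_ne _ _ (by simpa [Cmd.intTargets] using hb)
  | .toss a i p, s, t, h => by
      rw [Cmd.run, PMF.mem_support_map_iff] at h
      obtain ⟨b, -, rfl⟩ := h
      refine ⟨fun b hb => ?_, fun _ _ => rfl⟩
      exact s.putInt_int_of_ne _ _ (by simpa [Cmd.intTargets] using hb)
  | .seq f g, s, t, h => by
      rw [Cmd.run, PMF.mem_support_bind_iff] at h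
      obtain ⟨σ, hσ, ht⟩ := h
      have h1 := f.run_frame s σ hσ
      have h2 := g.run_frame σ t ht
      simp only [Cmd.intTargets, Cmd.realTargets, List.mem_append, not_or]
      exact ⟨fun a ha => (h2.1 a ha.2).trans (h1.1 a ha.1),
        fun a ha => (h2.2 a ha.2).trans (h1.2 a ha.1)⟩
  | .ifLt d e f g, s, t, h => by
      rw [Cmd.run] at h
      simp only [Cmd.intTargets, Cmd.realTargets, List.mem_append, not_or]
      split_ifs at h
      · have h1 := f.run_frame _ t h
        exact ⟨fun a ha => h1.1 a ha.1, fun a ha => h1.2 a ha.1⟩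
      · have h1 := g.run_frame _ t h
        exact ⟨fun a ha => h1.1 a ha.2, fun a ha => h1.2 a ha.2⟩
  | .loop a e f, s, t, h => by
      rw [Cmd.run] at h
      simp only [Cmd.intTargets, Cmd.realTargets, List.mem_cons, not_or]
      refine iterate_support _ (fun _ t => (∀ b, b ≠ a ∧ b ∉ f.intTargets → t.int b = s.int b) ∧
        ∀ b, b ∉ f.realTargets → t.real b = s.real b) _ (s.tick (e.size + 1)) ⟨fun _ _ => rfl, fun _ _ => rfl⟩ ?_ t h
      intro j _ σ hσ τ hτ
      have h1 := f.run_frame _ τ hτ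
      refine ⟨fun b hb => ?_, fun b hb => (h1.2 b hb).trans (hσ.2 b hb)⟩
      rw [h1.1 b hb.2, Config.tick_int, Config.putInt_int_of_ne _ _ _ hb.1, hσ.1 b hb]

theorem Cmd.Simple.zero_notMem : ∀ {f : Cmd}, f.Simple → 0 ∉ f.intTargets
  | .skip, _ => by simp [Cmd.intTargets]
  | .setInt a _ _, h => by simpa [Cmd.intTargets] using Ne.symm h
  | .setReal _ _ _, _ => by simp [Cmd.intTargets]
  | .setFloor a _ _, h => by simpa [Cmd.intTargets] using Ne.symm h
  | .toss a _ _, h => by simpa [Cmd.intTargets] using Ne.symm h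
  | .seq f g, h => by
      simpa [Cmd.intTargets] using ⟨h.1.zero_notMem, h.2.zero_notMem⟩
  | .ifLt _ _ f g, h => by
      simpa [Cmd.intTargets] using ⟨h.1.zero_notMem, h.2.zero_notMem⟩
  | .loop a e f, h => by
      simpa [Cmd.intTargets] using ⟨Ne.symm h.1, h.2.2.zero_notMem⟩

theorem Cmd.Simple.int_zero {f : Cmd} (hf : f.Simple) {s t : Config}
    (h : t ∈ (f.run s).support) : t.int 0 = s.int 0 := (f.run_frame s t h).1 0 hf.zero_notMem

/-- The running time of a command. -/
theorem Cmd.Simple.clock_le : ∀ {f : Cmd}, f.Simple → ∀ {s t : Config}, t ∈ (f.run s).support →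
    t.clock ≤ s.clock + f.cost.eval (s.int 0 0)
  | .skip, _, s, t, h => by
      rw [Cmd.run, PMF.mem_support_pure_iff] at h
      subst h
      simp [Cmd.cost]
  | .setInt a i e, _, s, t, h => by
      rw [Cmd.run, PMF.mem_support_pure_iff] at h
      subst h
      simp [Cmd.cost]
  | .setReal a i e, _, s, t, h => by
      rw [Cmd.run, PMF.mem_support_pure_iff] at h
      subst h
      simp [Cmd.cost]
  | .setFloor a i e, _, s, t, h => by
      rw [Cmd.run, PMF.mem_support_pure_iff] at h
      subst h
      simp [Cmd.cost]
  | .toss a i p, _, s, t, h => by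
      rw [Cmd.run, PMF.mem_support_map_iff] at h
      obtain ⟨b, -, rfl⟩ := h
      simp [Cmd.cost]
  | .seq f g, hfg, s, t, h => by
      rw [Cmd.run, PMF.mem_support_bind_iff] at h
      obtain ⟨σ, hσ, ht⟩ := h
      have h1 := hfg.1.clock_le hσ
      have h2 := hfg.2.clock_le ht
      rw [hfg.1.int_zero hσ] at h2
      rw [Cmd.cost, Polynomial.eval_add]
      omega
  | .ifLt d e f g, hfg, s, t, h => by
      rw [Cmd.run] at h
      rw [Cmd.cost, Polynomial.eval_add, Polynomial.eval_add, Polynomial.eval_C]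
      split_ifs at h
      · have h1 := hfg.1.clock_le h
        simp only [Config.tick_clock, Config.tick_int] at h1
        omega
      · have h1 := hfg.2.clock_le h
        simp only [Config.tick_clock, Config.tick_int] at h1
        omega
  | .loop a e f, hf, s, t, h => by
      obtain ⟨ha, rfl, hf⟩ := hf
      rw [Cmd.run] at h
      have h1 := iterate_support _ (fun k t => t.int 0 = s.int 0 ∧
        t.clock ≤ s.clock + (dimExpr.size + 1) + k * (1 + f.cost.eval (s.int 0 0))) _
        (s.tick (dimExpr.size + 1)) ⟨rfl, by simp⟩ ?_ t h
      · have h2 : dimExpr.eval s = s.int 0 0 := rfl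
        rw [h2] at h1
        simp only [Cmd.cost, Polynomial.eval_add, Polynomial.eval_C, Polynomial.eval_mul,
          Polynomial.eval_X, Polynomial.eval_one]
        omega
      · rintro j _ σ ⟨hσ0, hσ⟩ τ hτ
        have h2 : ((σ.putInt a 0 j).tick 1).int 0 = s.int 0 := by
          rw [Config.tick_int, Config.putInt_int_of_ne _ _ _ (Ne.symm ha), hσ0]
        have h3 := hf.clock_le hτ
        rw [h2] at h3
        simp only [Config.tick_clock, Config.putInt_clock] at h3
        refine ⟨(hf.int_zero hτ).trans h2, ?_⟩
        rw [add_mul]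
        omega

theorem eval_mono (p : Polynomial ℕ) {a b : ℕ} (h : a ≤ b) : p.eval a ≤ p.eval b := by
  rw [Polynomial.eval_eq_sum, Polynomial.eval_eq_sum]
  exact Finset.sum_le_sum fun i _ => Nat.mul_le_mul_left _ (Nat.pow_le_pow_left h i)

/-- The cell holding `m` is never overwritten, so every call of `serve` is bounded by the same
polynomial in `m`, whatever the coins and the contents of the memory. -/
theorem runsWithin_cost {m n : ℕ} {P : OnlineProgram} (h1 : P.setup.Simple) (h2 : P.serve.Simple)
    (c : Fin m → ℝ) (β : ℝ) (r : Fin n → Fin m → ℝ) :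
    P.RunsWithin c β r ((P.setup.cost + Polynomial.X * P.serve.cost).eval (m + n)) := by
  intro h hh
  rw [OnlineProgram.run, PMF.mem_support_bind_iff] at hh
  obtain ⟨s, hs, hh⟩ := hh
  have hs0 : s.int 0 0 = m := by
    rw [h1.int_zero hs]
    rfl
  have hs1 : s.clock ≤ P.setup.cost.eval m := by
    have := h1.clock_le hs
    simpa [Config.start] using this
  obtain ⟨h3, h4⟩ := trajectory_support _ _ _ _ h hh
  have key : ∀ t : Fin (n + 1), (h t).int 0 0 = m ∧
      (h t).clock ≤ P.setup.cost.eval m + t * P.serve.cost.eval m := by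
    intro t
    induction t using Fin.induction with
    | zero =>
      rw [h3]
      exact ⟨hs0, by simpa using hs1⟩
    | succ t ih =>
      have h5 := h2.int_zero (h4 t)
      have h6 := h2.clock_le (h4 t)
      simp only [Config.load] at h5 h6
      rw [ih.1] at h6
      refine ⟨by rw [h5, ih.1], ?_⟩
      have := ih.2
      simp only [Fin.val_castSucc, Fin.val_succ] at this ⊢
      rw [add_mul]
      omega
  refine (key (Fin.last n)).2.trans ?_
  simp only [Polynomial.eval_add, Polynomial.eval_mul, Polynomial.eval_X, Fin.val_last]
  exact Nat.add_le_add (eval_mono _ (Nat.le_add_right _ _))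
    (Nat.mul_le_mul (Nat.le_add_left _ _) (eval_mono _ (Nat.le_add_right _ _)))

/-! ### Deterministic commands and loops over the columns -/

/-- The command is deterministic on `s`, and its result satisfies `Q`. -/
def Det (f : Cmd) (s : Config) (Q : Config → Prop) : Prop := ∃ t, f.run s = PMF.pure t ∧ Q t

/-- A consequence rule that also supplies the frame: specifications need to mention only what a
command computes, and everything outside its targets is known to be unchanged. -/
theorem Det.mono {f : Cmd} {s : Config} {Q Q' : Config → Prop} (h : Det f s Q)
    (hQ : ∀ t, (∀ a, a ∉ f.intTargets → t.int a = s.int a) →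
      (∀ a, a ∉ f.realTargets → t.real a = s.real a) → Q t → Q' t) : Det f s Q' := by
  obtain ⟨t, ht, h⟩ := h
  have h1 := f.run_frame s t (by rw [ht]; simp)
  exact ⟨t, ht, hQ t h1.1 h1.2 h⟩

theorem det_skip {s : Config} {Q : Config → Prop} (h : Q (s.tick 1)) : Det .skip s Q := ⟨_, rfl, h⟩

theorem det_setInt {a : ℕ} {i e : IExpr} {s : Config} {Q : Config → Prop}
    (h : Q ((s.putInt a (i.eval s) (e.eval s)).tick (i.size + e.size + 1))) :
    Det (.setInt a i e) s Q := ⟨_, rfl, h⟩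

theorem det_setReal {a : ℕ} {i : IExpr} {e : RExpr} {s : Config} {Q : Config → Prop}
    (h : Q ((s.putReal a (i.eval s) (e.eval s)).tick (i.size + e.size + 1))) :
    Det (.setReal a i e) s Q := ⟨_, rfl, h⟩

theorem det_setFloor {a : ℕ} {i : IExpr} {e : RExpr} {s : Config} {Q : Config → Prop}
    (h : Q ((s.putInt a (i.eval s) ⌊e.eval s⌋₊).tick (i.size + e.size + 1))) :
    Det (.setFloor a i e) s Q := ⟨_, rfl, h⟩

theorem det_seq {f g : Cmd} {s : Config} {Q : Config → Prop}
    (h : Det f s fun t => Det g t Q) : Det (.seq f g) s Q := by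
  obtain ⟨t, ht, u, hu, hQ⟩ := h
  exact ⟨u, by rw [Cmd.run, ht, PMF.pure_bind, hu], hQ⟩

theorem det_ifLt {d e : RExpr} {f g : Cmd} {s : Config} {Q : Config → Prop}
    (h1 : d.eval s < e.eval s → Det f (s.tick (d.size + e.size + 1)) Q)
    (h2 : ¬d.eval s < e.eval s → Det g (s.tick (d.size + e.size + 1)) Q) :
    Det (.ifLt d e f g) s Q := by
  unfold Det
  rw [Cmd.run]
  split_ifs with h
  · exact h1 h
  · exact h2 h

/-- For every column `j`, store `j` in the integer array `2` and do `f`. -/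
def forColumns (f : Cmd) : Cmd := .loop 2 dimExpr f

theorem det_forColumns {f : Cmd} {s : Config} {m : ℕ} (hm : s.int 0 0 = m)
    (I : ℕ → Config → Prop) (h0 : ∀ k, I 0 (s.tick k))
    (h : ∀ (j : Fin m) σ, I j σ → Det f ((σ.putInt 2 0 j).tick 1) (I (j + 1))) :
    Det (forColumns f) s (I m) := by
  have key : ∀ k ≤ m, ∃ t, iterate (fun k s => f.run ((s.putInt 2 0 k).tick 1)) k
      (s.tick (dimExpr.size + 1)) = PMF.pure t ∧ I k t := by
    intro k
    induction k with
    | zero => exact fun _ => ⟨_, rfl, h0 _⟩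
    | succ k ih =>
      intro hk
      obtain ⟨t, ht, hI⟩ := ih (Nat.le_of_succ_le hk)
      obtain ⟨u, hu, hI'⟩ := h ⟨k, hk⟩ t hI
      exact ⟨u, by rw [iterate, ht, PMF.pure_bind]; exact hu, hI'⟩
  obtain ⟨t, ht, hI⟩ := key m le_rfl
  refine ⟨t, ?_, hI⟩
  rw [forColumns, Cmd.run, show dimExpr.eval s = m from hm]
  exact ht

/-- A loop that computes the entries of a real array. -/
theorem det_forColumns_map {f : Cmd} {s : Config} {m A : ℕ} (v : Fin m → ℝ)
    (hm : s.int 0 0 = m) (hint : f.intTargets = []) (hreal : ∀ a, a ≠ A → a ∉ f.realTargets)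
    (h : ∀ (j : Fin m) σ, σ.int 2 0 = (j : ℕ) → (∀ a, a ≠ 2 → σ.int a = s.int a) →
      (∀ a, a ≠ A → σ.real a = s.real a) → σ.real A j = s.real A j →
      Det f σ fun t => t.real A j = v j ∧ ∀ i : ℕ, i ≠ j → t.real A i = σ.real A i) :
    Det (forColumns f) s fun t => ∀ j : Fin m, t.real A j = v j := by
  refine (det_forColumns hm (fun k σ => (∀ a, a ≠ 2 → σ.int a = s.int a) ∧
    (∀ a, a ≠ A → σ.real a = s.real a) ∧ (∀ j : Fin m, (j : ℕ) < k → σ.real A j = v j) ∧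
    ∀ j : Fin m, k ≤ j → σ.real A j = s.real A j)
    (fun k => ⟨fun _ _ => rfl, fun _ _ => rfl, fun _ h => absurd h (Nat.not_lt_zero _),
      fun _ _ => rfl⟩) ?_).mono fun t _ _ ht j => ht.2.2.1 j j.2
  rintro j σ ⟨h1, h2, h3, h4⟩
  have h5 : ∀ a, a ≠ 2 → ((σ.putInt 2 0 j).tick 1).int a = s.int a := fun a ha => by
    rw [Config.tick_int, Config.putInt_int_of_ne _ _ _ ha, h1 a ha]
  refine (h j ((σ.putInt 2 0 j).tick 1) (by simp [Config.putInt_int]) h5 h2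
    (h4 j le_rfl)).mono fun t ht1 ht2 ht => ⟨fun a ha => ?_, fun a ha => ?_, fun i hi => ?_,
      fun i hi => ?_⟩
  · rw [ht1 a (by simp [hint]), h5 a ha]
  · rw [ht2 a (hreal a ha)]
    exact h2 a ha
  · rcases Nat.lt_succ_iff_lt_or_eq.1 hi with hlt | heq
    · rw [ht.2 i hlt.ne]
      exact h3 i hlt
    · rw [Fin.ext heq]
      exact ht.1
  · rw [ht.2 i (by omega)]
    exact h4 i (by omega)

/-- A loop that computes a sum. -/
theorem det_forColumns_sum {f : Cmd} {s : Config} {m A : ℕ} (v : Fin m → ℝ)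
    (hm : s.int 0 0 = m) (hint : f.intTargets = []) (hreal : ∀ a, a ≠ A → a ∉ f.realTargets)
    (h : ∀ (j : Fin m) σ, σ.int 2 0 = (j : ℕ) → (∀ a, a ≠ 2 → σ.int a = s.int a) →
      (∀ a, a ≠ A → σ.real a = s.real a) → Det f σ fun t => t.real A 0 = σ.real A 0 + v j) :
    Det (.seq (.setReal A (.lit 0) (.ofInt (.lit 0))) (forColumns f)) s
      fun t => t.real A 0 = ∑ j, v j := by
  refine det_seq (det_setReal ?_)
  set s' := (s.putReal A ((IExpr.lit 0).eval s) ((RExpr.ofInt (.lit 0)).eval s)).tick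
    ((IExpr.lit 0).size + (RExpr.ofInt (.lit 0)).size + 1) with hs'
  have hs0 : s'.real A 0 = 0 := by simp [hs', Config.putReal_real, IExpr.eval, RExpr.eval]
  have hsr : ∀ a, a ≠ A → s'.real a = s.real a := fun a ha =>
    Config.putReal_real_of_ne _ _ _ ha
  refine (det_forColumns (s := s') (m := m) hm (fun k σ => (∀ a, a ≠ 2 → σ.int a = s.int a) ∧
    (∀ a, a ≠ A → σ.real a = s.real a) ∧
    σ.real A 0 = ∑ i ∈ Finset.range k, if h : i < m then v ⟨i, h⟩ else 0)
    (fun k => ⟨fun _ _ => rfl, hsr, by simpa using hs0⟩) ?_).mono fun t _ _ ht => ?_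
  · rintro j σ ⟨h1, h2, h3⟩
    have h5 : ∀ a, a ≠ 2 → ((σ.putInt 2 0 j).tick 1).int a = s.int a := fun a ha => by
      rw [Config.tick_int, Config.putInt_int_of_ne _ _ _ ha, h1 a ha]
    refine (h j ((σ.putInt 2 0 j).tick 1) (by simp [Config.putInt_int]) h5 h2).mono
      fun t ht1 ht2 ht => ⟨fun a ha => ?_, fun a ha => ?_, ?_⟩
    · rw [ht1 a (by simp [hint]), h5 a ha]
    · rw [ht2 a (hreal a ha)]
      exact h2 a ha
    · rw [ht, Finset.sum_range_succ, dif_pos j.2, ← h3]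
      rfl
  · rw [ht.2.2, Finset.sum_range]
    simp

end machine

/-! ## Independent coins, tossed one after the other -/

/-- The last coin is split off, which matches the recursion of `iterate`, whose last iteration is
executed last. -/
theorem coins_succ {k : ℕ} (p : Fin (k + 1) → ℝ) :
    coins p = (coins fun j => p j.castSucc).bind fun b =>
      (coin (p (Fin.last k))).map fun t => Fin.snoc (α := fun _ => Bool) b t := by
  ext b
  rw [PMF.bind_apply, tsum_fintype, Finset.sum_eq_single (Fin.init b)]
  · rw [PMF.map_apply, tsum_fintype, Finset.sum_eq_single (b (Fin.last k))]
    · simp only [Fin.snoc_init_self, if_true, coins, PMF.ofFintype_apply, Fin.prod_univ_castSucc]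
      rfl
    · intro t _ ht
      rw [if_neg]
      intro h
      apply ht
      rw [h, Fin.snoc_last]
    · simp
  · intro b' _ hb'
    rw [PMF.map_apply, tsum_fintype, Finset.sum_eq_zero, mul_zero]
    intro t _
    rw [if_neg]
    intro h
    apply hb'
    rw [h, Fin.init_snoc]
  · simp

/-! ## The programs -/

/-- The current column. -/
def colExpr : IExpr := .get 2 (.lit 0)

/-- The entry of a real array at the current column. -/
def colEntry (a : ℕ) : RExpr := .get a colExpr

/-- A real variable, held at index `0` of an array. -/
def realVar (a : ℕ) : RExpr := .get a (.lit 0)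

/-- A natural number as a real expression. -/
def natExpr (k : ℕ) : RExpr := .ofInt (.lit k)

/-- Array `4` receives the row, with entries truncated at `1`. -/
def truncateCmd : Cmd :=
  forColumns (.ifLt (colEntry 2) (natExpr 1) (.setReal 4 colExpr (colEntry 2))
    (.setReal 4 colExpr (natExpr 1)))

/-- Variable `10` receives the largest ratio `a_k / c_k`, and the integer variable `3` the first maximizer. -/
def bestCmd : Cmd :=
  .seq (.setReal 10 (.lit 0) (natExpr 0))
    (forColumns (.ifLt (realVar 10) (.div (colEntry 4) (colEntry 0))
      (.seq (.setReal 10 (.lit 0) (.div (colEntry 4) (colEntry 0))) (.setInt 3 (.lit 0) colExpr))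
      .skip))

/-- Start again with the guess `e`. -/
def restartCmd (e : RExpr) : Cmd :=
  .seq (.setReal 1 (.lit 0) e)
    (.seq (forColumns (.setReal 3 colExpr (.div (realVar 1) (.mul (colEntry 0) (.ofInt dimExpr)))))
      (.setReal 9 (.lit 0) (natExpr 1)))

/-- Raise a guess below the cost of a full greedy cover of the row. -/
def raiseCmd : Cmd :=
  .ifLt (realVar 1) (.div (natExpr 1) (realVar 10)) (restartCmd (.div (natExpr 2) (realVar 10)))
    .skip

/-- Double a guess that is refuted by the certificate. -/
def refuteCmd : Cmd :=
  .ifLt (.ofInt dimExpr) (realVar 9) (restartCmd (.mul (natExpr 2) (realVar 1))) .skip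

/-- Variable `11` receives the deficit of the row, if the solution is held with the factor `q`. -/
def deficitCmd (q : ℕ) : Cmd :=
  .seq (.seq (.setReal 11 (.lit 0) (natExpr 0))
      (forColumns (.setReal 11 (.lit 0)
        (.add (realVar 11) (.mul (colEntry 4) (.ofInt (.get 1 colExpr)))))))
    (.seq (.setReal 11 (.lit 0) (.sub (natExpr 1) (.div (realVar 11) (natExpr q))))
      (.ifLt (realVar 11) (natExpr 0) (.setReal 11 (.lit 0) (natExpr 0)) .skip))

/-- Variable `12` receives `κ`, and array `7` the vector `y`. -/
def scaleCmd : Cmd :=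
  .seq (.setReal 12 (.lit 0) (.div (realVar 11) (realVar 10)))
    (forColumns (.setReal 7 colExpr (.div (.mul (realVar 12) (colEntry 3)) (realVar 1))))

/-- The multiplicative update. -/
def learnCmd : Cmd :=
  .seq (.seq (.setReal 13 (.lit 0) (natExpr 0))
      (forColumns (.setReal 13 (.lit 0) (.add (realVar 13) (.mul (colEntry 4) (colEntry 3))))))
    (.ifLt (realVar 13) (realVar 11)
      (.seq (forColumns (.setReal 3 colExpr (.mul (colEntry 3)
          (.exp (.mul (realVar 12) (.div (colEntry 4) (colEntry 0)))))))
        (.seq (.seq (.setReal 14 (.lit 0) (natExpr 0))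
            (forColumns (.setReal 14 (.lit 0)
              (.add (realVar 14) (.mul (colEntry 0) (colEntry 3))))))
          (.seq (.setReal 14 (.lit 0) (.div (realVar 14) (realVar 1)))
            (.seq (forColumns (.setReal 3 colExpr (.div (colEntry 3) (realVar 14))))
              (.setReal 9 (.lit 0) (.mul (realVar 9)
                (.div (.exp (.div (realVar 12) (realVar 1))) (realVar 14))))))))
      .skip)

/-- The cheapest column. -/
def starExpr : IExpr := .get 3 (.lit 0)

/-- The fractional number of copies of the cheapest column that cover the row. -/
def greedyExpr : RExpr := .div (realVar 11) (.get 4 starExpr)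

/-- Buy the cheapest column. -/
def greedyCmd (q : ℕ) : Cmd :=
  .seq (.setFloor 4 (.lit 0) greedyExpr)
    (.seq (.setInt 1 starExpr (.add (.get 1 starExpr) (.mul (.lit q) (.get 4 (.lit 0)))))
      (.ifLt (.ofInt (.get 4 (.lit 0))) greedyExpr
        (.setInt 1 starExpr (.add (.get 1 starExpr) (.lit q))) .skip))

/-- Buy a rounding of the current entry of array `7`. -/
def roundEntryCmd (q : ℕ) : Cmd :=
  .seq (.setFloor 4 (.lit 0) (colEntry 7))
    (.seq (.toss 5 (.lit 0) (.sub (colEntry 7) (.ofInt (.get 4 (.lit 0)))))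
      (.setInt 1 colExpr (.add (.get 1 colExpr)
        (.mul (.lit q) (.add (.get 4 (.lit 0)) (.get 5 (.lit 0)))))))

/-- The threshold `1 / (e - 1)`. -/
def thresholdExpr : RExpr := .div (natExpr 1) (.sub (.exp (natExpr 1)) (natExpr 1))

/-- One round on the row in array `2`. -/
def roundCmd (q : ℕ) (pre post : Cmd) : Cmd :=
  .seq truncateCmd (.seq bestCmd (.seq pre (.seq (deficitCmd q)
    (.ifLt thresholdExpr (realVar 11)
      (.seq scaleCmd (.seq learnCmd (.seq post (.seq (greedyCmd q)
        (forColumns (roundEntryCmd q))))))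
      .skip))))

/-- The initial fractional solution of LearnOrCoverCIP. -/
def initCmd : Cmd :=
  .seq (.seq (.setReal 15 (.lit 0) (natExpr 0))
      (forColumns (.ifLt (realVar 1) (colEntry 0) .skip
        (.setReal 15 (.lit 0) (.add (realVar 15) (natExpr 1))))))
    (forColumns (.ifLt (realVar 1) (colEntry 0) (.setReal 3 colExpr (natExpr 0))
      (.setReal 3 colExpr (.div (realVar 1) (.mul (colEntry 0) (realVar 15))))))

/-- LearnOrCoverCIP. -/
def locProgram : OnlineProgram := ⟨initCmd, roundCmd 1 .skip .skip⟩

/-- The algorithm that guesses the optimal value, and holds three times the solution. -/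
def adaptProgram : OnlineProgram := ⟨.skip, roundCmd 3 raiseCmd refuteCmd⟩

/-! ## Correctness of the programs -/

/-- The memory represents a state of the algorithm, and holds `q` times the solution. -/
structure Represents {m : ℕ} (q : ℕ) (c : Fin m → ℝ) (st : AdaptState m) (s : Config) : Prop where
  dim : s.int 0 0 = m
  cost : ∀ j : Fin m, s.real 0 j = c j
  x : ∀ j : Fin m, s.real 3 j = st.x j
  z : ∀ j : Fin m, s.int 1 j = q * st.z j
  β : s.real 1 0 = st.β
  G : s.real 9 0 = st.G

theorem Represents.congr {m q : ℕ} {c : Fin m → ℝ} {st : AdaptState m} {s t : Config}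
    (h : Represents q c st s) (h0 : t.int 0 = s.int 0) (h1 : t.int 1 = s.int 1)
    (h2 : t.real 0 = s.real 0) (h3 : t.real 3 = s.real 3) (h4 : t.real 1 = s.real 1)
    (h5 : t.real 9 = s.real 9) : Represents q c st t :=
  ⟨by rw [h0, h.dim], fun j => by rw [h2, h.cost], fun j => by rw [h3, h.x],
    fun j => by rw [h1, h.z], by rw [h4, h.β], by rw [h5, h.G]⟩

/-- The row with entries truncated at `1`. -/
noncomputable def truncRow {m : ℕ} (r : Fin m → ℝ) : Fin m → ℝ := fun j => min (r j) 1

section correctness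
variable {m q : ℕ} {c a : Fin m → ℝ} {s : Config} {st : AdaptState m}

theorem det_truncateCmd {r : Fin m → ℝ} (hm : s.int 0 0 = m) (hr : ∀ j : Fin m, s.real 2 j = r j) :
    Det truncateCmd s fun t => ∀ j : Fin m, t.real 4 j = truncRow r j := by
  refine det_forColumns_map (A := 4) (truncRow r) hm rfl
    (by simp [Cmd.realTargets]) fun j σ hj _ h _ => ?_
  have hσ : σ.real 2 j = r j := by rw [h 2 (by norm_num), hr]
  refine det_ifLt (fun hlt => det_setReal ?_) fun hlt => det_setReal ?_ <;>
  simp only [colEntry, colExpr, natExpr, RExpr.eval, IExpr.eval, hj, hσ, Nat.cast_one,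
    Config.tick_int, Config.tick_real] at hlt ⊢
  · exact ⟨by simp [Config.putReal_real, truncRow, hlt.le],
      fun i hi => by simp [Config.putReal_real, hi]⟩
  · exact ⟨by simp [Config.putReal_real, truncRow, not_lt.1 hlt],
      fun i hi => by simp [Config.putReal_real, hi]⟩

/-- The program maximizes `a_k / c_k` instead of minimizing `c_k / a_k`. A zero entry then has ratio
`0` and never beats the initial value, and the strict comparison keeps the first optimal column. -/
theorem det_bestCmd (hm : s.int 0 0 = m) (hc0 : ∀ j : Fin m, s.real 0 j = c j)
    (ha0 : ∀ j : Fin m, s.real 4 j = a j) (hc : ∀ j, 0 < c j) (ha : IsRow a) :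
    Det bestCmd s fun t => t.real 10 0 = 1 / minRatio c a ∧
      ∃ k : Fin m, IsArgmin c a k ∧ t.int 3 0 = k := by
  refine det_seq (det_setReal ?_)
  set s' := (s.putReal 10 ((IExpr.lit 0).eval s) ((natExpr 0).eval s)).tick
    ((IExpr.lit 0).size + (natExpr 0).size + 1) with hs'
  refine (det_forColumns (s := s') (m := m) hm (fun k σ =>
    (∀ b, b ≠ 10 → σ.real b = s.real b) ∧ 0 ≤ σ.real 10 0 ∧
    (∀ j : Fin m, (j : ℕ) < k → a j / c j ≤ σ.real 10 0) ∧
    (0 < σ.real 10 0 → ∃ l : Fin m, σ.int 3 0 = l ∧ σ.real 10 0 = a l / c l ∧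
      ∀ j < l, a j / c j < a l / c l)) ?_ ?_).mono fun t _ _ ht => ?_
  · have h10 : s'.real 10 0 = 0 := by
      simp [hs', Config.putReal_real, natExpr, IExpr.eval, RExpr.eval]
    intro k
    simp only [Config.tick_real, h10]
    exact ⟨fun b hb => Config.putReal_real_of_ne _ _ _ hb, le_rfl,
      fun j hj => absurd hj (Nat.not_lt_zero _), fun h => absurd h (lt_irrefl _)⟩
  · rintro j σ ⟨h1, h2, h3, h4⟩
    have h5 : σ.real 4 j = a j := by rw [h1 4 (by norm_num), ha0]
    have h6 : σ.real 0 j = c j := by rw [h1 0 (by norm_num), hc0]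
    refine det_ifLt (fun hlt => det_seq (det_setReal (det_setInt ?_))) fun hlt => det_skip ?_ <;>
    simp [colEntry, colExpr, realVar, RExpr.eval, IExpr.eval, Config.putInt_int, h5, h6] at hlt
    · simp [colEntry, colExpr, realVar, RExpr.eval, IExpr.eval, Config.putInt_int,
        Config.putReal_real, h5, h6]
      refine ⟨fun b hb => ?_, (div_nonneg (ha.1 j).1 (hc j).le), fun i hi => ?_,
        fun hpos => ⟨j, rfl, rfl, fun i hi => ?_⟩⟩
      · rw [Config.putReal_real_of_ne _ _ _ hb]
        exact h1 b hb
      · rcases hi.lt_or_eq with hlt' | heq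
        · exact (h3 i hlt').trans hlt.le
        · rw [heq]
      · exact (h3 i hi).trans_lt hlt
    · simp only [Config.tick_real, Config.putInt_real, Config.tick_int]
      refine ⟨h1, h2, fun i hi => ?_, fun hpos => ?_⟩
      · rcases Nat.lt_succ_iff_lt_or_eq.1 hi with hlt' | heq
        · exact h3 i hlt'
        · rw [Fin.ext heq]
          exact hlt
      · simpa [Config.putInt_int] using h4 hpos
  · obtain ⟨-, -, h3, h4⟩ := ht
    obtain ⟨j, hj⟩ := ha.2
    obtain ⟨l, hl, hl', hl''⟩ := h4 ((div_pos hj (hc j)).trans_le (h3 j j.2))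
    have hpos : 0 < a l / c l := hl' ▸ (div_pos hj (hc j)).trans_le (h3 j j.2)
    have hal : 0 < a l := by
      by_contra h
      exact absurd (div_nonpos_of_nonpos_of_nonneg (not_lt.1 h) (hc l).le) hpos.not_ge
    have harg : IsArgmin c a l := by
      refine ⟨hal, fun k hk => ?_, fun k hkl hk => ?_⟩
      · have := h3 k k.2
        rw [hl', div_le_div_iff₀ (hc k) (hc l)] at this
        rw [div_le_div_iff₀ hal hk]
        linarith
      · have := hl'' k hkl
        rw [div_lt_div_iff₀ (hc k) (hc l)] at this
        rw [div_lt_div_iff₀ hal hk]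
        linarith
    exact ⟨by rw [hl', minRatio_eq harg, one_div_div], l, harg, hl⟩

theorem det_restartCmd {e : RExpr} {β : ℝ} (h : Represents q c st s) (he : e.eval s = β) :
    Det (restartCmd e) s (Represents q c (st.restart c β)) := by
  refine det_seq (det_setReal ?_)
  set s' := (s.putReal 1 ((IExpr.lit 0).eval s) (e.eval s)).tick
    ((IExpr.lit 0).size + e.size + 1) with hs'
  have hsr : ∀ b, b ≠ 1 → s'.real b = s.real b := fun b hb => Config.putReal_real_of_ne _ _ _ hb
  have hs1 : s'.real 1 0 = β := by simp [hs', Config.putReal_real, IExpr.eval, he]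
  refine det_seq ((det_forColumns_map (s := s') (A := 3) (fun j => β / (c j * m)) h.dim rfl
    (by simp [Cmd.realTargets]) fun j σ hj h1 h2 _ => det_setReal ?_).mono fun t ht1 ht2 ht => ?_)
  · have h3 : σ.real 1 0 = β := by rw [h2 1 (by norm_num), hs1]
    have h4 : σ.real 0 j = c j := by rw [h2 0 (by norm_num), hsr 0 (by norm_num), h.cost]
    have h5 : σ.int 0 0 = m := by
      rw [h1 0 (by norm_num)]
      exact h.dim
    simp only [realVar, colEntry, colExpr, dimExpr, RExpr.eval, IExpr.eval, hj, h3, h4, h5]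
    exact ⟨by simp [Config.putReal_real], fun i hi => by simp [Config.putReal_real, hi]⟩
  · have hr : ∀ b, b ≠ 3 → t.real b = s'.real b := fun b hb =>
      ht2 b (by simp [Cmd.realTargets, forColumns, hb])
    have hi : ∀ b, b ≠ 2 → t.int b = s.int b := fun b hb =>
      ht1 b (by simp [Cmd.intTargets, forColumns, hb])
    refine det_setReal ⟨?_, fun j => ?_, fun j => ?_, fun j => ?_, ?_, ?_⟩
    · simp [hi, h.dim]
    · simp [Config.putReal_real, hr, hsr, h.cost]
    · simp [Config.putReal_real, ht, AdaptState.restart]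
    · simp [hi, h.z, AdaptState.restart]
    · simp [Config.putReal_real, hr, hs1, AdaptState.restart]
    · simp [Config.putReal_real, IExpr.eval, RExpr.eval, natExpr, AdaptState.restart]

theorem det_raiseCmd (h : Represents q c st s) (hbest : s.real 10 0 = 1 / minRatio c a) :
    Det raiseCmd s (Represents q c (st.raise c a)) := by
  have e1 : ((natExpr 1).div (realVar 10)).eval s = minRatio c a := by
    simp [natExpr, realVar, RExpr.eval, IExpr.eval, hbest]
  have e2 : (realVar 1).eval s = st.β := h.β
  refine det_ifLt (fun hlt => ?_) fun hlt => det_skip ?_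
  · rw [e1, e2] at hlt
    rw [show st.raise c a = st.restart c (2 * minRatio c a) from if_pos hlt]
    refine det_restartCmd (h.congr rfl rfl rfl rfl rfl rfl) ?_
    simp [natExpr, realVar, RExpr.eval, IExpr.eval, hbest]
  · rw [e1, e2] at hlt
    rw [show st.raise c a = st from if_neg hlt]
    exact h.congr rfl rfl rfl rfl rfl rfl

theorem det_refuteCmd (h : Represents q c st s) :
    Det refuteCmd s (Represents q c (st.refute c)) := by
  have e1 : (RExpr.ofInt dimExpr).eval s = m := by
    simp [dimExpr, RExpr.eval, IExpr.eval, h.dim]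
  have e2 : (realVar 9).eval s = st.G := h.G
  refine det_ifLt (fun hlt => ?_) fun hlt => det_skip ?_
  · rw [e1, e2] at hlt
    rw [show st.refute c = st.restart c (2 * st.β) from if_pos hlt]
    refine det_restartCmd (h.congr rfl rfl rfl rfl rfl rfl) ?_
    simp [natExpr, realVar, RExpr.eval, IExpr.eval, h.β]
  · rw [e1, e2] at hlt
    rw [show st.refute c = st from if_neg hlt]
    exact h.congr rfl rfl rfl rfl rfl rfl

theorem det_deficitCmd (hq : 0 < q) (h : Represents q c st s)
    (ha0 : ∀ j : Fin m, s.real 4 j = a j) :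
    Det (deficitCmd q) s fun t => t.real 11 0 = deficit a st.z := by
  have hq' : (q : ℝ) ≠ 0 := Nat.cast_ne_zero.2 hq.ne'
  refine det_seq ((det_forColumns_sum (A := 11) (fun j => a j * (q * st.z j : ℕ)) h.dim rfl
    (by simp [Cmd.realTargets]) fun j σ hj h1 h2 => det_setReal ?_).mono fun t ht1 ht2 ht => ?_)
  · have h3 : σ.real 4 j = a j := by rw [h2 4 (by norm_num), ha0]
    have h4 : σ.int 1 j = q * st.z j := by rw [h1 1 (by norm_num), h.z]
    simp [realVar, colEntry, colExpr, RExpr.eval, IExpr.eval, hj, h3, h4, Config.putReal_real]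
  · have hdot : ∑ j, a j * ((q * st.z j : ℕ) : ℝ) = q * dot a (toReal st.z) := by
      rw [← dot_toReal_mul]
      rfl
    rw [hdot] at ht
    refine det_seq (det_setReal (det_ifLt (fun hlt => det_setReal ?_) fun hlt => det_skip ?_)) <;>
    simp [realVar, natExpr, RExpr.eval, IExpr.eval, Config.putReal_real, ht, hq'] at hlt ⊢
    · rw [deficit, max_eq_left (by linarith)]
    · rw [deficit, max_eq_right (by linarith)]

theorem det_scaleCmd {Δ r : ℝ} (h : Represents q c st s) (hbest : s.real 10 0 = 1 / r)
    (hΔ : s.real 11 0 = Δ) :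
    Det scaleCmd s fun t => t.real 12 0 = Δ * r ∧
      ∀ j : Fin m, t.real 7 j = Δ * r * st.x j / st.β := by
  refine det_seq (det_setReal ?_)
  set s' := (s.putReal 12 ((IExpr.lit 0).eval s) (((realVar 11).div (realVar 10)).eval s)).tick
    ((IExpr.lit 0).size + ((realVar 11).div (realVar 10)).size + 1) with hs'
  have hsr : ∀ b, b ≠ 12 → s'.real b = s.real b := fun b hb =>
    Config.putReal_real_of_ne _ _ _ hb
  have h12 : s'.real 12 0 = Δ * r := by
    simp [hs', Config.putReal_real, realVar, RExpr.eval, IExpr.eval, hbest, hΔ]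
  refine (det_forColumns_map (s := s') (A := 7) (fun j => Δ * r * st.x j / st.β) h.dim rfl
    (by simp [Cmd.realTargets]) fun j σ hj h1 h2 _ => det_setReal ?_).mono
      fun t ht1 ht2 ht => ⟨?_, ht⟩
  · have h3 : σ.real 12 0 = Δ * r := by rw [h2 12 (by norm_num), h12]
    have h4 : σ.real 3 j = st.x j := by rw [h2 3 (by norm_num), hsr 3 (by norm_num), h.x]
    have h5 : σ.real 1 0 = st.β := by rw [h2 1 (by norm_num), hsr 1 (by norm_num), h.β]
    simp only [realVar, colEntry, colExpr, RExpr.eval, IExpr.eval, hj, h3, h4, h5]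
    exact ⟨by simp [Config.putReal_real], fun i hi => by simp [Config.putReal_real, hi]⟩
  · rw [ht2 12 (by simp [Cmd.realTargets, forColumns]), h12]

theorem det_learnCmd (h : Represents q c st s) (ha0 : ∀ j : Fin m, s.real 4 j = a j)
    (hΔ : s.real 11 0 = deficit a st.z) (hκ : s.real 12 0 = deficit a st.z * minRatio c a) :
    Det learnCmd s (Represents q c (st.learn c a)) := by
  set κ := deficit a st.z * minRatio c a with hκd
  refine det_seq ((det_forColumns_sum (A := 13) (fun j => a j * st.x j) h.dim rfl
    (by simp [Cmd.realTargets]) fun j σ hj h1 h2 => det_setReal ?_).mono fun t ht1 ht2 ht => ?_)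
  · have h3 : σ.real 4 j = a j := by rw [h2 4 (by norm_num), ha0]
    have h4 : σ.real 3 j = st.x j := by rw [h2 3 (by norm_num), h.x]
    simp [realVar, colEntry, colExpr, RExpr.eval, IExpr.eval, hj, h3, h4, Config.putReal_real]
  · replace ht1 : ∀ b, b ≠ 2 → t.int b = s.int b := fun b hb =>
      ht1 b (by simp [Cmd.intTargets, forColumns, hb])
    replace ht2 : ∀ b, b ≠ 13 → t.real b = s.real b := fun b hb =>
      ht2 b (by simp [Cmd.realTargets, forColumns, hb])
    have hrep : Represents q c st t := h.congr (ht1 0 (by norm_num)) (ht1 1 (by norm_num))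
      (ht2 0 (by norm_num)) (ht2 3 (by norm_num)) (ht2 1 (by norm_num)) (ht2 9 (by norm_num))
    have e1 : (realVar 13).eval t = dot a st.x := ht
    have e2 : (realVar 11).eval t = deficit a st.z := by
      rw [← hΔ, ← ht2 11 (by norm_num)]
      rfl
    refine det_ifLt (fun hlt => ?_) fun hlt => det_skip ?_ <;> rw [e1, e2] at hlt
    · have hst : st.learn c a = { st with
          x := learn st.β c a κ st.x
          G := st.G * (Real.exp (κ / st.β) / learnNorm st.β c a κ st.x) } := if_pos hlt
      set w : Fin m → ℝ := fun j => st.x j * Real.exp (κ * (a j / c j)) with hw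
      set s₁ := t.tick ((realVar 13).size + (realVar 11).size + 1)
      have hrep₁ : Represents q c st s₁ := hrep.congr rfl rfl rfl rfl rfl rfl
      have h4 : ∀ j : Fin m, s₁.real 4 j = a j := fun j => by
        rw [← ha0, ← ht2 4 (by norm_num)]
        rfl
      have h12 : s₁.real 12 0 = κ := by
        rw [← hκ, ← ht2 12 (by norm_num)]
        rfl
      clear_value s₁
      refine det_seq ((det_forColumns_map (A := 3) w hrep₁.dim rfl (by simp [Cmd.realTargets])
        fun j σ hj i1 i2 i3 => det_setReal ?_).mono fun s₂ f1 f2 g => ?_)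
      · have j1 : σ.real 4 j = a j := by rw [i2 4 (by norm_num), h4]
        have j2 : σ.real 0 j = c j := by rw [i2 0 (by norm_num), hrep₁.cost]
        have j3 : σ.real 12 0 = κ := by rw [i2 12 (by norm_num), h12]
        have j4 : σ.real 3 j = st.x j := by rw [i3, hrep₁.x]
        simp only [realVar, colEntry, colExpr, RExpr.eval, IExpr.eval, hj, j1, j2, j3, j4]
        exact ⟨by simp [Config.putReal_real, hw], fun i hi => by simp [Config.putReal_real, hi]⟩
      replace f1 : ∀ b, b ≠ 2 → s₂.int b = s₁.int b := fun b hb =>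
        f1 b (by simp [Cmd.intTargets, forColumns, hb])
      replace f2 : ∀ b, b ≠ 3 → s₂.real b = s₁.real b := fun b hb =>
        f2 b (by simp [Cmd.realTargets, forColumns, hb])
      have hdim₂ : s₂.int 0 0 = m := by rw [f1 0 (by norm_num), hrep₁.dim]
      refine det_seq ((det_forColumns_sum (A := 14) (fun j => c j * w j) hdim₂ rfl
        (by simp [Cmd.realTargets]) fun j σ hj i1 i2 => det_setReal ?_).mono fun s₃ f3 f4 g' => ?_)
      · have j1 : σ.real 0 j = c j := by
          rw [i2 0 (by norm_num), f2 0 (by norm_num), hrep₁.cost]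
        have j2 : σ.real 3 j = w j := by rw [i2 3 (by norm_num), g]
        simp [realVar, colEntry, colExpr, RExpr.eval, IExpr.eval, hj, j1, j2, Config.putReal_real]
      replace f3 : ∀ b, b ≠ 2 → s₃.int b = s₁.int b := fun b hb =>
        (f3 b (by simp [Cmd.intTargets, forColumns, hb])).trans (f1 b hb)
      replace f4 : ∀ b, b ≠ 14 → s₃.real b = s₂.real b := fun b hb =>
        f4 b (by simp [Cmd.realTargets, forColumns, hb])
      refine det_seq (det_setReal ?_)
      have e3 : ((realVar 14).div (realVar 1)).eval s₃ = learnNorm st.β c a κ st.x := by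
        simp only [realVar, RExpr.eval, IExpr.eval, g', f4 1 (by norm_num), f2 1 (by norm_num),
          hrep₁.β]
        rfl
      set s₄ := (s₃.putReal 14 ((IExpr.lit 0).eval s₃) (((realVar 14).div (realVar 1)).eval s₃)).tick
        ((IExpr.lit 0).size + ((realVar 14).div (realVar 1)).size + 1) with hs₄
      have f5 : ∀ b, b ≠ 14 → s₄.real b = s₂.real b := fun b hb =>
        (Config.putReal_real_of_ne _ _ _ hb).trans (f4 b hb)
      have h14 : s₄.real 14 0 = learnNorm st.β c a κ st.x := by
        simp [hs₄, Config.putReal_real, e3, IExpr.eval]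
      have f6 : ∀ b, b ≠ 2 → s₄.int b = s₁.int b := f3
      clear_value s₄
      refine det_seq ((det_forColumns_map (A := 3) (learn st.β c a κ st.x) (s := s₄)
        ((congrFun (f6 0 (by norm_num)) 0).trans hrep₁.dim) rfl (by simp [Cmd.realTargets])
        fun j σ hj i1 i2 i3 => det_setReal ?_).mono fun s₅ f7 f8 g'' => ?_)
      · have j1 : σ.real 14 0 = learnNorm st.β c a κ st.x := by rw [i2 14 (by norm_num), h14]
        have j2 : σ.real 3 j = w j := by rw [i3, f5 3 (by norm_num), g]
        simp only [realVar, colEntry, colExpr, RExpr.eval, IExpr.eval, hj, j1, j2]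
        exact ⟨by simp [Config.putReal_real, hw, learn_apply],
          fun i hi => by simp [Config.putReal_real, hi]⟩
      replace f7 : ∀ b, b ≠ 2 → s₅.int b = s₁.int b := fun b hb =>
        (f7 b (by simp [Cmd.intTargets, forColumns, hb])).trans (f6 b hb)
      replace f8 : ∀ b, b ≠ 3 → s₅.real b = s₄.real b := fun b hb =>
        f8 b (by simp [Cmd.realTargets, forColumns, hb])
      have k1 : ∀ b, b ≠ 3 → b ≠ 14 → s₅.real b = s₁.real b := fun b hb hb' => by
        rw [f8 b hb, f5 b hb', f2 b hb]
      have k2 : s₅.real 14 0 = learnNorm st.β c a κ st.x := by rw [f8 14 (by norm_num), h14]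
      rw [hst]
      refine det_setReal ⟨?_, fun j => ?_, fun j => ?_, fun j => ?_, ?_, ?_⟩
      · simp [f7, hrep₁.dim]
      · simp [Config.putReal_real, k1, hrep₁.cost]
      · simp [Config.putReal_real, g'']
      · simp [f7, hrep₁.z]
      · simp [Config.putReal_real, k1, hrep₁.β]
      · simp [Config.putReal_real, IExpr.eval, RExpr.eval, realVar, k1, k2, hrep₁.G, hrep₁.β, h12]
    · rw [show st.learn c a = st from if_neg hlt]
      exact hrep.congr rfl rfl rfl rfl rfl rfl

/-- The machine has a floor but no ceiling, so the greedy purchase is made by a floor and one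
comparison. -/
theorem ceil_eq_floor_add (v : ℝ) :
    ⌈v⌉₊ = ⌊v⌋₊ + if (⌊v⌋₊ : ℝ) < v then 1 else 0 := by
  split_ifs with h
  · exact le_antisymm (Nat.ceil_le_floor_add_one v) (Nat.lt_ceil.2 h)
  · exact le_antisymm (Nat.ceil_le.2 (not_lt.1 h)) (Nat.floor_le_ceil v)

theorem det_greedyCmd {k : Fin m} (hk : s.int 3 0 = k) {v : ℝ}
    (he : s.real 11 0 / s.real 4 k = v) :
    Det (greedyCmd q) s fun t => ∀ j : Fin m,
      t.int 1 j = s.int 1 j + if j = k then q * ⌈v⌉₊ else 0 := by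
  have hce := ceil_eq_floor_add v
  refine det_seq (det_setFloor (det_seq (det_setInt (det_ifLt (fun hlt => det_setInt ?_)
    fun hlt => det_skip ?_)))) <;>
  simp [greedyExpr, starExpr, realVar, RExpr.eval, IExpr.eval, Config.putInt_int, hk, he]
    at hlt ⊢ <;>
  intro j
  · rw [if_pos hlt] at hce
    by_cases hj : j = k
    · simp only [hj, if_true, hce]
      ring
    · simp [hj, Fin.val_inj]
  · rw [if_neg hlt.not_gt] at hce
    by_cases hj : j = k
    · simp [hj, hce]
    · simp [hj, Fin.val_inj]

end correctness

/-! ## Simulation of the rounds -/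

section simulation
variable {m q : ℕ} {c a : Fin m → ℝ}

theorem run_roundEntryCmd {s : Config} {k : ℕ} {v : ℝ} (hk : s.int 2 0 = k)
    (h7 : s.real 7 k = v) (hv : 0 ≤ v) :
    ∃ G : Bool → Config, (roundEntryCmd q).run s = (coin (Int.fract v)).map G ∧
      ∀ t, (G t).real = s.real ∧ (∀ b, b ≠ 1 → b ≠ 4 → b ≠ 5 → (G t).int b = s.int b) ∧
        ∀ i, (G t).int 1 i = s.int 1 i + if i = k then q * (⌊v⌋₊ + t.toNat) else 0 := by
  have h1 : v - ⌊v⌋₊ = Int.fract v := by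
    rw [sub_eq_iff_eq_add', floor_add_fract_of_nonneg hv]
  set s₁ := (s.putInt 4 0 ⌊v⌋₊).tick ((IExpr.lit 0).size + (colEntry 7).size + 1) with hs₁
  have e1 : (Cmd.setFloor 4 (.lit 0) (colEntry 7)).run s = PMF.pure s₁ := by
    simp [Cmd.run, hs₁, colEntry, colExpr, RExpr.eval, IExpr.eval, hk, h7]
  have e2 : ((colEntry 7).sub (.ofInt (.get 4 (.lit 0)))).eval s₁ = Int.fract v := by
    simp [hs₁, colEntry, colExpr, RExpr.eval, IExpr.eval, Config.putInt_int, hk, h7, h1]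
  refine ⟨fun t =>
    let s₂ := (s₁.putInt 5 0 t.toNat).tick
      ((IExpr.lit 0).size + ((colEntry 7).sub (.ofInt (.get 4 (.lit 0)))).size + 1)
    (s₂.putInt 1 (colExpr.eval s₂) ((IExpr.add (.get 1 colExpr)
      (.mul (.lit q) (.add (.get 4 (.lit 0)) (.get 5 (.lit 0))))).eval s₂)).tick
      (colExpr.size + (IExpr.add (.get 1 colExpr)
        (.mul (.lit q) (.add (.get 4 (.lit 0)) (.get 5 (.lit 0))))).size + 1), ?_, ?_⟩
  · rw [roundEntryCmd, Cmd.run, e1, PMF.pure_bind, Cmd.run, Cmd.run, e2, PMF.bind_map]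
    rfl
  · intro t
    refine ⟨rfl, fun b hb1 hb4 hb5 => ?_, fun i => ?_⟩
    · simp [hs₁, Config.putInt_int_of_ne, hb1, hb4, hb5]
    · by_cases hi : i = k <;> simp [hs₁, Config.putInt_int, IExpr.eval, colExpr, hk, hi]

/-- Each entry is bought from array `7`, which the loop does not change, so the biases do not depend
on earlier tosses. The law is therefore an image of the product law, by induction on the number of
columns with `coins_succ`. -/
theorem run_roundLoop {s : Config} {y : Fin m → ℝ} (hm : s.int 0 0 = m)
    (h7 : ∀ j : Fin m, s.real 7 j = y j) (hy : ∀ j, 0 ≤ y j) :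
    ∃ F : (Fin m → Bool) → Config,
      (forColumns (roundEntryCmd q)).run s = (coins fun j => Int.fract (y j)).map F ∧
      ∀ b, (F b).real = s.real ∧ (F b).int 0 = s.int 0 ∧
        ∀ j : Fin m, (F b).int 1 j = s.int 1 j + q * (⌊y j⌋₊ + (b j).toNat) := by
  have key : ∀ k ≤ m, ∃ F : (Fin k → Bool) → Config,
      iterate (fun k s => (roundEntryCmd q).run ((s.putInt 2 0 k).tick 1)) k
        (s.tick (dimExpr.size + 1)) = (coins fun j : Fin k => Int.fract (s.real 7 j)).map F ∧
      ∀ b, (F b).real = s.real ∧ (F b).int 0 = s.int 0 ∧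
        (∀ j : Fin k, (F b).int 1 j = s.int 1 j + q * (⌊s.real 7 j⌋₊ + (b j).toNat)) ∧
        ∀ i, k ≤ i → (F b).int 1 i = s.int 1 i := by
    intro k
    induction k with
    | zero =>
      intro _
      refine ⟨fun _ => s.tick (dimExpr.size + 1), ?_, fun b => ⟨rfl, rfl, fun j => j.elim0,
        fun _ _ => rfl⟩⟩
      exact (PMF.map_const _ _).symm
    | succ k ih =>
      intro hk
      obtain ⟨F, hF, hF'⟩ := ih (Nat.le_of_succ_le hk)
      have hG : ∀ b, ∃ G : Bool → Config,
          (roundEntryCmd q).run (((F b).putInt 2 0 k).tick 1) =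
            (coin (Int.fract (s.real 7 k))).map G ∧
          ∀ t, (G t).real = s.real ∧ (G t).int 0 = s.int 0 ∧
            ∀ i, (G t).int 1 i =
              (F b).int 1 i + if i = k then q * (⌊s.real 7 k⌋₊ + t.toNat) else 0 := by
        intro b
        obtain ⟨h1, h2, -, -⟩ := hF' b
        obtain ⟨G, hG, hG'⟩ := run_roundEntryCmd (q := q) (s := ((F b).putInt 2 0 k).tick 1)
          -- The floor is truncated at zero, so it agrees with the `Int.fract` decomposition only
          -- for a nonnegative entry; this is why nonnegativity is carried through the simulation.
          (k := k) (v := s.real 7 k) (by simp [Config.putInt_int]) (by simp [h1])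
          (by rw [show s.real 7 k = y ⟨k, hk⟩ from h7 ⟨k, hk⟩]; exact hy _)
        refine ⟨G, hG, fun t => ?_⟩
        obtain ⟨g1, g2, g3⟩ := hG' t
        refine ⟨g1.trans h1, ?_, fun i => ?_⟩
        · rw [g2 0 (by norm_num) (by norm_num) (by norm_num), Config.tick_int,
            Config.putInt_int_of_ne _ _ _ (by norm_num), h2]
        · rw [g3 i, Config.tick_int, Config.putInt_int_of_ne _ _ _ (by norm_num)]
      choose G hG hG' using hG
      refine ⟨fun b => G (Fin.init b) (b (Fin.last k)), ?_, fun b => ?_⟩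
      · rw [iterate, hF, PMF.bind_map, coins_succ, PMF.map_bind]
        congr 1
        ext b : 1
        rw [Function.comp_apply, hG, PMF.map_comp]
        congr 1
        ext t : 1
        simp [Fin.init_snoc (α := fun _ => Bool), Fin.snoc_last (α := fun _ => Bool)]
      · obtain ⟨f1, f2, f3, f4⟩ := hF' (Fin.init b)
        obtain ⟨g1, g2, g3⟩ := hG' (Fin.init b) (b (Fin.last k))
        refine ⟨g1, g2, fun j => ?_, fun i hi => ?_⟩
        · rw [g3]
          refine Fin.lastCases ?_ (fun j => ?_) j
          · simp [f4]
          · have := f3 j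
            simp only [Fin.init] at this
            simp [this, j.2.ne]
        · rw [g3, f4 i (by omega), if_neg (by omega), add_zero]
  obtain ⟨F, hF, hF'⟩ := key m le_rfl
  have hp : (fun j : Fin m => Int.fract (s.real 7 j)) = fun j => Int.fract (y j) := by
    ext j
    rw [h7]
  rw [hp] at hF
  refine ⟨F, ?_, fun b => ⟨(hF' b).1, (hF' b).2.1, fun j => ?_⟩⟩
  · rw [forColumns, Cmd.run, show dimExpr.eval s = m from hm]
    exact hF
  · rw [(hF' b).2.2.1 j, h7]

/-- The state that the memory represents. -/
noncomputable def Config.state (m q : ℕ) (s : Config) : AdaptState m where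
  x := fun j => s.real 3 j
  z := fun j => s.int 1 j / q
  β := s.real 1 0
  G := s.real 9 0

theorem Represents.state_eq (hq : 0 < q) {st : AdaptState m} {s : Config}
    (h : Represents q c st s) : s.state m q = st := by
  obtain ⟨-, -, h1, h2, h3, h4⟩ := h
  cases st
  simp only [Config.state, AdaptState.mk.injEq]
  exact ⟨funext h1, funext fun j => by rw [h2, Nat.mul_div_cancel_left _ hq], h3, h4⟩

/-- A law of memory contents represents a law of states. -/
def Simulates (q : ℕ) (c : Fin m → ℝ) (p : PMF Config) (μ : PMF (AdaptState m)) : Prop :=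
  p.map (Config.state m q) = μ ∧ ∀ t ∈ p.support, Represents q c (t.state m q) t

theorem simulates_seq {f g : Cmd} {s : Config} {μ : PMF (AdaptState m)}
    (h : Det f s fun t => Simulates q c (g.run t) μ) : Simulates q c ((Cmd.seq f g).run s) μ := by
  obtain ⟨t, ht, h⟩ := h
  rwa [Cmd.run, ht, PMF.pure_bind]

theorem simulates_pure (hq : 0 < q) {t : Config} {st : AdaptState m} (h : Represents q c st t) :
    Simulates q c (PMF.pure t) (PMF.pure st) := by
  refine ⟨by rw [PMF.pure_map, h.state_eq hq], fun t' ht' => ?_⟩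
  rw [PMF.mem_support_pure_iff] at ht'
  rw [ht', h.state_eq hq]
  exact h

theorem simulates_map (hq : 0 < q) {T : Type*} (ν : PMF T) {F : T → Config}
    {S : T → AdaptState m} (h : ∀ b, Represents q c (S b) (F b)) :
    Simulates q c (ν.map F) (ν.map S) := by
  refine ⟨?_, fun t ht => ?_⟩
  · rw [PMF.map_comp]
    congr 1
    ext b : 1
    exact (h b).state_eq hq
  · rw [PMF.mem_support_map_iff] at ht
    obtain ⟨b, -, rfl⟩ := ht
    rw [(h b).state_eq hq]
    exact h b

/-- The fractional part of the state is nonnegative. -/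
def AdaptState.Nonneg (st : AdaptState m) : Prop := (∀ j, 0 ≤ st.x j) ∧ 0 ≤ st.β

theorem AdaptState.Nonneg.learn (hc : ∀ j, 0 < c j) {st : AdaptState m} (h : st.Nonneg) :
    (st.learn c a).Nonneg := by
  unfold AdaptState.learn
  split_ifs
  · have hw : ∀ (κ : ℝ) j, 0 ≤ st.x j * Real.exp (κ * (a j / c j)) := fun κ j =>
      mul_nonneg (h.1 j) (Real.exp_pos _).le
    exact ⟨fun j => div_nonneg (hw _ j)
      (div_nonneg (dot_nonneg (fun j => (hc j).le) (hw _)) h.2), h.2⟩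
  · exact h

theorem AdaptState.Nonneg.restart (hc : ∀ j, 0 < c j) {β : ℝ} (hβ : 0 ≤ β) (st : AdaptState m) :
    (st.restart c β).Nonneg :=
  ⟨fun j => div_nonneg hβ (mul_nonneg (hc j).le (Nat.cast_nonneg _)), hβ⟩

/-- Commands that carry out modifications of the state before and after a round. -/
structure Implements (q : ℕ) (c : Fin m → ℝ) (preCmd postCmd : Cmd)
    (pre : (Fin m → ℝ) → AdaptState m → AdaptState m) (post : AdaptState m → AdaptState m) :
    Prop where
  det_pre : ∀ a st s, Represents q c st s → s.real 10 0 = 1 / minRatio c a →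
    Det preCmd s (Represents q c (pre a st))
  det_post : ∀ st s, Represents q c st s → Det postCmd s (Represents q c (post st))
  int_pre : ∀ b ∈ preCmd.intTargets, b = 2
  int_post : ∀ b ∈ postCmd.intTargets, b = 2
  real_pre : ∀ b ∈ preCmd.realTargets, b = 1 ∨ b = 3 ∨ b = 9
  real_post : ∀ b ∈ postCmd.realTargets, b = 1 ∨ b = 3 ∨ b = 9
  nonneg_pre : ∀ a st, IsRow a → st.Nonneg → (pre a st).Nonneg
  nonneg_post : ∀ st, st.Nonneg → (post st).Nonneg

theorem implements_skip : Implements q c .skip .skip (fun _ st => st) id where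
  det_pre _ _ _ h _ := det_skip (h.congr rfl rfl rfl rfl rfl rfl)
  det_post _ _ h := det_skip (h.congr rfl rfl rfl rfl rfl rfl)
  int_pre := by simp [Cmd.intTargets]
  int_post := by simp [Cmd.intTargets]
  real_pre := by simp [Cmd.realTargets]
  real_post := by simp [Cmd.realTargets]
  nonneg_pre _ _ _ h := h
  nonneg_post _ h := h

theorem implements_adapt (hc : ∀ j, 0 < c j) :
    Implements q c raiseCmd refuteCmd (AdaptState.raise c) (AdaptState.refute c) where
  det_pre _ _ _ h h' := det_raiseCmd h h'
  det_post _ _ h := det_refuteCmd h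
  int_pre := by simp [raiseCmd, restartCmd, forColumns, Cmd.intTargets]
  int_post := by simp [refuteCmd, restartCmd, forColumns, Cmd.intTargets]
  real_pre := by simp [raiseCmd, restartCmd, forColumns, Cmd.realTargets]
  real_post := by simp [refuteCmd, restartCmd, forColumns, Cmd.realTargets]
  nonneg_pre a st ha h := by
    unfold AdaptState.raise
    split_ifs
    · exact AdaptState.Nonneg.restart hc (by linarith [minRatio_pos hc ha.2]) st
    · exact h
  nonneg_post st h := by
    unfold AdaptState.refute
    split_ifs
    · exact AdaptState.Nonneg.restart hc (by linarith [h.2]) st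
    · exact h

variable {preCmd postCmd : Cmd} {pre : (Fin m → ℝ) → AdaptState m → AdaptState m}
  {post : AdaptState m → AdaptState m}

theorem modifiedRound_nonneg (himp : Implements q c preCmd postCmd pre post)
    (hc : ∀ j, 0 < c j) (ha : IsRow a) {st st' : AdaptState m} (h : st.Nonneg)
    (hst' : st' ∈ (modifiedRound pre post c a st).support) : st'.Nonneg := by
  have h1 := himp.nonneg_pre a st ha h
  unfold modifiedRound at hst'
  split_ifs at hst'
  · rw [PMF.mem_support_map_iff] at hst'
    obtain ⟨b, -, rfl⟩ := hst'
    exact himp.nonneg_post _ (h1.learn hc)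
  · rw [PMF.mem_support_pure_iff] at hst'
    rwa [hst']

/-- A round of the program carries out a round of the algorithm. -/
theorem simulates_roundCmd (himp : Implements q c preCmd postCmd pre post) (hq : 0 < q)
    (hc : ∀ j, 0 < c j) {r : Fin m → ℝ} (hr : IsRow (truncRow r)) {st : AdaptState m}
    (hst : st.Nonneg) {s : Config} (h : Represents q c st s) (h2 : ∀ j : Fin m, s.real 2 j = r j) :
    Simulates q c ((roundCmd q preCmd postCmd).run s)
      (modifiedRound pre post c (truncRow r) st) := by
  set a := truncRow r with ha
  refine simulates_seq ((det_truncateCmd h.dim h2).mono fun s₁ i1 r1 h4 => simulates_seq ?_)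
  replace i1 : ∀ b, b ≠ 2 → s₁.int b = s.int b := fun b hb =>
    i1 b (by simp [truncateCmd, Cmd.intTargets, forColumns, hb])
  replace r1 : ∀ b, b ≠ 4 → s₁.real b = s.real b := fun b hb =>
    r1 b (by simp [truncateCmd, Cmd.realTargets, forColumns, hb])
  have h₁ : Represents q c st s₁ := h.congr (i1 0 (by norm_num)) (i1 1 (by norm_num))
    (r1 0 (by norm_num)) (r1 3 (by norm_num)) (r1 1 (by norm_num)) (r1 9 (by norm_num))
  refine (det_bestCmd h₁.dim h₁.cost h4 hc hr).mono fun s₂ i2 r2 ⟨hbest, k, hk, hk3⟩ =>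
    simulates_seq ?_
  replace i2 : ∀ b, b ≠ 2 → b ≠ 3 → s₂.int b = s₁.int b := fun b hb hb' =>
    i2 b (by simp [bestCmd, Cmd.intTargets, forColumns, hb, hb'])
  replace r2 : ∀ b, b ≠ 10 → s₂.real b = s₁.real b := fun b hb =>
    r2 b (by simp [bestCmd, Cmd.realTargets, forColumns, hb])
  have h₂ : Represents q c st s₂ := h₁.congr (i2 0 (by norm_num) (by norm_num))
    (i2 1 (by norm_num) (by norm_num)) (r2 0 (by norm_num)) (r2 3 (by norm_num))
    (r2 1 (by norm_num)) (r2 9 (by norm_num))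
  replace h4 : ∀ j : Fin m, s₂.real 4 j = a j := fun j => by rw [r2 4 (by norm_num), h4]
  refine (himp.det_pre a st s₂ h₂ hbest).mono fun s₃ i3 r3 h₃ => simulates_seq ?_
  replace i3 : ∀ b, b ≠ 2 → s₃.int b = s₂.int b := fun b hb =>
    i3 b fun hmem => hb (himp.int_pre b hmem)
  replace r3 : ∀ b, b ≠ 1 → b ≠ 3 → b ≠ 9 → s₃.real b = s₂.real b := fun b hb hb' hb'' =>
    r3 b fun hmem => by rcases himp.real_pre b hmem with h | h | h <;> contradiction
  have hst₁ := himp.nonneg_pre a st hr hst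
  unfold modifiedRound
  generalize pre a st = st₁ at h₃ hst₁ ⊢
  replace hbest : s₃.real 10 0 = 1 / minRatio c a := by
    rw [r3 10 (by norm_num) (by norm_num) (by norm_num), hbest]
  replace hk3 : s₃.int 3 0 = k := by rw [i3 3 (by norm_num), hk3]
  replace h4 : ∀ j : Fin m, s₃.real 4 j = a j := fun j => by
    rw [r3 4 (by norm_num) (by norm_num) (by norm_num), h4]
  refine (det_deficitCmd hq h₃ h4).mono fun s₄ i4 r4 hΔ => ?_
  replace i4 : ∀ b, b ≠ 2 → s₄.int b = s₃.int b := fun b hb =>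
    i4 b (by simp [deficitCmd, Cmd.intTargets, forColumns, hb])
  replace r4 : ∀ b, b ≠ 11 → s₄.real b = s₃.real b := fun b hb =>
    r4 b (by simp [deficitCmd, Cmd.realTargets, forColumns, hb])
  have h₄ : Represents q c st₁ s₄ := h₃.congr (i4 0 (by norm_num)) (i4 1 (by norm_num))
    (r4 0 (by norm_num)) (r4 3 (by norm_num)) (r4 1 (by norm_num)) (r4 9 (by norm_num))
  replace hbest : s₄.real 10 0 = 1 / minRatio c a := by rw [r4 10 (by norm_num), hbest]
  replace hk3 : s₄.int 3 0 = k := by rw [i4 3 (by norm_num), hk3]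
  replace h4 : ∀ j : Fin m, s₄.real 4 j = a j := fun j => by rw [r4 4 (by norm_num), h4]
  clear i1 i2 i3 i4 r1 r2 r3 r4 h₁ h₂ h₃ h h2
  have e1 : thresholdExpr.eval s₄ = threshold := by
    simp [thresholdExpr, natExpr, RExpr.eval, IExpr.eval, threshold]
  have e2 : (realVar 11).eval s₄ = deficit a st₁.z := hΔ
  rw [Cmd.run, e1, e2]
  split_ifs with hact
  swap
  · exact simulates_pure hq (h₄.congr rfl rfl rfl rfl rfl rfl)
  set s₅ := s₄.tick (thresholdExpr.size + (realVar 11).size + 1)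
  have h₅ : Represents q c st₁ s₅ := h₄.congr rfl rfl rfl rfl rfl rfl
  replace hbest : s₅.real 10 0 = 1 / minRatio c a := hbest
  replace hΔ : s₅.real 11 0 = deficit a st₁.z := hΔ
  replace hk3 : s₅.int 3 0 = k := hk3
  replace h4 : ∀ j : Fin m, s₅.real 4 j = a j := h4
  clear_value s₅
  refine simulates_seq ((det_scaleCmd h₅ hbest hΔ).mono fun s₆ i1 r1 ⟨hκ, h7⟩ => simulates_seq ?_)
  replace i1 : ∀ b, b ≠ 2 → s₆.int b = s₅.int b := fun b hb =>
    i1 b (by simp [scaleCmd, Cmd.intTargets, forColumns, hb])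
  replace r1 : ∀ b, b ≠ 12 → b ≠ 7 → s₆.real b = s₅.real b := fun b hb hb' =>
    r1 b (by simp [scaleCmd, Cmd.realTargets, forColumns, hb, hb'])
  have h₆ : Represents q c st₁ s₆ := h₅.congr (i1 0 (by norm_num)) (i1 1 (by norm_num))
    (r1 0 (by norm_num) (by norm_num)) (r1 3 (by norm_num) (by norm_num))
    (r1 1 (by norm_num) (by norm_num)) (r1 9 (by norm_num) (by norm_num))
  replace h4 : ∀ j : Fin m, s₆.real 4 j = a j := fun j => by
    rw [r1 4 (by norm_num) (by norm_num), h4]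
  replace hΔ : s₆.real 11 0 = deficit a st₁.z := by rw [r1 11 (by norm_num) (by norm_num), hΔ]
  replace hk3 : s₆.int 3 0 = k := by rw [i1 3 (by norm_num), hk3]
  refine (det_learnCmd h₆ h4 hΔ hκ).mono fun s₇ i2 r2 h₇ => simulates_seq ?_
  replace i2 : ∀ b, b ≠ 2 → s₇.int b = s₆.int b := fun b hb =>
    i2 b (by simp [learnCmd, Cmd.intTargets, forColumns, hb])
  replace r2 : ∀ b, b ≠ 3 → b ≠ 9 → b ≠ 13 → b ≠ 14 → s₇.real b = s₆.real b :=
    fun b hb hb' hb'' hb''' =>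
      r2 b (by simp [learnCmd, Cmd.realTargets, forColumns, hb, hb', hb'', hb'''])
  refine (himp.det_post _ s₇ h₇).mono fun s₈ i3 r3 h₈ => simulates_seq ?_
  replace i3 : ∀ b, b ≠ 2 → s₈.int b = s₆.int b := fun b hb =>
    (i3 b fun hmem => hb (himp.int_post b hmem)).trans (i2 b hb)
  have r8 : ∀ b, b ≠ 1 → b ≠ 3 → b ≠ 9 → b ≠ 13 → b ≠ 14 → s₈.real b = s₆.real b :=
    fun b b1 b2 b3 b4 b5 => (r3 b fun hmem => by
      rcases himp.real_post b hmem with h | h | h <;> contradiction).trans (r2 b b2 b3 b4 b5)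
  have hz₈ : ∀ j : Fin m, s₈.int 1 j = q * st₁.z j := fun j => by
    rw [i3 1 (by norm_num), h₆.z]
  replace h7 : ∀ j : Fin m, s₈.real 7 j =
      deficit a st₁.z * minRatio c a * st₁.x j / st₁.β := fun j => by
    rw [r8 7 (by norm_num) (by norm_num) (by norm_num) (by norm_num) (by norm_num), h7]
  have he : s₈.real 11 0 / s₈.real 4 k = deficit a st₁.z / a k := by
    rw [r8 11 (by norm_num) (by norm_num) (by norm_num) (by norm_num) (by norm_num),
      r8 4 (by norm_num) (by norm_num) (by norm_num) (by norm_num) (by norm_num), hΔ, h4]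
  replace hk3 : s₈.int 3 0 = k := by rw [i3 3 (by norm_num), hk3]
  refine (det_greedyCmd (q := q) hk3 he).mono fun s₉ i4 r4 hz₉ => ?_
  replace i4 : s₉.int 0 = s₈.int 0 := i4 0 (by simp [greedyCmd, Cmd.intTargets])
  replace r4 : s₉.real = s₈.real := funext fun b =>
    r4 b (by simp [greedyCmd, Cmd.realTargets])
  -- The vector `y` was stored before the update of `x` and before a possible restart, so the
  -- rounding uses the `x` held when the purchase was computed. Buying the greedy column before the
  -- rounding leaves the sum unchanged and makes the random part come last.
  obtain ⟨F, hF, hF'⟩ := run_roundLoop (q := q) (s := s₉)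
    (y := fun j => deficit a st₁.z * minRatio c a * st₁.x j / st₁.β)
    (by rw [i4, h₈.dim]) (by simpa [r4] using h7)
    (fun j => div_nonneg (mul_nonneg (mul_nonneg (deficit_nonneg _) (minRatio_pos hc hr.2).le)
      (hst₁.1 j)) hst₁.2)
  rw [hF]
  refine simulates_map hq _ fun b => ?_
  obtain ⟨f1, f2, f3⟩ := hF' b
  rw [r4] at f1
  refine ⟨by rw [f2, i4, h₈.dim], fun j => by rw [f1, h₈.cost], fun j => by rw [f1, h₈.x],
    fun j => ?_, by rw [f1, h₈.β], by rw [f1, h₈.G]⟩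
  rw [f3, hz₉, hz₈]
  have hiff : IsArgmin c a j ↔ j = k := ⟨fun h => h.unique hk, fun h => h ▸ hk⟩
  simp only [buy, hiff]
  split_ifs with hj
  · rw [hj]
    ring
  · ring

theorem pmf_map_congr {S T : Type*} (p : PMF S) {f g : S → T} (h : ∀ s ∈ p.support, f s = g s) :
    p.map f = p.map g := by
  rw [PMF.map, PMF.map]
  ext t
  simp only [PMF.bind_apply]
  refine tsum_congr fun s => ?_
  by_cases hs : p s = 0
  · simp [hs]
  · simp [h s ((PMF.mem_support_iff _ _).2 hs)]

/-- The history of the solutions that a program holds. -/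
theorem solutions_eq (himp : Implements q c preCmd postCmd pre post) (hq : 0 < q)
    (hc : ∀ j, 0 < c j) {setup : Cmd} {β : ℝ} {st : AdaptState m} (hst : st.Nonneg)
    (hsetup : Det setup (Config.start c β) (Represents q c st)) {n : ℕ} {r : Fin n → Fin m → ℝ}
    (hr : ∀ t, IsRow (truncRow (r t))) :
    (OnlineProgram.mk setup (roundCmd q preCmd postCmd)).solutions c β r =
      (trajectory (fun a => modifiedRound pre post c (truncRow a)) n st r).map
        fun h t j => q * (h t).z j := by
  obtain ⟨s, hs, hrep⟩ := hsetup
  have hstep : ∀ t s, (Represents q c (s.state m q) s ∧ (s.state m q).Nonneg) →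
      ((roundCmd q preCmd postCmd).run (Config.load (r t) s)).map (Config.state m q) =
        modifiedRound pre post c (truncRow (r t)) (s.state m q) ∧
      ∀ s' ∈ ((roundCmd q preCmd postCmd).run (Config.load (r t) s)).support,
        Represents q c (s'.state m q) s' ∧ (s'.state m q).Nonneg := by
    rintro t s ⟨h1, h2⟩
    obtain ⟨h3, h4⟩ := simulates_roundCmd himp hq hc (hr t) h2 (s := Config.load (r t) s)
      (h1.congr rfl rfl (by simp [Config.load]) (by simp [Config.load]) (by simp [Config.load])
        (by simp [Config.load])) (fun j => by simp [Config.load, toArray])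
    refine ⟨h3, fun s' hs' => ⟨h4 s' hs', modifiedRound_nonneg himp hc (hr t) h2 ?_⟩⟩
    rw [← h3, PMF.mem_support_map_iff]
    exact ⟨s', hs', rfl⟩
  have hs0 : Represents q c (s.state m q) s ∧ (s.state m q).Nonneg := by
    rw [hrep.state_eq hq]
    exact ⟨hrep, hst⟩
  have h1 := trajectory_map
    (fun a s => (roundCmd q preCmd postCmd).run (Config.load a s))
    (fun a => modifiedRound pre post c (truncRow a)) (Config.state m q)
    (fun s => Represents q c (s.state m q) s ∧ (s.state m q).Nonneg) n s r hs0 hstep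
  rw [hrep.state_eq hq] at h1
  rw [OnlineProgram.solutions, OnlineProgram.run, hs, PMF.pure_bind, ← h1, PMF.map_comp]
  refine pmf_map_congr _ fun h hh => ?_
  ext t j
  have h2 := trajectory_invariant _
    (fun s => Represents q c (s.state m q) s ∧ (s.state m q).Nonneg) n s r hs0
    (fun t s hs => (hstep t s hs).2) h hh t
  exact h2.1.z j

end simulation

/-! ## The initialization -/

theorem det_initCmd {m : ℕ} (β : ℝ) (c : Fin m → ℝ) :
    Det initCmd (Config.start c β)
      (Represents 1 c ⟨(locInit β c).x, (locInit β c).z, β, 0⟩) := by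
  have h00 : (Config.start c β).int 0 0 = m := by simp [Config.start]
  have hc0 : ∀ j : Fin m, (Config.start c β).real 0 j = c j := fun j => by
    simp [Config.start, toArray]
  have hβ0 : (Config.start c β).real 1 0 = β := by simp [Config.start]
  refine det_seq ((det_forColumns_sum (A := 15) (fun j => if c j ≤ β then 1 else 0) h00 rfl
    (by simp [Cmd.realTargets]) fun j σ hj h1 h2 => ?_).mono fun s i1 r1 hs => ?_)
  · have h3 : σ.real 1 0 = β := by rw [h2 1 (by norm_num), hβ0]
    have h4 : σ.real 0 j = c j := by rw [h2 0 (by norm_num), hc0]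
    refine det_ifLt (fun hlt => det_skip ?_) fun hlt => det_setReal ?_ <;>
    simp [realVar, natExpr, colEntry, colExpr, RExpr.eval, IExpr.eval, hj, h3, h4,
      Config.putReal_real] at hlt ⊢
    · exact hlt
    · exact hlt
  · replace i1 : ∀ b, b ≠ 2 → s.int b = (Config.start c β).int b := fun b hb =>
      i1 b (by simp [Cmd.intTargets, forColumns, hb])
    replace r1 : ∀ b, b ≠ 15 → s.real b = (Config.start c β).real b := fun b hb =>
      r1 b (by simp [Cmd.realTargets, forColumns, hb])
    have hcard : s.real 15 0 = (Finset.univ.filter fun k => c k ≤ β).card := by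
      rw [hs]
      simp
    refine (det_forColumns_map (A := 3) (locInit β c).x (by rw [i1 0 (by norm_num), h00]) rfl
      (by simp [Cmd.realTargets]) fun j σ hj h1 h2 _ => ?_).mono fun t i2 r2 ht => ?_
    · have h3 : σ.real 1 0 = β := by rw [h2 1 (by norm_num), r1 1 (by norm_num), hβ0]
      have h4 : σ.real 0 j = c j := by rw [h2 0 (by norm_num), r1 0 (by norm_num), hc0]
      have h5 : σ.real 15 0 = (Finset.univ.filter fun k => c k ≤ β).card := by
        rw [h2 15 (by norm_num), hcard]
      refine det_ifLt (fun hlt => det_setReal ?_) fun hlt => det_setReal ?_ <;>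
      simp only [realVar, natExpr, colEntry, colExpr, RExpr.eval, IExpr.eval, hj, h3, h4, h5,
        Nat.cast_zero, Config.tick_int, Config.tick_real] at hlt ⊢
      · exact ⟨by simp [Config.putReal_real, locInit, hlt.not_ge],
          fun i hi => by simp [Config.putReal_real, hi]⟩
      · exact ⟨by simp [Config.putReal_real, locInit, not_lt.1 hlt],
          fun i hi => by simp [Config.putReal_real, hi]⟩
    · replace i2 : ∀ b, b ≠ 2 → t.int b = (Config.start c β).int b := fun b hb =>
        (i2 b (by simp [Cmd.intTargets, forColumns, hb])).trans (i1 b hb)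
      replace r2 : ∀ b, b ≠ 3 → b ≠ 15 → t.real b = (Config.start c β).real b := fun b hb hb' =>
        (r2 b (by simp [Cmd.realTargets, forColumns, hb])).trans (r1 b hb')
      refine ⟨by rw [i2 0 (by norm_num), h00], fun j => ?_, ht, fun j => ?_, ?_, ?_⟩
      · rw [r2 0 (by norm_num) (by norm_num), hc0]
      · rw [i2 1 (by norm_num)]
        simp [Config.start, locInit]
      · rw [r2 1 (by norm_num) (by norm_num), hβ0]
      · rw [r2 9 (by norm_num) (by norm_num)]
        simp [Config.start]

/-- No setup is needed: zeroed memory is already the initial state, with guess `0`. -/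
theorem det_skip_start {m : ℕ} (c : Fin m → ℝ) :
    Det .skip (Config.start c 0) (Represents 3 c (adaptInit m)) := by
  refine det_skip ⟨?_, fun j => ?_, fun j => ?_, fun j => ?_, ?_, ?_⟩ <;>
  simp [Config.start, adaptInit, toArray]

theorem locProgram_simple : locProgram.setup.Simple ∧ locProgram.serve.Simple := by
  simp [locProgram, initCmd, roundCmd, truncateCmd, bestCmd, deficitCmd, scaleCmd, learnCmd,
    greedyCmd, roundEntryCmd, forColumns, Cmd.Simple]

theorem adaptProgram_simple : adaptProgram.setup.Simple ∧ adaptProgram.serve.Simple := by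
  simp [adaptProgram, roundCmd, truncateCmd, bestCmd, deficitCmd, scaleCmd, learnCmd, raiseCmd,
    refuteCmd, restartCmd, greedyCmd, roundEntryCmd, forColumns, Cmd.Simple]

/-! ## The two algorithms -/

theorem trajectory_comp {S R R' : Type*} (serve : R' → S → PMF S) (f : R → R') :
    ∀ (n : ℕ) (s : S) (r : Fin n → R),
      trajectory (fun a => serve (f a)) n s r = trajectory serve n s fun t => f (r t)
  | 0, _, _ => rfl
  | n + 1, s, r => by
      simp only [trajectory, trajectory_comp serve f n]
      rfl

/-! ### Truncation of rows at 1 -/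

section rows
variable {m : ℕ} {a : Fin m → ℝ}

theorem truncRow_of_isRow (ha : IsRow a) : truncRow a = a :=
  funext fun j => min_eq_left (ha.1 j).2

theorem isRow_truncRow (h0 : ∀ j, 0 ≤ a j) (h : ∃ j, 0 < a j) : IsRow (truncRow a) := by
  obtain ⟨j, hj⟩ := h
  exact ⟨fun j => ⟨le_min (h0 j) zero_le_one, min_le_right _ _⟩, j, lt_min hj zero_lt_one⟩

/-- This uses integrality: one copy of a column with entry above `1` still covers the truncated row.
If no such column is used, then truncation changes nothing. -/
theorem one_le_dot_truncRow (h0 : ∀ j, 0 ≤ a j) {z : Fin m → ℕ} (h : 1 ≤ dot a (toReal z)) :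
    1 ≤ dot (truncRow a) (toReal z) := by
  by_cases hbig : ∃ j, 1 < a j ∧ z j ≠ 0
  · obtain ⟨j, hj, hz⟩ := hbig
    have h1 : truncRow a j * (z j : ℝ) ≤ dot (truncRow a) (toReal z) :=
      Finset.single_le_sum (f := fun j => truncRow a j * (z j : ℝ))
        (fun j _ => mul_nonneg (le_min (h0 j) zero_le_one) (Nat.cast_nonneg _)) (Finset.mem_univ j)
    rw [truncRow, min_eq_right hj.le, one_mul] at h1
    exact (Nat.one_le_cast.2 (Nat.one_le_iff_ne_zero.2 hz)).trans h1
  · push Not at hbig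
    refine h.trans (Finset.sum_le_sum fun j _ => ?_)
    by_cases hj : 1 < a j
    · simp [toReal, hbig j hj]
    · rw [truncRow, min_eq_left (not_lt.1 hj)]

theorem dot_truncRow_le (z : Fin m → ℕ) : dot (truncRow a) (toReal z) ≤ dot a (toReal z) :=
  Finset.sum_le_sum fun _ _ => mul_le_mul_of_nonneg_right (min_le_left _ _) (Nat.cast_nonneg _)

end rows

theorem lpOpt_nonneg {m n : ℕ} {A : Fin n → Fin m → ℝ} {c : Fin m → ℝ} (hc : ∀ j, 0 < c j) :
    0 ≤ lpOpt A c := by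
  refine Real.sInf_nonneg ?_
  rintro v ⟨x, hx, -, rfl⟩
  exact dot_nonneg (fun j => (hc j).le) hx

/-- The program carries out LearnOrCoverCIP. -/
theorem locProgram_solutions {m n : ℕ} {c : Fin m → ℝ} {β : ℝ} (hc : ∀ j, 0 < c j) (hβ : 0 ≤ β)
    {r : Fin n → Fin m → ℝ} (hr : ∀ t, IsRow (r t)) :
    locProgram.solutions c β r = learnOrCover β c r := by
  have hst : (AdaptState.mk (locInit β c).x (locInit β c).z β 0).Nonneg := by
    refine ⟨fun j => ?_, hβ⟩
    simp only [locInit]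
    split_ifs
    · exact div_nonneg hβ (mul_nonneg (hc j).le (Nat.cast_nonneg _))
    · exact le_rfl
  have htr : (fun t => truncRow (r t)) = r := funext fun t => truncRow_of_isRow (hr t)
  rw [locProgram, solutions_eq implements_skip one_pos hc hst (det_initCmd β c)
    (fun t => by rw [truncRow_of_isRow (hr t)]; exact hr t),
    trajectory_comp (modifiedRound (fun _ st => st) id c) truncRow, htr, learnOrCover]
  have h1 := trajectory_map (modifiedRound (fun _ st => st) id c) (locRound β c)
    AdaptState.toLoc (fun st => st.β = β) n ⟨(locInit β c).x, (locInit β c).z, β, 0⟩ r rfl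
    (fun t st h => modifiedRound_id c (r t) h)
  rw [show AdaptState.toLoc ⟨(locInit β c).x, (locInit β c).z, β, 0⟩ = locInit β c from rfl] at h1
  rw [← h1, PMF.map_comp]
  congr 1
  ext h t j
  simp [AdaptState.toLoc]

theorem adaptProgram_solutions {m n : ℕ} {c : Fin m → ℝ} (hc : ∀ j, 0 < c j)
    {r : Fin n → Fin m → ℝ} (hr : ∀ t, IsRow (truncRow (r t))) :
    adaptProgram.solutions c 0 r =
      (trajectory (adaptRound c) n (adaptInit m) fun t => truncRow (r t)).map
        fun h t j => 3 * (h t).z j := by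
  rw [adaptProgram, solutions_eq (implements_adapt hc) three_pos hc (st := adaptInit m)
    ⟨fun _ => le_rfl, le_rfl⟩ (det_skip_start c) hr,
    trajectory_comp (modifiedRound (AdaptState.raise c) (AdaptState.refute c) c) truncRow]
  rfl

theorem adaptProgram_isOnlineSolution {m n : ℕ} {c : Fin m → ℝ} (hc : ∀ j, 0 < c j)
    {r : Fin n → Fin m → ℝ} (hr0 : ∀ t j, 0 ≤ r t j) (hr : ∀ t, ∃ j, 0 < r t j)
    {z : Fin (n + 1) → Fin m → ℕ} (hz : z ∈ (adaptProgram.solutions c 0 r).support) :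
    IsOnlineSolution 1 r z := by
  have hrow : ∀ t, IsRow (truncRow (r t)) := fun t => isRow_truncRow (hr0 t) (hr t)
  rw [adaptProgram_solutions hc hrow, PMF.mem_support_map_iff] at hz
  obtain ⟨h, hh, rfl⟩ := hz
  obtain ⟨-, h1⟩ := trajectory_support _ _ _ _ h hh
  refine isOnlineSolution_of_step hr0
    (fun t j => Nat.mul_le_mul_left 3 ((adaptRound_support (hrow t) (h1 t)).1 j)) fun t => ?_
  have h2 := (adaptRound_support (hrow t) (h1 t)).2
  rw [dot_toReal_mul]
  have := dot_truncRow_le (a := r t) (h t.succ).z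
  push_cast
  linarith

/-- The comparison is with an integer solution, because a fractional one need not survive the
truncation. -/
theorem expectedCost_adaptProgram_le {m n : ℕ} {A : Fin n → Fin m → ℝ} {c : Fin m → ℝ}
    (hc : ∀ j, 0 < c j) (hA0 : ∀ i j, 0 ≤ A i j) (hA : ∀ i, ∃ j, 0 < A i j) (hmn : 2 ≤ m * n) :
    expectedCost 1 A c (adaptProgram.solutions c 0) ≤
      ENNReal.ofReal (3552 * Real.log (m * n) * ipOpt A c) := by
  have hn : 0 < n := Nat.pos_of_ne_zero fun h0 => by simp [h0] at hmn
  obtain ⟨z₀, hz₀⟩ := exists_integer_feasible hA0 hA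
  have hpos : 0 < ipOpt A c := by
    refine (minRatio_pos hc (hA ⟨0, hn⟩)).trans_le (le_csInf ⟨_, z₀, hz₀, rfl⟩ ?_)
    rintro v ⟨z, hz, rfl⟩
    exact minRatio_le_dot hc (hA0 _) (hA _) (fun j => Nat.cast_nonneg _) (hz _)
  -- A solution of cost below twice the optimum spares a proof that the infimum is attained; the
  -- loss turns `1776` into `3552`.
  obtain ⟨v, ⟨z, hz, rfl⟩, hv⟩ := exists_lt_of_csInf_lt (s := {v | ∃ z : Fin m → ℕ,
    (∀ i, 1 ≤ dot (A i) (toReal z)) ∧ v = dot c (toReal z)}) ⟨_, z₀, hz₀, rfl⟩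
    (show ipOpt A c < 2 * ipOpt A c by linarith)
  have hrow : ∀ i, IsRow (truncRow (A i)) := fun i => isRow_truncRow (hA0 i) (hA i)
  have h1 := mean_adaptRound_le (A := fun i => truncRow (A i)) (u := toReal z) hc
    (fun j => Nat.cast_nonneg _) hrow (fun i => one_le_dot_truncRow (hA0 i) (hz i)) hmn
  have h2 : ∀ σ : Equiv.Perm (Fin n), adaptProgram.solutions c 0 (fun t => A (σ t)) =
      (trajectory (adaptRound c) n (adaptInit m) fun t => truncRow (A (σ t))).map
        fun h t j => 3 * (h t).z j := fun σ => adaptProgram_solutions hc fun t => hrow (σ t)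
  simp only [expectedCost, h2, one_mul]
  refine h1.trans (ENNReal.ofReal_le_ofReal ?_)
  have hlog := (log_mul_lower hmn).2.2.2.2.1
  nlinarith

end CoveringIP

theorem mainTheorem2 :
    -- LearnOrCoverCIP, given `β` with `lpOpt ≤ β ≤ 2 lpOpt`
    (∃ (C : ℝ) (P : CoveringIP.OnlineProgram) (p : Polynomial ℕ), 0 < C ∧
      ∀ (m n : ℕ) (A : Fin n → Fin m → ℝ) (c : Fin m → ℝ) (β : ℝ),
        (∀ j, 0 < c j) → (∀ i j, 0 ≤ A i j ∧ A i j ≤ 1) → (∀ i, ∃ j, 0 < A i j) →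
        CoveringIP.lpOpt A c ≤ β → β ≤ 2 * CoveringIP.lpOpt A c →
          -- for every arrival order and all coins, `3 z` is feasible at all times
          (∀ σ : Equiv.Perm (Fin n),
            ∀ z ∈ (CoveringIP.learnOrCover β c fun t => A (σ t)).support,
              CoveringIP.IsOnlineSolution 3 (fun t => A (σ t)) z) ∧
          -- the algorithm is carried out by a program that runs in polynomial time
          (∀ σ : Equiv.Perm (Fin n),
            P.solutions c β (fun t => A (σ t)) =
                CoveringIP.learnOrCover β c (fun t => A (σ t)) ∧
              P.RunsWithin c β (fun t => A (σ t)) (p.eval (m + n))) ∧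
          -- the expected cost of `z`, and the competitive ratio of `3 z`
          (2 ≤ m * n →
            CoveringIP.expectedCost 1 A c (CoveringIP.learnOrCover β c) ≤
                ENNReal.ofReal (C * β * Real.log (m * n)) ∧
              CoveringIP.expectedCost 3 A c (CoveringIP.learnOrCover β c) ≤
                ENNReal.ofReal (C * Real.log (m * n) * CoveringIP.ipOpt A c))) ∧
    -- a polynomial-time competitive algorithm that is not given `β`
    (∃ (C : ℝ) (P : CoveringIP.OnlineProgram) (p : Polynomial ℕ), 0 < C ∧
      ∀ (m n : ℕ) (A : Fin n → Fin m → ℝ) (c : Fin m → ℝ),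
        (∀ j, 0 < c j) → (∀ i j, 0 ≤ A i j) → (∀ i, ∃ j, 0 < A i j) →
          (∀ σ : Equiv.Perm (Fin n),
            (∀ z ∈ (P.solutions c 0 fun t => A (σ t)).support,
              CoveringIP.IsOnlineSolution 1 (fun t => A (σ t)) z) ∧
            P.RunsWithin c 0 (fun t => A (σ t)) (p.eval (m + n))) ∧
          (2 ≤ m * n →
            CoveringIP.expectedCost 1 A c (P.solutions c 0) ≤
              ENNReal.ofReal (C * Real.log (m * n) * CoveringIP.ipOpt A c))) := by
  -- `816 = 3 · 136 · 2`, for the factor `3` of the solution and for `β ≤ 2 LP`.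
  refine ⟨⟨816, CoveringIP.locProgram, CoveringIP.locProgram.setup.cost +
      Polynomial.X * CoveringIP.locProgram.serve.cost, by norm_num,
      fun m n A c β hc hA01 hA hβ hβ' => ?_⟩,
    ⟨3552, CoveringIP.adaptProgram, CoveringIP.adaptProgram.setup.cost +
      Polynomial.X * CoveringIP.adaptProgram.serve.cost, by norm_num,
      fun m n A c hc hA0 hA => ?_⟩⟩
  · have hrow : ∀ i, CoveringIP.IsRow (A i) := fun i => ⟨hA01 i, hA i⟩
    have hβ0 : 0 ≤ β := (CoveringIP.lpOpt_nonneg hc).trans hβ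
    refine ⟨fun σ z hz => CoveringIP.learnOrCover_isOnlineSolution (fun t => hrow (σ t)) hz,
      fun σ => ⟨CoveringIP.locProgram_solutions hc hβ0 fun t => hrow (σ t),
        CoveringIP.runsWithin_cost CoveringIP.locProgram_simple.1
          CoveringIP.locProgram_simple.2 c β _⟩, fun hmn => ?_⟩
    have h1 := CoveringIP.expectedCost_learnOrCover_le hc hrow hβ hmn
    have hlog := (CoveringIP.log_mul_lower hmn).2.2.2.2.1
    have hlog0 : 0 ≤ Real.log (m * n) := by linarith
    refine ⟨h1.trans (ENNReal.ofReal_le_ofReal ?_), ?_⟩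
    · nlinarith [mul_nonneg hβ0 hlog0]
    · have h2 := CoveringIP.lpOpt_le_ipOpt hc (fun i j => (hA01 i j).1) hA
      rw [CoveringIP.expectedCost_mul 3]
      calc _ ≤ ((3 : ℕ) : ENNReal) * ENNReal.ofReal (136 * β * Real.log (m * n)) := by gcongr
        _ = ENNReal.ofReal (3 * (136 * β * Real.log (m * n))) := by
            rw [ENNReal.ofReal_mul (p := 3) (by norm_num), ENNReal.ofReal_ofNat, Nat.cast_ofNat]
        _ ≤ _ := by
            refine ENNReal.ofReal_le_ofReal ?_
            have h3 : β * Real.log (m * n) ≤ 2 * CoveringIP.ipOpt A c * Real.log (m * n) :=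
              mul_le_mul_of_nonneg_right (by linarith) hlog0
            linarith
  · exact ⟨fun σ => ⟨fun z hz => CoveringIP.adaptProgram_isOnlineSolution hc
        (fun t => hA0 (σ t)) (fun t => hA (σ t)) hz,
      CoveringIP.runsWithin_cost CoveringIP.adaptProgram_simple.1
        CoveringIP.adaptProgram_simple.2 c 0 _⟩,
      fun hmn => CoveringIP.expectedCost_adaptProgram_le hc hA0 hA hmn⟩
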